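/- **Setting.** States and actions live in $\mathbb{R}^d$ with the Euclidean norm. For a policy $\pi$ (a Markov kernel from states to actions), dynamics $f:\mathbb{R}^d\times\mathbb{R}^d\to\mathbb{R}^d$ and a probability measure $D$ on $\mathbb{R}^d$, $\Pr_{\pi,f,D}$ is the law of $(x_t,u_t)_{1\le t\le H}$ with $x_1\sim D$, $u_t\mid x_t\sim\pi(x_t)$, $x_{t+1}=f(x_t,u_t)$. - A map $g$ is $L$-Lipschitz if $\|g(z)-g(z')\|\le L\|z-z'\|$, and $M$-smooth if for all unit vectors $v$ the function $\langle v,g\rangle$ is $C^2$ with Hessian of operator norm at most $M$. - $f$ is $(C,\rho)$-E-IISS if any two trajectories $x_{t+1}=f(x_t,u_t)$, $x'_{t+1}=f(x'_t,u'_t)$ satisfy $\|x_{t+1}-x'_{t+1}\|\le C\rho^t\|x_1-x_1'\|+\sum_{k=1}^tC\rho^{t-k}\|u_k-u_k'\|$ for all $t\ge 1$. A pair $(\pi^\star,f)$ with $\pi^\star$ deterministic is $(C,\rho)$-E-IISS if $(x,u)\mapsto f(x,\pi^\star(x)+u)$ is. - An instance class $\mathcal I$ is a set of pairs $(\pi^\star,f)$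 of a deterministic policy and dynamics. $(\mathcal I,D)$ is $(R,L_0,M_0)$-regular if for every $(\pi^\star,f)\in\mathcal I$, $\pi^\star$ and $f$ are $L_0$-Lipschitz and $M_0$-smooth, and $\|x_t\|,\|u_t\|\le R$ for all $t$ almost surely under $\Pr_{\pi^\star,f,D}$. - $\mathcal C_{\mathrm{Lip}}$ is the class of costs $\mathrm{cost}(x_{1:H},u_{1:H})=\sum_{h=1}^H\tilde c(x_h,u_h)$ with $\tilde c$ $1$-Lipschitz and $[0,1]$-valued. - A policy is $(L,M)$-simple if its mean $\mathrm{mean}[\pi](x)=\mathbb{E}_{u\sim\pi(x)}[u]$ exists and is $L$-Lipschitz and $M$-smooth, and the law of $u-\mathrm{mean}[\pi](x)$, $u\sim\pi(x)$, does not depend on $x$. - An algorithm maps a sample of $n$ i.i.d. expert trajectories of length $H$ from $\Pr_{\pi^\star,f,D}$, possibly with extra randomness, to a policy $\hat\pi$. It is $(L,M)$-simple (resp. $\mathcal I$-proper) if for every sample $\hat\pi$ is almost surely $(L,M)$-simple (resp. an expert policy of $\mathcal I$). $\mathbb{E}_{\mathrm{alg}}$ denotes expectation over the sample and over $\hat\pi$.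 - $R_{\mathrm{expert}}(\hat\pi)=\sum_{t=1}^H\big(\mathbb{E}_{\pi^\star,f,D}\mathbb{E}_{\hat u\sim\hat\pi(x_t)}\|\hat u-\pi^\star(x_t)\|^2\big)^{1/2}$ and $R_{\mathrm{cost}}(\hat\pi)=\mathbb{E}_{\hat\pi,f,D}[\mathrm{cost}]-\mathbb{E}_{\pi^\star,f,D}[\mathrm{cost}]$. **Theorem.** There are universal constants $C\ge1$, $\rho\in(0,1)$, $R,L_0,M_0$ such that for all integers $k\ge1$, $s\ge2$, with $d=k+2$ and $\epsilon_n=n^{-s/k}$, there are constants $C_1,C_2,C_3,C_4>0$ depending only on $(k,s)$, an instance class $\mathcal I$ on $(\mathbb{R}^d,\mathbb{R}^d)$ and a cost in $\mathcal C_{\mathrm{Lip}}$ with the following properties. For all $(\pi^\star,f)\in\mathcal I$, both $f$ and $(\pi^\star,f)$ are $(C,\rho)$-E-IISS. For all $L,M\ge1$ there is an initial distribution $D$ (depending on $k,s,L,M$, not on $n,H$) such that $(\mathcal I,D)$ is $(R,L_0,M_0)$-regular and, for all $H\ge2$ and $n\ge1$: 1. every $\mathcal I$-proper algorithm is $(L_0,M_0)$-simple,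 and there is an $\mathcal I$-proper algorithm with $\mathbb{E}_{\mathrm{alg}}[R_{\mathrm{expert}}(\hat\pi)]\le C_1\epsilon_n$ for all $(\pi^\star,f)\in\mathcal I$; 2. for every $(L,M)$-simple algorithm there is $(\pi^\star,f)\in\mathcal I$ with $\mathbb{E}_{\mathrm{alg}}[R_{\mathrm{cost}}(\hat\pi)]\ge C_2\min\{1.05^H\epsilon_n,\,1/(L^2M)\}$; 3. $\Pr_{\pi^\star,f,D}[\mathrm{cost}(x_{1:H},u_{1:H})=0]=1$ for all $(\pi^\star,f)\in\mathcal I$; nevertheless, for every $(L,M)$-simple algorithm there is $(\pi^\star,f)\in\mathcal I$ with $$\mathbb{E}_{\mathrm{alg}}\Pr_{\hat\pi,f,D}\big[\mathrm{cost}(x_{1:H},u_{1:H})\ge C_3\min\{1.05^H\epsilon_n,\,L^{-2}M^{-1}\}\big]\ge C_4 .$$ -/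

import Mathlib

open MeasureTheory ProbabilityTheory

noncomputable section

namespace ImitationLearning

/-- States and control actions live in Euclidean spaces. -/
abbrev Vec (d : ℕ) := EuclideanSpace ℝ (Fin d)

/-- A dynamical map `(x, u) ↦ f x u`. -/
abbrev Dynamics (d m : ℕ) := Vec d → Vec m → Vec d

/-- A deterministic time-invariant policy. -/
abbrev DetPolicy (d m : ℕ) := Vec d → Vec m

/-- A (stochastic) time-invariant Markovian policy. -/
abbrev Policy (d m : ℕ) := Vec d → Measure (Vec m)

/-- A trajectory `((x₁, u₁), …, (x_H, u_H))`. -/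
abbrev Traj (d m H : ℕ) := Fin H → Vec d × Vec m

/-- A sample of `n` trajectories. -/
abbrev Sample (d m H n : ℕ) := Fin n → Traj d m H

/-- A deterministic policy, regarded as a stochastic one. -/
def DetPolicy.toPolicy {d m : ℕ} (π : DetPolicy d m) : Policy d m :=
  fun x => Measure.dirac (π x)

/-! ### Trajectory laws -/

/-- The law of the trajectory of length `H` with `x₁ = x`, `u_t ∼ π(x_t)`,
`x_{t+1} = f(x_t, u_t)`. -/
def rollout {d m : ℕ} (π : Policy d m) (f : Dynamics d m) :
    (H : ℕ) → Vec d → Measure (Traj d m H)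
  | 0, _ => Measure.dirac (fun i => i.elim0)
  | H + 1, x => (π x).bind fun u =>
      (rollout π f H (f x u)).map fun τ => (Fin.cons (x, u) τ : Traj d m (H + 1))

/-- The law `P_{π,f,D}` of the trajectory of length `H` with `x₁ ∼ D`. -/
def trajLaw {d m : ℕ} (π : Policy d m) (f : Dynamics d m) (D : Measure (Vec d)) (H : ℕ) :
    Measure (Traj d m H) :=
  D.bind (rollout π f H)

/-- For a policy given by a Markov kernel and measurable dynamics, the rollouts form a Markov
kernel, so that the measures above are what they are meant to be. -/
theorem rollout_measurable {d m : ℕ} (π : Kernel (Vec d) (Vec m)) [IsMarkovKernel π]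
    (f : Dynamics d m) (hf : Measurable fun p : Vec d × Vec m => f p.1 p.2) (H : ℕ) :
    Measurable (rollout π f H) ∧ ∀ x, IsProbabilityMeasure (rollout π f H x) := by
  induction H with
  | zero =>
    refine ⟨measurable_const, fun x => ?_⟩
    simp only [rollout]
    infer_instance
  | succ H ih =>
    let κ : Kernel (Vec d) (Traj d m H) := ⟨rollout π f H, ih.1⟩
    have : IsMarkovKernel κ := ⟨ih.2⟩
    let κ' : Kernel (Vec d × Vec m) (Traj d m H) := κ.comap (fun p => f p.1 p.2) hf
    let κ'' : Kernel (Vec d × Vec m) ((Vec d × Vec m) × Traj d m H) := Kernel.id ×ₖ κ'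
    have hcons : Measurable fun q : (Vec d × Vec m) × Traj d m H =>
        (Fin.cons q.1 q.2 : Traj d m (H + 1)) := by
      refine measurable_pi_lambda _ fun i => ?_
      refine Fin.cases ?_ (fun j => ?_) i
      · simpa using measurable_fst
      · simp only [Fin.cons_succ]
        exact (measurable_pi_apply j).comp measurable_snd
    let κ₃ : Kernel (Vec d × Vec m) (Traj d m (H + 1)) :=
      κ''.map fun q => (Fin.cons q.1 q.2 : Traj d m (H + 1))
    have h3 : IsMarkovKernel κ₃ := Kernel.IsMarkovKernel.map κ'' hcons
    have e3 : ∀ x u, κ₃ (x, u) =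
        (rollout π f H (f x u)).map fun τ => (Fin.cons (x, u) τ : Traj d m (H + 1)) := by
      intro x u
      have hc : Measurable fun τ : Traj d m H => ((x, u), τ) := measurable_prodMk_left
      simp only [κ₃, κ'', Kernel.map_apply _ hcons, Kernel.prod_apply, Kernel.id_apply,
        Measure.dirac_prod]
      rw [Measure.map_map hcons hc]
      rfl
    let κ₄ : Kernel (Vec d) (Traj d m (H + 1)) := κ₃ ∘ₖ (Kernel.id ×ₖ π)
    have e4 : ∀ x, κ₄ x = rollout π f (H + 1) x := by
      intro x
      simp only [κ₄, rollout, Kernel.comp_apply, Kernel.prod_apply, Kernel.id_apply,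
        Measure.dirac_prod]
      ext s hs
      have hc : Measurable fun u : Vec m => (x, u) := measurable_prodMk_left
      have hm : Measurable fun u => κ₃ (x, u) := κ₃.measurable.comp hc
      simp only [← e3]
      rw [Measure.bind_apply hs κ₃.measurable.aemeasurable, Measure.bind_apply hs hm.aemeasurable,
        lintegral_map (κ₃.measurable_coe hs) hc]
    have e5 : rollout π f (H + 1) = κ₄ := funext fun x => (e4 x).symm
    exact ⟨e5 ▸ κ₄.measurable, fun x => e4 x ▸ inferInstance⟩

/-! ### Lipschitz continuity, smoothness, stability -/

/-- `g` is `L`-Lipschitz. -/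
def IsLip {V W : Type*} [NormedAddCommGroup V] [NormedAddCommGroup W] (L : ℝ) (g : V → W) : Prop :=
  ∀ z z', ‖g z - g z'‖ ≤ L * ‖z - z'‖

/-- `g` is `M`-smooth: for each unit vector `v`, the function `⟨v, g⟩` is twice continuously
differentiable and its Hessian has operator norm at most `M` everywhere. -/
def IsSmooth {V W : Type*} [NormedAddCommGroup V] [NormedSpace ℝ V] [NormedAddCommGroup W]
    [InnerProductSpace ℝ W] (M : ℝ) (g : V → W) : Prop :=
  ∀ v : W, ‖v‖ = 1 →
    ContDiff ℝ 2 (fun z => inner ℝ v (g z)) ∧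
    ∀ z, ‖fderiv ℝ (fderiv ℝ fun z => inner ℝ v (g z)) z‖ ≤ M

/-- A function of state and action, as a function on the Euclidean product space
(`‖(x, u)‖² = ‖x‖² + ‖u‖²`). -/
def joint {d m : ℕ} {Y : Type*} (F : Vec d → Vec m → Y) : WithLp 2 (Vec d × Vec m) → Y :=
  fun p => F p.fst p.snd

/-- States visited from `x` under the input sequence `u`: `x₀ = x`, `x_{t+1} = f(x_t, u_t)`. -/
def states {d m : ℕ} (f : Dynamics d m) (x : Vec d) (u : ℕ → Vec m) : ℕ → Vec d
  | 0 => x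
  | t + 1 => f (states f x u t) (u t)

/-- `(C, ρ)`-exponential incremental input-to-state stability of `f` (time is counted from `0`). -/
def IsEIISS {d m : ℕ} (C ρ : ℝ) (f : Dynamics d m) : Prop :=
  ∀ (x x' : Vec d) (u u' : ℕ → Vec m) (t : ℕ),
    ‖states f x u (t + 1) - states f x' u' (t + 1)‖ ≤
      C * ρ ^ (t + 1) * ‖x - x'‖ + ∑ j ∈ Finset.range (t + 1), C * ρ ^ (t - j) * ‖u j - u' j‖

/-- The closed-loop system `(x, u) ↦ f(x, π(x) + u)`. -/
def closedLoop {d m : ℕ} (π : DetPolicy d m) (f : Dynamics d m) : Dynamics d m :=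
  fun x u => f x (π x + u)

/-! ### Instance classes and costs -/

/-- A class of pairs (deterministic expert policy, dynamics). -/
abbrev InstanceClass (d m : ℕ) := Set (DetPolicy d m × Dynamics d m)

/-- `(R, L, M)`-regularity of the problem family `(I, D)`. -/
def IsRegular {d m : ℕ} (R L M : ℝ) (I : InstanceClass d m) (D : Measure (Vec d)) : Prop :=
  ∀ p ∈ I,
    IsLip L p.1 ∧ IsSmooth M p.1 ∧ IsLip L (joint p.2) ∧ IsSmooth M (joint p.2) ∧
    ∀ H : ℕ, ∀ᵐ τ ∂(trajLaw p.1.toPolicy p.2 D H), ∀ t, ‖(τ t).1‖ ≤ R ∧ ‖(τ t).2‖ ≤ R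

/-- Admissible stage costs: `1`-Lipschitz in `(x, u)` with values in `[0, 1]`. -/
def IsLipCost {d m : ℕ} (c : Vec d → Vec m → ℝ) : Prop :=
  IsLip 1 (joint c) ∧ ∀ x u, 0 ≤ c x u ∧ c x u ≤ 1

/-- The additive cost `∑_h c(x_h, u_h)` of a trajectory. -/
def totalCost {d m H : ℕ} (c : Vec d → Vec m → ℝ) (τ : Traj d m H) : ℝ :=
  ∑ h, c (τ h).1 (τ h).2

/-! ### Simple policies and imitation learning algorithms -/

/-- The mean of a stochastic policy. -/
def meanPolicy {d m : ℕ} (π : Policy d m) : DetPolicy d m :=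
  fun x => ∫ u, u ∂(π x)

/-- `(L, M)`-simple policies: the mean exists, the law of the deviation from the mean does not
depend on the state, and the mean is `L`-Lipschitz and `M`-smooth. -/
def IsSimplePolicy {d m : ℕ} (L M : ℝ) (π : Policy d m) : Prop :=
  (∀ x, Integrable (fun u : Vec m => u) (π x)) ∧
  (∃ ν : Measure (Vec m), ∀ x, (π x).map (fun u => u - meanPolicy π x) = ν) ∧
  IsLip L (meanPolicy π) ∧ IsSmooth M (meanPolicy π)

/-- A randomized non-interactive imitation learning algorithm for `n` expert trajectories of
length `H`: given the sample `S` it draws a seed `ω` and returns the policy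
`x ↦ policy ((S, ω), x)`. -/
structure Algorithm (d m H n : ℕ) where
  Seed : Type
  [seedSpace : MeasurableSpace Seed]
  seedLaw : Kernel (Sample d m H n) Seed
  [seedMarkov : IsMarkovKernel seedLaw]
  policy : Kernel ((Sample d m H n × Seed) × Vec d) (Vec m)
  [policyMarkov : IsMarkovKernel policy]

attribute [instance] Algorithm.seedSpace Algorithm.seedMarkov Algorithm.policyMarkov

/-- The policy returned on sample `S` with seed `ω`. -/
def Algorithm.output {d m H n : ℕ} (alg : Algorithm d m H n) (S : Sample d m H n)
    (ω : alg.Seed) : Policy d m :=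
  fun x => alg.policy ((S, ω), x)

/-- On every sample, the returned policy is almost surely `(L, M)`-simple. -/
def Algorithm.IsSimple {d m H n : ℕ} (L M : ℝ) (alg : Algorithm d m H n) : Prop :=
  ∀ S, ∀ᵐ ω ∂(alg.seedLaw S), IsSimplePolicy L M (alg.output S ω)

/-- On every sample, the returned policy is almost surely one of the expert policies of `I`. -/
def Algorithm.IsProper {d m H n : ℕ} (I : InstanceClass d m) (alg : Algorithm d m H n) : Prop :=
  ∀ S, ∀ᵐ ω ∂(alg.seedLaw S), ∃ p ∈ I, alg.output S ω = p.1.toPolicy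

/-! ### Samples and risks -/

/-- The law of `n` i.i.d. expert trajectories of length `H`. -/
def sampleLaw {d m : ℕ} (p : DetPolicy d m × Dynamics d m) (D : Measure (Vec d)) (H n : ℕ) :
    Measure (Sample d m H n) :=
  Measure.pi fun _ => trajLaw p.1.toPolicy p.2 D H

/-- Expert-distribution error
`∑_t (E_{x_t ∼ expert} E_{û ∼ π̂(x_t)} ‖û - π⋆(x_t)‖^q)^{1/q}`. -/
def expertRisk {d m : ℕ} (q : ℝ) (πhat : Policy d m) (p : DetPolicy d m × Dynamics d m)
    (D : Measure (Vec d)) (H : ℕ) : ENNReal :=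
  ∑ t : Fin H,
    (∫⁻ τ, ∫⁻ u, ‖u - p.1 (τ t).1‖ₑ ^ q ∂(πhat (τ t).1) ∂(trajLaw p.1.toPolicy p.2 D H)) ^ (1 / q)

/-- Execution error: expected cost of the imitator minus expected cost of the expert. -/
def costRisk {d m : ℕ} (c : Vec d → Vec m → ℝ) (πhat : Policy d m)
    (p : DetPolicy d m × Dynamics d m) (D : Measure (Vec d)) (H : ℕ) : ℝ :=
  (∫ τ, totalCost c τ ∂(trajLaw πhat p.2 D H)) -
    ∫ τ, totalCost c τ ∂(trajLaw p.1.toPolicy p.2 D H)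

/-- The rate `ε_n = n^{-s/k}`. -/
def rate (k s n : ℕ) : ℝ := (n : ℝ) ^ (-(s : ℝ) / (k : ℝ))

/-- `min {1.05^H ε_n, 1 / (L² M)}`. -/
def compoundedError (k s n H : ℕ) (L M : ℝ) : ℝ :=
  min ((1.05 : ℝ) ^ H * rate k s n) (1 / (L ^ 2 * M))

end ImitationLearning

end

/-!
Why the theorem is true. A state is written `(q, p, z)` with `z ∈ ℝ^k`. The instances are the systems
`(q, p, z), u ↦ (p, -9/16 q + 3/2 σ p + u₁ - g(x), 0)` with a sign `σ = ±1` and a perturbation `g`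
that depends on `z` only and vanishes for `z = 0`. The linear part has the double eigenvalue
`3/4 σ`, so the open loop is stable (`isEIISS_dyn`). The expert feeds back
`9/16 q - 3/2 σ p + g(x)`, which turns the closed loop into a stable shift register
(`isEIISS_closedLoop`). The cost is `min(1, |p|)`, and all initial states have `p = 0`, so the
expert never pays: its state is `0` from the second step on, and its data do not depend on `σ`.

*Statistics.* The perturbation is a sum of bumps of height about `N^{-s}` over the cells of a grid
with `N^k` cells, each with its own sign (`profile`); with `s ≥ 2` the profiles are uniformly smooth.
For `N^k ≥ n` a sample of size `n` misses a given cell with probability at least `2/3`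
(`measure_miss_ge`) and then carries no information on its sign, so the error in a typical cell is of
order `n^{-s/k}`. No larger error is necessary: the expert announces `N` by an idle coordinate of
its action, the signs are read off from the initial states on the plateaus of the bumps, and a cell
is missed with probability at most `exp(-c n / N^k)`, which balances `N^{-s}` for every `N`
(`exists_height_bound`, `learner_risk_le`).

*Control.* For a simple policy the deviation from the mean action has the same law in all states, so
all rollouts can be driven by the same noise (`rollout_eq_map_noisyTraj`), and the noise cancels in
the difference of two of them. Let `v_q, v_p` be the slopes at `0` of the second coordinate of the
mean action. If the rollouts from `0` and from `(r, 0, 0)` both have small cost, then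
`v_q` is close to `9/16` (`slope_of_coupled`): the policy must cancel `q` as the expert does. But
`|3/2 σ + v_p| ≥ 3/2` for one of the two signs, which the data do not reveal. For that sign the
difference of two rollouts grows by a factor of at least `1.05` per step as long as the rollouts stay
in the ball of radius of order `1/M` in which the mean action is nearly linear
(`growth_of_coupled`). The error in the first step, from the misjudged sign of a cell, is thus
amplified to `1.05^H n^{-s/k}`, or the cost reaches the order `1/M ≥ 1/(L²M)`.

On a common sample these two facts exclude that one policy does well on all four instances given
by the signs of the linear part and of one cell (`cellFailure_pair`). Averaging over all sign
patterns gives one instance with failure probability bounded below (`exists_inst_failure`), and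
Markov's inequality turns this into a bound for the expected cost (`integral_costRisk_ge`).
-/

noncomputable section

namespace ImitationLearning

/-! ### Bump profiles on a grid -/

/-- The last `k` coordinates of `x ∈ ℝ^{k+2}`, stretched by `k`. The stretching lets the unit cube
of `ℝ^k` parametrize initial states of norm at most `1`, for every `k`. -/
def gridCoord (k : ℕ) : Vec (k + 2) →L[ℝ] Vec k :=
  LinearMap.toContinuousLinearMap
    { toFun := fun x => WithLp.toLp 2 fun j => (k : ℝ) * x j.succ.succ
      map_add' := fun x y => by ext j; simp [mul_add]
      map_smul' := fun a x => by ext j; simp; ring }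

@[simp]
theorem gridCoord_apply (k : ℕ) (x : Vec (k + 2)) (j : Fin k) :
    gridCoord k x j = k * x j.succ.succ := rfl

theorem norm_gridCoord_le (k : ℕ) (x : Vec (k + 2)) : ‖gridCoord k x‖ ≤ k * ‖x‖ := by
  rw [EuclideanSpace.norm_eq, EuclideanSpace.norm_eq]
  apply Real.sqrt_le_iff.2 ⟨by positivity, ?_⟩
  rw [mul_pow, Real.sq_sqrt (by positivity), Fin.sum_univ_succ, Fin.sum_univ_succ]
  simp only [gridCoord_apply, norm_mul, mul_pow, ← Finset.mul_sum, RCLike.norm_natCast]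
  gcongr
  rw [← add_assoc]
  exact le_add_of_nonneg_left (by positivity)

/-- A smooth bump supported in the interior of the unit cube. -/
def cubeBump (k : ℕ) : ContDiffBump (WithLp.toLp 2 fun _ => 1 / 2 : Vec k) :=
  ⟨1 / 4, 1 / 3, by norm_num, by norm_num⟩

/-- The cells of the regular grid with `N ^ k` cells in the unit cube, named by their lowest
corner (in units of `1 / N`). -/
def cells (k N : ℕ) : Finset (Fin k → ℕ) := Fintype.piFinset fun _ => Finset.range N

theorem card_cells (k N : ℕ) : (cells k N).card = N ^ k := by simp [cells]

/-- The affine map sending the cell `j` of the grid to the unit cube. -/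
def cellChart (k N : ℕ) (j : Fin k → ℕ) (x : Vec (k + 2)) : Vec k :=
  (N : ℝ) • gridCoord k x - WithLp.toLp 2 fun i => (j i : ℝ)

/-- The bump over the cell `j`. -/
def cellBump (k N : ℕ) (j : Fin k → ℕ) (x : Vec (k + 2)) : ℝ := cubeBump k (cellChart k N j x)

theorem norm_cellChart_sub_le (k N : ℕ) (j : Fin k → ℕ) (x y : Vec (k + 2)) :
    ‖cellChart k N j x - cellChart k N j y‖ ≤ N * k * ‖x - y‖ := by
  rw [cellChart, cellChart, sub_sub_sub_cancel_right, ← smul_sub, ← map_sub, norm_smul,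
    RCLike.norm_natCast, mul_assoc]
  gcongr
  exact norm_gridCoord_le k _

theorem hasFDerivAt_cellChart (k N : ℕ) (j : Fin k → ℕ) (x : Vec (k + 2)) :
    HasFDerivAt (cellChart k N j) ((N : ℝ) • gridCoord k) x :=
  (((N : ℝ) • gridCoord k).hasFDerivAt (x := x)).sub_const (WithLp.toLp 2 fun i => (j i : ℝ))

theorem contDiff_cellBump (k N : ℕ) (j : Fin k → ℕ) : ContDiff ℝ 2 (cellBump k N j) := by
  refine (cubeBump k).contDiff.comp ?_
  exact (((N : ℝ) • gridCoord k).contDiff).sub contDiff_const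

theorem cellBump_nonneg (k N : ℕ) (j : Fin k → ℕ) (x : Vec (k + 2)) : 0 ≤ cellBump k N j x :=
  (cubeBump k).nonneg

theorem cellBump_le_one (k N : ℕ) (j : Fin k → ℕ) (x : Vec (k + 2)) : cellBump k N j x ≤ 1 :=
  (cubeBump k).le_one

theorem mem_cell_of_chart_mem {k N : ℕ} {j : Fin k → ℕ} {x : Vec (k + 2)}
    (h : cellChart k N j x ∈ Metric.closedBall (WithLp.toLp 2 fun _ => 1 / 2 : Vec k) (1 / 3))
    (i : Fin k) : (j i : ℝ) < N * gridCoord k x i ∧ N * gridCoord k x i < j i + 1 := by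
  have h1 : ‖(cellChart k N j x - (WithLp.toLp 2 fun _ => 1 / 2 : Vec k)) i‖ ≤ 1 / 3 :=
    (PiLp.norm_apply_le _ i).trans (by simpa [dist_eq_norm] using h)
  have h2 : (cellChart k N j x - (WithLp.toLp 2 fun _ => 1 / 2 : Vec k)) i =
      N * gridCoord k x i - j i - 1 / 2 := by
    simp [cellChart]
  rw [h2, Real.norm_eq_abs, abs_le] at h1
  constructor <;> linarith [h1.1, h1.2]

theorem cell_unique {k N : ℕ} {j j' : Fin k → ℕ} {x : Vec (k + 2)}
    (h : cellChart k N j x ∈ Metric.closedBall (WithLp.toLp 2 fun _ => 1 / 2 : Vec k) (1 / 3))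
    (h' : cellChart k N j' x ∈ Metric.closedBall (WithLp.toLp 2 fun _ => 1 / 2 : Vec k) (1 / 3)) :
    j = j' := by
  funext i
  have h1 := mem_cell_of_chart_mem h i
  have h2 := mem_cell_of_chart_mem h' i
  have h3 : (j i : ℝ) < j' i + 1 := by linarith
  have h4 : (j' i : ℝ) < j i + 1 := by linarith
  norm_cast at h3 h4
  omega

theorem chart_mem_of_cellBump_ne_zero {k N : ℕ} {j : Fin k → ℕ} {x : Vec (k + 2)}
    (h : cellBump k N j x ≠ 0) :
    cellChart k N j x ∈ Metric.closedBall (WithLp.toLp 2 fun _ => 1 / 2 : Vec k) (1 / 3) := by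
  by_contra hc
  refine h ((cubeBump k).zero_of_le_dist ?_)
  simpa [cubeBump] using (not_le.1 (fun h' => hc (Metric.mem_closedBall.2 h'))).le

theorem chart_mem_of_fderiv_ne_zero {k N : ℕ} {j : Fin k → ℕ} {x : Vec (k + 2)}
    (h : fderiv ℝ (cubeBump k) (cellChart k N j x) ≠ 0) :
    cellChart k N j x ∈ Metric.closedBall (WithLp.toLp 2 fun _ => 1 / 2 : Vec k) (1 / 3) := by
  have h1 := support_fderiv_subset ℝ (f := cubeBump k) h
  rwa [(cubeBump k).tsupport_eq] at h1

theorem cellBump_unique {k N : ℕ} {j j' : Fin k → ℕ} {x : Vec (k + 2)}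
    (h : cellBump k N j x ≠ 0) (h' : cellBump k N j' x ≠ 0) : j = j' :=
  cell_unique (chart_mem_of_cellBump_ne_zero h) (chart_mem_of_cellBump_ne_zero h')

theorem cellBump_zero_of_tail_eq_zero {k N : ℕ} (hk : 1 ≤ k) (j : Fin k → ℕ) {x : Vec (k + 2)}
    (hx : ∀ i : Fin k, x i.succ.succ = 0) : cellBump k N j x = 0 := by
  by_contra h
  have h1 := (mem_cell_of_chart_mem (chart_mem_of_cellBump_ne_zero h) ⟨0, hk⟩).1
  simp only [gridCoord_apply, hx, mul_zero] at h1
  exact (Nat.cast_nonneg (α := ℝ) _).not_gt h1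

/-- A sum of `B`-Lipschitz functions, at most one of which is nonzero at each point, is
`2 B`-Lipschitz, no matter how many summands there are. -/
theorem norm_sum_sub_sum_le_of_disjoint {ι E F : Type*} [NormedAddCommGroup E]
    [NormedAddCommGroup F] (s : Finset ι) (f : ι → E → F) (B : ℝ) (hB : 0 ≤ B)
    (hf : ∀ i ∈ s, ∀ x y, ‖f i x - f i y‖ ≤ B * ‖x - y‖)
    (hd : ∀ x, ∀ i ∈ s, ∀ j ∈ s, f i x ≠ 0 → f j x ≠ 0 → i = j) (x y : E) :
    ‖∑ i ∈ s, f i x - ∑ i ∈ s, f i y‖ ≤ 2 * B * ‖x - y‖ := by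
  classical
  rw [← Finset.sum_sub_distrib]
  -- only the indices active at `x` or at `y` contribute
  set t := s.filter fun i => f i x ≠ 0 ∨ f i y ≠ 0 with ht
  have h1 : ∑ i ∈ s, (f i x - f i y) = ∑ i ∈ t, (f i x - f i y) := by
    rw [ht, Finset.sum_filter_of_ne]
    intro i _ hi
    by_contra hc
    push Not at hc
    simp [hc.1, hc.2] at hi
  have h2 : t.card ≤ 2 := by
    rw [ht, Finset.filter_or]
    refine (Finset.card_union_le _ _).trans ?_
    have : ∀ z, (s.filter fun i => f i z ≠ 0).card ≤ 1 := fun z => by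
      rw [Finset.card_le_one]
      intro a ha b hb
      rw [Finset.mem_filter] at ha hb
      exact hd z a ha.1 b hb.1 ha.2 hb.2
    have hx := this x
    have hy := this y
    omega
  rw [h1]
  calc ‖∑ i ∈ t, (f i x - f i y)‖ ≤ ∑ i ∈ t, ‖f i x - f i y‖ := norm_sum_le _ _
    _ ≤ ∑ _i ∈ t, B * ‖x - y‖ :=
        Finset.sum_le_sum fun i hi => hf i (Finset.mem_of_mem_filter i hi) x y
    _ = t.card * (B * ‖x - y‖) := by rw [Finset.sum_const, nsmul_eq_mul]
    _ ≤ 2 * (B * ‖x - y‖) := by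
        gcongr
        exact_mod_cast h2
    _ = 2 * B * ‖x - y‖ := by ring

/-- The sign attached to the cell `j` by a set `T` of cells. -/
def cellSign {k : ℕ} (T : Finset (Fin k → ℕ)) (j : Fin k → ℕ) : ℝ := if j ∈ T then 1 else -1

theorem abs_cellSign {k : ℕ} (T : Finset (Fin k → ℕ)) (j : Fin k → ℕ) : |cellSign T j| = 1 := by
  unfold cellSign; split_ifs <;> simp

/-- The profile of height `κ N^{-s}` on the grid with `N ^ k` cells: a bump over every cell, with
positive sign on the cells in `T` and with negative sign elsewhere. -/
def profile (k s : ℕ) (κ : ℝ) (N : ℕ) (T : Finset (Fin k → ℕ)) (x : Vec (k + 2)) : ℝ :=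
  ∑ j ∈ cells k N, κ / N ^ s * cellSign T j * cellBump k N j x

theorem profile_zero_of_tail_eq_zero {k : ℕ} (hk : 1 ≤ k) (s : ℕ) (κ : ℝ) (N : ℕ)
    (T : Finset (Fin k → ℕ)) {x : Vec (k + 2)} (hx : ∀ i : Fin k, x i.succ.succ = 0) :
    profile k s κ N T x = 0 :=
  Finset.sum_eq_zero fun j _ => by rw [cellBump_zero_of_tail_eq_zero hk j hx, mul_zero]

theorem profile_eq_of_cellBump_ne_zero {k : ℕ} (s : ℕ) (κ : ℝ) {N : ℕ}
    (T : Finset (Fin k → ℕ)) {j : Fin k → ℕ} (hj : j ∈ cells k N) {x : Vec (k + 2)}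
    (hx : cellBump k N j x ≠ 0) :
    profile k s κ N T x = κ / N ^ s * cellSign T j * cellBump k N j x := by
  refine Finset.sum_eq_single_of_mem j hj fun i _ hij => ?_
  by_contra hc
  exact hij (cellBump_unique (right_ne_zero_of_mul hc) hx)

/-- Regularity of the perturbations used by the instances: `C²`, with values in `[-1, 1]`,
`1`-Lipschitz, with `1`-Lipschitz derivative, and vanishing on the plane of the first two
coordinates. -/
structure IsProfile {k : ℕ} (g : Vec (k + 2) → ℝ) : Prop where
  contDiff : ContDiff ℝ 2 g
  abs_le_one : ∀ x, |g x| ≤ 1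
  lip : ∀ x y, |g x - g y| ≤ ‖x - y‖
  lip_fderiv : ∀ x y, ‖fderiv ℝ g x - fderiv ℝ g y‖ ≤ ‖x - y‖
  eq_zero : ∀ x : Vec (k + 2), (∀ i : Fin k, x i.succ.succ = 0) → g x = 0

theorem exists_lipschitz_cubeBump (k : ℕ) : ∃ B : ℝ, 1 ≤ B ∧
    (∀ x y, ‖cubeBump k x - cubeBump k y‖ ≤ B * ‖x - y‖) ∧
    ∀ x y, ‖fderiv ℝ (cubeBump k) x - fderiv ℝ (cubeBump k) y‖ ≤ B * ‖x - y‖ := by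
  have hc : HasCompactSupport (cubeBump k) := (cubeBump k).hasCompactSupport
  have hs : ContDiff ℝ 2 (cubeBump k) := (cubeBump k).contDiff
  obtain ⟨C, hC⟩ := hs.lipschitzWith_of_hasCompactSupport hc (by norm_num)
  have hs' : ContDiff ℝ 1 (fderiv ℝ (cubeBump k)) := hs.fderiv_right (by norm_num)
  obtain ⟨C', hC'⟩ := hs'.lipschitzWith_of_hasCompactSupport (hc.fderiv ℝ) (by norm_num)
  refine ⟨1 + C + C', by linarith [C.2, C'.2, C.coe_nonneg, C'.coe_nonneg], fun x y => ?_,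
    fun x y => ?_⟩
  · refine (hC.norm_sub_le x y).trans ?_
    gcongr
    linarith [C'.coe_nonneg]
  · refine (hC'.norm_sub_le x y).trans ?_
    gcongr
    linarith [C.coe_nonneg]

theorem pow_mul_div_pow_le_one {N s : ℕ} (a : ℕ) (ha : a ≤ s) :
    (N : ℝ) ^ a / (N : ℝ) ^ s ≤ 1 := by
  rcases Nat.eq_zero_or_pos N with h | h
  · subst h
    rcases Nat.eq_zero_or_pos s with h' | h'
    · simp [h', Nat.le_zero.1 (h' ▸ ha)]
    · simp [zero_pow h'.ne']
  · have : (1 : ℝ) ≤ N := by exact_mod_cast h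
    exact div_le_one_of_le₀ (pow_le_pow_right₀ this ha) (by positivity)

/-- For amplitudes below a threshold depending only on `k`, the profiles of all grids are regular:
on the grid of mesh `1 / N`, two derivatives cost `N ^ 2`, which the height `N ^ (-s)` pays for. -/
theorem exists_isProfile {k : ℕ} (hk : 1 ≤ k) : ∃ κ : ℝ, 0 < κ ∧ κ ≤ 1 ∧
    ∀ s : ℕ, 2 ≤ s → ∀ N T, IsProfile (profile k s κ N T) := by
  obtain ⟨B, hB, hB1, hB2⟩ := exists_lipschitz_cubeBump k
  have hk' : (1 : ℝ) ≤ k := by exact_mod_cast hk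
  have hk2 : (k : ℝ) ≤ (k : ℝ) ^ 2 := by nlinarith
  have hden : 1 ≤ 2 * (B * (k : ℝ) ^ 2) := by nlinarith
  set κ : ℝ := 1 / (2 * (B * (k : ℝ) ^ 2)) with hκ
  have hκ0 : 0 < κ := by positivity
  have hκe : 2 * (κ * (B * (k : ℝ) ^ 2)) = 1 := by
    rw [hκ]; field_simp
  have hκ1 : κ ≤ 1 := by rw [hκ]; exact div_le_one_of_le₀ hden (by positivity)
  refine ⟨κ, hκ0, hκ1, fun s hs N T => ?_⟩
  have hcd : ∀ j, ContDiff ℝ 2 fun x => κ / N ^ s * cellSign T j * cellBump k N j x := fun j =>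
    contDiff_const.mul (contDiff_cellBump k N j)
  have hcoef : ∀ j, ‖κ / (N : ℝ) ^ s * cellSign T j‖ = κ / N ^ s := fun j => by
    rw [norm_mul, Real.norm_eq_abs, Real.norm_eq_abs, abs_cellSign, mul_one, abs_of_nonneg]
    positivity
  have hD : ∀ j x, fderiv ℝ (fun x => κ / N ^ s * cellSign T j * cellBump k N j x) x =
      (κ / N ^ s * cellSign T j) •
        (fderiv ℝ (cubeBump k) (cellChart k N j x)).comp ((N : ℝ) • gridCoord k) := by
    intro j x
    have h1 : HasFDerivAt (cubeBump k) (fderiv ℝ (cubeBump k) (cellChart k N j x))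
        (cellChart k N j x) :=
      (((cubeBump k).contDiff (n := 1)).differentiable (by norm_num) _).hasFDerivAt
    exact ((h1.comp x (hasFDerivAt_cellChart k N j x)).const_mul _).fderiv
  have hsum : ∀ x, fderiv ℝ (profile k s κ N T) x =
      ∑ j ∈ cells k N, fderiv ℝ (fun x => κ / N ^ s * cellSign T j * cellBump k N j x) x := by
    intro x
    exact fderiv_fun_sum fun j _ => ((hcd j).differentiable (by norm_num)) x
  have hgn : ‖gridCoord k‖ ≤ k :=
    ContinuousLinearMap.opNorm_le_bound _ (by positivity) (norm_gridCoord_le k)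
  refine ⟨ContDiff.sum fun j _ => hcd j, fun x => ?_, fun x y => ?_, fun x y => ?_,
    fun x hx => profile_zero_of_tail_eq_zero hk s κ N T hx⟩
  · by_cases h : ∃ j ∈ cells k N, cellBump k N j x ≠ 0
    · obtain ⟨j, hj, hx⟩ := h
      rw [profile_eq_of_cellBump_ne_zero s κ T hj hx, abs_mul, ← Real.norm_eq_abs, hcoef,
        abs_of_nonneg (cellBump_nonneg k N j x)]
      have h1 := pow_mul_div_pow_le_one (N := N) (s := s) 0 (by omega)
      rw [pow_zero] at h1
      calc κ / (N : ℝ) ^ s * cellBump k N j x ≤ κ * (1 / (N : ℝ) ^ s) * 1 := by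
            rw [mul_one_div]
            gcongr
            exact cellBump_le_one k N j x
        _ ≤ 1 * 1 * 1 := by gcongr
        _ = 1 := by norm_num
    · push Not at h
      rw [profile, Finset.sum_eq_zero fun j hj => by rw [h j hj, mul_zero]]
      simp
  · have h := norm_sum_sub_sum_le_of_disjoint (cells k N)
      (fun j x => κ / N ^ s * cellSign T j * cellBump k N j x) (κ * (B * (k : ℝ) ^ 2))
      (by positivity) (fun j _ x y => ?_) (fun x i _ j _ h1 h2 =>
        cellBump_unique (right_ne_zero_of_mul h1) (right_ne_zero_of_mul h2)) x y
    · rw [hκe, one_mul] at h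
      exact h
    · rw [← mul_sub, norm_mul, hcoef]
      have h1 := pow_mul_div_pow_le_one (N := N) (s := s) 1 (by omega)
      rw [pow_one] at h1
      calc κ / (N : ℝ) ^ s * ‖cellBump k N j x - cellBump k N j y‖
          ≤ κ / (N : ℝ) ^ s * (B * (N * k * ‖x - y‖)) := by
            gcongr
            refine (hB1 _ _).trans ?_
            gcongr
            exact norm_cellChart_sub_le k N j x y
        _ = κ * (B * k) * ‖x - y‖ * ((N : ℝ) / (N : ℝ) ^ s) := by ring
        _ ≤ κ * (B * (k : ℝ) ^ 2) * ‖x - y‖ * 1 := by gcongr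
        _ = _ := by ring
  · rw [hsum, hsum]
    have h := norm_sum_sub_sum_le_of_disjoint (cells k N)
      (fun j x => fderiv ℝ (fun x => κ / N ^ s * cellSign T j * cellBump k N j x) x)
      (κ * (B * (k : ℝ) ^ 2))
      (by positivity) (fun j _ x y => ?_) (fun x i _ j _ h1 h2 => ?_) x y
    · rw [hκe, one_mul] at h
      exact h
    · simp only [hD]
      rw [← smul_sub, ← ContinuousLinearMap.sub_comp, norm_smul, hcoef]
      have h1 := pow_mul_div_pow_le_one (N := N) (s := s) 2 hs
      calc κ / (N : ℝ) ^ s * ‖(fderiv ℝ (cubeBump k) (cellChart k N j x) -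
              fderiv ℝ (cubeBump k) (cellChart k N j y)).comp ((N : ℝ) • gridCoord k)‖
          ≤ κ / (N : ℝ) ^ s * (B * (N * k * ‖x - y‖) * (N * k)) := by
            gcongr
            refine (ContinuousLinearMap.opNorm_comp_le _ _).trans ?_
            gcongr
            · refine (hB2 _ _).trans ?_
              gcongr
              exact norm_cellChart_sub_le k N j x y
            · rw [norm_smul, RCLike.norm_natCast]
              gcongr
        _ = κ * (B * (k : ℝ) ^ 2) * ‖x - y‖ * ((N : ℝ) ^ 2 / (N : ℝ) ^ s) := by ring
        _ ≤ κ * (B * (k : ℝ) ^ 2) * ‖x - y‖ * 1 := by gcongr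
        _ = _ := by ring
    · simp only [hD] at h1 h2
      refine cell_unique (chart_mem_of_fderiv_ne_zero (k := k) (N := N) (j := i) (x := x) ?_)
        (chart_mem_of_fderiv_ne_zero (k := k) (N := N) (j := j) (x := x) ?_)
      · intro h3
        simp [h3] at h1
      · intro h3
        simp [h3] at h2

/-! ### The instances: regularity and stability -/

/-- The vector with first two coordinates `a`, `b` and all others zero. -/
def plane (k : ℕ) (a b : ℝ) : Vec (k + 2) := EuclideanSpace.single 0 a + EuclideanSpace.single 1 b

@[simp] theorem plane_zero (k : ℕ) (a b : ℝ) : plane k a b 0 = a := by simp [plane]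

@[simp] theorem plane_one (k : ℕ) (a b : ℝ) : plane k a b 1 = b := by simp [plane]

@[simp] theorem plane_succ_succ (k : ℕ) (a b : ℝ) (i : Fin k) : plane k a b i.succ.succ = 0 := by
  simp [plane, Fin.ext_iff]

theorem vec_ext {k : ℕ} {x y : Vec (k + 2)} (h0 : x 0 = y 0) (h1 : x 1 = y 1)
    (h : ∀ i : Fin k, x i.succ.succ = y i.succ.succ) : x = y := by
  ext i
  refine Fin.cases h0 (fun i => ?_) i
  exact Fin.cases h1 h i

@[simp] theorem plane_zero_zero (k : ℕ) : plane k 0 0 = 0 := by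
  apply vec_ext <;> simp

theorem plane_sub (k : ℕ) (a b a' b' : ℝ) :
    plane k a b - plane k a' b' = plane k (a - a') (b - b') := by
  apply vec_ext <;> simp

theorem norm_plane_le (k : ℕ) (a b : ℝ) : ‖plane k a b‖ ≤ |a| + |b| := by
  refine (norm_add_le _ _).trans ?_
  simp

theorem inner_plane (k : ℕ) (v : Vec (k + 2)) (a b : ℝ) :
    inner ℝ v (plane k a b) = v 0 * a + v 1 * b := by
  simp [plane, inner_add_right, EuclideanSpace.inner_single_right]
  ring

theorem continuous_plane (k : ℕ) : Continuous fun y : ℝ × ℝ => plane k y.1 y.2 := by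
  have e : (fun y : ℝ × ℝ => plane k y.1 y.2) = fun y => y.1 • plane k 1 0 + y.2 • plane k 0 1 := by
    funext y
    apply vec_ext <;> simp
  rw [e]
  fun_prop

theorem abs_coord_le {d : ℕ} (x : Vec d) (i : Fin d) : |x i| ≤ ‖x‖ :=
  PiLp.norm_apply_le x i

theorem abs_coord_sub_le {d : ℕ} (x y : Vec d) (i : Fin d) : |x i - y i| ≤ ‖x - y‖ :=
  PiLp.norm_apply_le (x - y) i

/-- The dynamics with sign `σ` and perturbation `g`. Writing `x = (q, p, z)`, the next state is
`(p, - 9/16 q + 3/2 σ p + u₁ - g(x), 0)`, where `u₁` is the second coordinate of the action. The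
linear part has the double eigenvalue `3/4 σ`. -/
def dyn {k : ℕ} (σ : ℝ) (g : Vec (k + 2) → ℝ) : Dynamics (k + 2) (k + 2) :=
  fun x u => plane k (x 1) (-(9 / 16) * x 0 + σ * (3 / 2) * x 1 + u 1 - g x)

/-- The expert for `dyn σ g`: it cancels the new value of `p`. The first coordinate `c` of its
action is idle. -/
def expert {k : ℕ} (σ c : ℝ) (g : Vec (k + 2) → ℝ) : DetPolicy (k + 2) (k + 2) :=
  fun x => plane k c (9 / 16 * x 0 - σ * (3 / 2) * x 1 + g x)

theorem closedLoop_expert {k : ℕ} (σ c : ℝ) (g : Vec (k + 2) → ℝ) (x u : Vec (k + 2)) :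
    closedLoop (expert σ c g) (dyn σ g) x u = plane k (x 1) (u 1) := by
  simp only [closedLoop, dyn, expert, PiLp.add_apply, plane_one]
  congr 1
  ring

theorem isLip_expert {k : ℕ} {σ : ℝ} (hσ : |σ| = 1) (c : ℝ) {g : Vec (k + 2) → ℝ}
    (hg : IsProfile g) : IsLip 6 (expert σ c g) := by
  intro x y
  rw [expert, expert, plane_sub]
  refine (norm_plane_le _ _ _).trans ?_
  rw [sub_self, abs_zero, zero_add]
  have e : 9 / 16 * x 0 - σ * (3 / 2) * x 1 + g x - (9 / 16 * y 0 - σ * (3 / 2) * y 1 + g y) =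
      9 / 16 * (x 0 - y 0) - σ * (3 / 2) * (x 1 - y 1) + (g x - g y) := by ring
  rw [e]
  refine (abs_add_le _ _).trans ?_
  refine (add_le_add_left (abs_sub _ _) _).trans ?_
  rw [abs_mul, abs_mul, abs_mul, hσ]
  have h0 := abs_coord_sub_le x y 0
  have h1 := abs_coord_sub_le x y 1
  have h2 := hg.lip x y
  rw [abs_of_pos (by norm_num : (0 : ℝ) < 9 / 16), abs_of_pos (by norm_num : (0 : ℝ) < 3 / 2)]
  nlinarith [norm_nonneg (x - y)]

theorem norm_dyn_sub_le {k : ℕ} {σ : ℝ} (hσ : |σ| = 1) {g : Vec (k + 2) → ℝ}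
    (hg : IsProfile g) (x y u w : Vec (k + 2)) :
    ‖dyn σ g x u - dyn σ g y w‖ ≤ 5 * ‖x - y‖ + ‖u - w‖ := by
  rw [dyn, dyn, plane_sub]
  refine (norm_plane_le _ _ _).trans ?_
  have e : -(9 / 16) * x 0 + σ * (3 / 2) * x 1 + u 1 - g x -
      (-(9 / 16) * y 0 + σ * (3 / 2) * y 1 + w 1 - g y) =
      (-(9 / 16) * (x 0 - y 0) + σ * (3 / 2) * (x 1 - y 1)) + ((u 1 - w 1) - (g x - g y)) := by ring
  rw [e]
  have h3 := (abs_add_le (-(9 / 16) * (x 0 - y 0) + σ * (3 / 2) * (x 1 - y 1))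
    ((u 1 - w 1) - (g x - g y)))
  have h4 := abs_add_le (-(9 / 16) * (x 0 - y 0)) (σ * (3 / 2) * (x 1 - y 1))
  have h5 := abs_sub (u 1 - w 1) (g x - g y)
  rw [abs_mul, abs_mul, abs_mul, hσ, abs_neg, abs_of_pos (by norm_num : (0 : ℝ) < 9 / 16),
    abs_of_pos (by norm_num : (0 : ℝ) < 3 / 2)] at h4
  have h0 := abs_coord_sub_le x y 0
  have h1 := abs_coord_sub_le x y 1
  have h2 := hg.lip x y
  have h6 := abs_coord_sub_le u w 1
  nlinarith [norm_nonneg (x - y)]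

theorem isLip_dyn {k : ℕ} {σ : ℝ} (hσ : |σ| = 1) {g : Vec (k + 2) → ℝ}
    (hg : IsProfile g) : IsLip 6 (joint (dyn σ g)) := by
  intro z w
  refine (norm_dyn_sub_le hσ hg _ _ _ _).trans ?_
  have h1 : ‖z.fst - w.fst‖ ≤ ‖z - w‖ := WithLp.norm_fst_le _ (z - w)
  have h2 : ‖z.snd - w.snd‖ ≤ ‖z - w‖ := WithLp.norm_snd_le _ (z - w)
  linarith

/-- Adding an affine function to a profile, precomposed with a contraction and scaled by a factor
at most `1`, leaves the Hessian bounded by `1`. -/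
theorem smooth_affine_add_profile {k : ℕ} {g : Vec (k + 2) → ℝ} (hg : IsProfile g)
    {V : Type*} [NormedAddCommGroup V] [NormedSpace ℝ V] (a : ℝ) (ℓ : V →L[ℝ] ℝ) {c : ℝ}
    (hc : |c| ≤ 1) (P : V →L[ℝ] Vec (k + 2)) (hP : ∀ z, ‖P z‖ ≤ ‖z‖) :
    ContDiff ℝ 2 (fun z => a + ℓ z + c * g (P z)) ∧
      ∀ z, ‖fderiv ℝ (fderiv ℝ fun z => a + ℓ z + c * g (P z)) z‖ ≤ 1 := by
  refine ⟨(contDiff_const.add ℓ.contDiff).add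
    (contDiff_const.mul (hg.contDiff.comp P.contDiff)), fun z => ?_⟩
  have hD : ∀ z, fderiv ℝ (fun z => a + ℓ z + c * g (P z)) z =
      ℓ + c • (fderiv ℝ g (P z)).comp P := fun z => by
    have h1 : HasFDerivAt g (fderiv ℝ g (P z)) (P z) :=
      (hg.contDiff.differentiable (by norm_num) _).hasFDerivAt
    exact ((ℓ.hasFDerivAt.const_add a).add ((h1.comp z P.hasFDerivAt).const_mul c)).fderiv
  have hP' : ‖P‖ ≤ 1 := P.opNorm_le_bound zero_le_one fun z => by simpa using hP z
  refine norm_fderiv_le_of_lip' ℝ zero_le_one (Filter.Eventually.of_forall fun w => ?_)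
  rw [hD, hD, add_sub_add_left_eq_sub, ← smul_sub, ← ContinuousLinearMap.sub_comp, norm_smul,
    Real.norm_eq_abs, one_mul]
  calc |c| * ‖(fderiv ℝ g (P w) - fderiv ℝ g (P z)).comp P‖
      ≤ 1 * (‖fderiv ℝ g (P w) - fderiv ℝ g (P z)‖ * ‖P‖) := by
        gcongr
        exact ContinuousLinearMap.opNorm_comp_le _ _
    _ ≤ 1 * (‖P (w - z)‖ * 1) := by
        gcongr
        rw [map_sub]
        exact hg.lip_fderiv _ _
    _ ≤ ‖w - z‖ := by
        rw [one_mul, mul_one]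
        exact hP _

theorem isSmooth_expert {k : ℕ} (σ c : ℝ) {g : Vec (k + 2) → ℝ}
    (hg : IsProfile g) : IsSmooth 1 (expert σ c g) := by
  intro v hv
  have h1 : |v 1| ≤ 1 := hv ▸ abs_coord_le v 1
  have e : (fun z => inner ℝ v (expert σ c g z)) = fun z => v 0 * c +
      ((v 1 * (9 / 16)) • EuclideanSpace.proj (𝕜 := ℝ) (0 : Fin (k + 2)) -
        (v 1 * (σ * (3 / 2))) • EuclideanSpace.proj (𝕜 := ℝ) (1 : Fin (k + 2)) :
          Vec (k + 2) →L[ℝ] ℝ) z +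
      v 1 * g (ContinuousLinearMap.id ℝ _ z) := by
    funext z
    simp only [expert, inner_plane, sub_apply, smul_apply,
      PiLp.proj_apply, smul_eq_mul, ContinuousLinearMap.id_apply]
    ring
  rw [e]
  exact smooth_affine_add_profile hg _ _ h1 _ fun z => le_rfl

theorem isSmooth_dyn {k : ℕ} (σ : ℝ) {g : Vec (k + 2) → ℝ}
    (hg : IsProfile g) : IsSmooth 1 (joint (dyn σ g)) := by
  intro v hv
  have h1 : |-v 1| ≤ 1 := by
    rw [abs_neg]
    exact hv ▸ abs_coord_le v 1
  let p0 : Vec (k + 2) →L[ℝ] ℝ := EuclideanSpace.proj (𝕜 := ℝ) (0 : Fin (k + 2))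
  let p1 : Vec (k + 2) →L[ℝ] ℝ := EuclideanSpace.proj (𝕜 := ℝ) (1 : Fin (k + 2))
  let F := WithLp.fstL 2 ℝ (Vec (k + 2)) (Vec (k + 2))
  let S := WithLp.sndL 2 ℝ (Vec (k + 2)) (Vec (k + 2))
  have e : (fun z => inner ℝ v (joint (dyn σ g) z)) = fun z => 0 +
      (v 0 • p1.comp F + v 1 • (-(9 / 16 : ℝ) • p0.comp F + (σ * (3 / 2)) • p1.comp F +
        p1.comp S)) z + (-v 1) * g (F z) := by
    funext z
    simp only [joint, dyn, inner_plane, add_apply,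
      smul_apply, smul_eq_mul, ContinuousLinearMap.comp_apply,
      p0, p1, F, S, PiLp.proj_apply, WithLp.fstL_apply, WithLp.sndL_apply]
    ring
  rw [e]
  exact smooth_affine_add_profile hg _ _ h1 _ fun z => WithLp.norm_fst_le _ z

theorem continuous_expert {k : ℕ} (σ c : ℝ) {g : Vec (k + 2) → ℝ} (hg : Continuous g) :
    Continuous (expert σ c g) := by
  refine (continuous_plane k).comp (f := fun x : Vec (k + 2) =>
    (c, 9 / 16 * x 0 - σ * (3 / 2) * x 1 + g x)) ?_
  fun_prop

theorem continuous_dyn {k : ℕ} (σ : ℝ) {g : Vec (k + 2) → ℝ} (hg : Continuous g) :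
    Continuous fun p : Vec (k + 2) × Vec (k + 2) => dyn σ g p.1 p.2 := by
  refine (continuous_plane k).comp (f := fun p : Vec (k + 2) × Vec (k + 2) =>
    (p.1 1, -(9 / 16) * p.1 0 + σ * (3 / 2) * p.1 1 + p.2 1 - g p.1)) ?_
  fun_prop

/-- Unrolling `W_{t+1} ≤ ρ W_t + K a_t`. -/
theorem lyapunov_unroll {ρ K A : ℝ} (hρ : 0 ≤ ρ) {W a : ℕ → ℝ}
    (h0 : W 1 ≤ A * ρ + K * a 0) (h : ∀ t, W (t + 2) ≤ ρ * W (t + 1) + K * a (t + 1)) (t : ℕ) :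
    W (t + 1) ≤ A * ρ ^ (t + 1) + ∑ j ∈ Finset.range (t + 1), K * ρ ^ (t - j) * a j := by
  induction t with
  | zero => simpa using h0
  | succ t ih =>
    refine (h t).trans ?_
    rw [Finset.sum_range_succ _ (t + 1)]
    have e : ∑ j ∈ Finset.range (t + 1), K * ρ ^ (t + 1 - j) * a j =
        ρ * ∑ j ∈ Finset.range (t + 1), K * ρ ^ (t - j) * a j := by
      rw [Finset.mul_sum]
      refine Finset.sum_congr rfl fun j hj => ?_
      rw [Nat.succ_sub (Nat.lt_succ_iff.1 (Finset.mem_range.1 hj)), pow_succ]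
      ring
    rw [e, Nat.sub_self, pow_zero, pow_succ ρ (t + 1)]
    nlinarith [mul_le_mul_of_nonneg_left ih hρ]

/-- A sequence `W` that bounds the distance of two trajectories and contracts by `ρ` up to the input
difference yields incremental stability. The contraction is required from the second state on only,
because the perturbation of the dynamics still acts on the initial state. -/
theorem isEIISS_of_lyapunov {d m : ℕ} {ρ K A B : ℝ} (hρ : 0 ≤ ρ) (hA : B * A ≤ 52)
    (hB : 0 ≤ B) (hK : B * K ≤ 52)
    {f : Dynamics d m} (h : ∀ (x x' : Vec d) (u u' : ℕ → Vec m), ∃ W : ℕ → ℝ,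
      (W 1 ≤ A * ρ * ‖x - x'‖ + K * ‖u 0 - u' 0‖) ∧
      (∀ t, W (t + 2) ≤ ρ * W (t + 1) + K * ‖u (t + 1) - u' (t + 1)‖) ∧
      ∀ t, ‖states f x u (t + 1) - states f x' u' (t + 1)‖ ≤ B * W (t + 1)) :
    IsEIISS 52 ρ f := by
  intro x x' u u' t
  obtain ⟨W, h1, h2, h3⟩ := h x x' u u'
  have h4 := lyapunov_unroll (A := A * ‖x - x'‖) (a := fun j => ‖u j - u' j‖) hρ
    (by linarith [h1]) h2 t
  refine (h3 t).trans ((mul_le_mul_of_nonneg_left h4 hB).trans ?_)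
  rw [mul_add, Finset.mul_sum]
  refine add_le_add ?_ (Finset.sum_le_sum fun j _ => ?_)
  · calc B * (A * ‖x - x'‖ * ρ ^ (t + 1)) = (B * A) * (ρ ^ (t + 1) * ‖x - x'‖) := by ring
      _ ≤ 52 * (ρ ^ (t + 1) * ‖x - x'‖) := by gcongr
      _ = _ := by ring
  · calc B * (K * ρ ^ (t - j) * ‖u j - u' j‖) = (B * K) * (ρ ^ (t - j) * ‖u j - u' j‖) := by ring
      _ ≤ 52 * (ρ ^ (t - j) * ‖u j - u' j‖) := by gcongr
      _ = _ := by ring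

/-- Open-loop stability. In the coordinates `q` and `r = p - 3/4 σ q` the linear part is triangular
with diagonal `3/4 σ`, so that `|q| + 8 |r|` contracts by `7/8`; the perturbation acts in the first
step only. -/
theorem isEIISS_dyn {k : ℕ} {σ : ℝ} (hσ : |σ| = 1) {g : Vec (k + 2) → ℝ}
    (hg : IsProfile g) : IsEIISS 52 (7 / 8) (dyn σ g) := by
  refine isEIISS_of_lyapunov (K := 8) (A := 26) (B := 2) (by norm_num) (by norm_num) (by norm_num)
    (by norm_num) fun x x' u u' => ?_
  set δ : ℕ → Vec (k + 2) := fun t => states (dyn σ g) x u t - states (dyn σ g) x' u' t with hδ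
  set V : Vec (k + 2) → ℝ := fun y => |y 0| + 8 * |y 1 - σ * (3 / 4) * y 0| with hV
  have hσ2 : σ * σ = 1 := by rw [← abs_mul_abs_self, hσ, one_mul]
  -- one step of the recursion, with the perturbation as an additional input
  have step : ∀ t, V (δ (t + 1)) ≤ 7 / 8 * V (δ t) + 8 * ‖u t - u' t‖ +
      8 * |g (states (dyn σ g) x u t) - g (states (dyn σ g) x' u' t)| := by
    intro t
    set y := states (dyn σ g) x u t
    set y' := states (dyn σ g) x' u' t
    have e0 : δ (t + 1) 0 = δ t 1 := by simp [hδ, states, dyn]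
    have e1 : δ (t + 1) 1 = -(9 / 16) * δ t 0 + σ * (3 / 2) * δ t 1 + (u t 1 - u' t 1) -
        (g y - g y') := by
      simp only [hδ, states, dyn, y, y', PiLp.sub_apply, plane_one]
      ring
    set q := δ t 0
    set p := δ t 1
    simp only [hV, e0, e1]
    have hp : |p| ≤ |p - σ * (3 / 4) * q| + 3 / 4 * |q| := by
      calc |p| = |(p - σ * (3 / 4) * q) + σ * (3 / 4) * q| := by ring_nf
        _ ≤ |p - σ * (3 / 4) * q| + |σ * (3 / 4) * q| := abs_add_le _ _
        _ = _ := by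
          rw [abs_mul, abs_mul, hσ, one_mul, abs_of_pos (by norm_num : (0 : ℝ) < 3 / 4)]
    have hr : |-(9 / 16) * q + σ * (3 / 2) * p + (u t 1 - u' t 1) - (g y - g y') -
        σ * (3 / 4) * p| ≤ 3 / 4 * |p - σ * (3 / 4) * q| + |u t 1 - u' t 1| + |g y - g y'| := by
      have e : -(9 / 16) * q + σ * (3 / 2) * p + (u t 1 - u' t 1) - (g y - g y') -
          σ * (3 / 4) * p = σ * (3 / 4) * (p - σ * (3 / 4) * q) + (u t 1 - u' t 1) -
            (g y - g y') := by linear_combination (9 / 16) * q * hσ2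
      rw [e]
      refine (abs_sub _ _).trans ?_
      gcongr
      refine (abs_add_le _ _).trans ?_
      gcongr
      rw [abs_mul, abs_mul, hσ, one_mul, abs_of_pos (by norm_num : (0 : ℝ) < 3 / 4)]
    have hu := abs_coord_sub_le (u t) (u' t) 1
    linarith [abs_nonneg q]
  refine ⟨fun t => V (δ t), ?_, fun t => ?_, fun t => ?_⟩
  · have h1 := step 0
    have h2 : |g (states (dyn σ g) x u 0) - g (states (dyn σ g) x' u' 0)| ≤ ‖x - x'‖ :=
      hg.lip x x'
    have h3 : V (δ 0) ≤ 15 * ‖x - x'‖ := by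
      have e : δ 0 = x - x' := rfl
      rw [e]
      have a0 := abs_coord_le (x - x') 0
      have a1 := abs_coord_le (x - x') 1
      have a2 : |(x - x') 1 - σ * (3 / 4) * (x - x') 0| ≤ |(x - x') 1| + 3 / 4 * |(x - x') 0| := by
        refine (abs_sub _ _).trans ?_
        rw [abs_mul (σ * (3 / 4)), abs_mul, hσ, one_mul,
          abs_of_pos (by norm_num : (0 : ℝ) < 3 / 4)]
      simp only [hV]
      linarith
    have h4 := norm_nonneg (x - x')
    linarith
  · have h1 := step (t + 1)
    have h2 : ∀ (x : Vec (k + 2)) (u : ℕ → Vec (k + 2)), g (states (dyn σ g) x u (t + 1)) = 0 :=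
      fun x u => hg.eq_zero _ fun i => by simp [states, dyn]
    rw [h2, h2, sub_zero, abs_zero] at h1
    linarith
  · have e : δ (t + 1) = plane k (δ (t + 1) 0) (δ (t + 1) 1) := by
      simp only [hδ, states, dyn, plane_sub, plane_zero, plane_one]
    change ‖δ (t + 1)‖ ≤ _
    have h1 := norm_plane_le k (δ (t + 1) 0) (δ (t + 1) 1)
    rw [← e] at h1
    set q := δ (t + 1) 0
    set p := δ (t + 1) 1
    have hp : |p| ≤ |p - σ * (3 / 4) * q| + 3 / 4 * |q| := by
      calc |p| = |(p - σ * (3 / 4) * q) + σ * (3 / 4) * q| := by ring_nf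
        _ ≤ |p - σ * (3 / 4) * q| + |σ * (3 / 4) * q| := abs_add_le _ _
        _ = _ := by
          rw [abs_mul, abs_mul, hσ, one_mul, abs_of_pos (by norm_num : (0 : ℝ) < 3 / 4)]
    change _ ≤ 2 * (|q| + 8 * |p - σ * (3 / 4) * q|)
    linarith [abs_nonneg q, abs_nonneg (p - σ * (3 / 4) * q)]

/-- Closed-loop stability: the closed loop is a shift register, which forgets its state after two
steps. -/
theorem isEIISS_closedLoop {k : ℕ} (σ c : ℝ) (g : Vec (k + 2) → ℝ) :
    IsEIISS 52 (7 / 8) (closedLoop (expert σ c g) (dyn σ g)) := by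
  refine isEIISS_of_lyapunov (K := 2) (A := 26) (B := 1) (by norm_num) (by norm_num) (by norm_num)
    (by norm_num) fun x x' u u' => ?_
  set f := closedLoop (expert σ c g) (dyn σ g)
  set δ : ℕ → Vec (k + 2) := fun t => states f x u t - states f x' u' t with hδ
  have e : ∀ t, δ (t + 1) = plane k (δ t 1) ((u t - u' t) 1) := fun t => by
    simp only [hδ, states, f, closedLoop_expert, plane_sub, PiLp.sub_apply]
  have hu : ∀ t, |(u t - u' t) 1| ≤ ‖u t - u' t‖ := fun t => abs_coord_le _ 1
  refine ⟨fun t => |δ t 0| + 2 * |δ t 1|, ?_, fun t => ?_, fun t => ?_⟩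
  · simp only [e 0, plane_zero, plane_one]
    have h1 : |δ 0 1| ≤ ‖x - x'‖ := abs_coord_le (x - x') 1
    linarith [hu 0, norm_nonneg (x - x')]
  · simp only [e (t + 1), plane_zero, plane_one]
    linarith [hu (t + 1), abs_nonneg (δ (t + 1) 0), abs_nonneg (δ (t + 1) 1)]
  · have h1 := norm_plane_le k (δ t 1) ((u t - u' t) 1)
    rw [← e] at h1
    change ‖δ (t + 1)‖ ≤ _
    have e0 : δ (t + 1) 0 = δ t 1 := by rw [e, plane_zero]
    have e1 : δ (t + 1) 1 = (u t - u' t) 1 := by rw [e, plane_one]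
    change _ ≤ 1 * (|δ (t + 1) 0| + 2 * |δ (t + 1) 1|)
    rw [e0, e1]
    linarith [abs_nonneg ((u t - u' t) 1)]

/-! ### Rollouts: dependence on parameters and noise representation -/

theorem measurable_cons {d m H : ℕ} : Measurable fun q : (Vec d × Vec m) × Traj d m H =>
    (Fin.cons q.1 q.2 : Traj d m (H + 1)) := by
  refine measurable_pi_lambda _ fun i => ?_
  refine Fin.cases ?_ (fun j => ?_) i
  · simpa using measurable_fst
  · simp only [Fin.cons_succ]
    exact (measurable_pi_apply j).comp measurable_snd

/-- The rollouts of a family of policies depending measurably on a parameter depend measurably on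
the parameter. -/
theorem exists_kernel_rollout {A : Type*} [MeasurableSpace A] {d m : ℕ}
    (π : Kernel (A × Vec d) (Vec m)) [IsMarkovKernel π] (f : Dynamics d m)
    (hf : Measurable fun p : Vec d × Vec m => f p.1 p.2) (H : ℕ) :
    ∃ κ : Kernel (A × Vec d) (Traj d m H), IsMarkovKernel κ ∧
      ∀ a x, κ (a, x) = rollout (fun y => π (a, y)) f H x := by
  induction H with
  | zero =>
    refine ⟨Kernel.const _ (Measure.dirac fun i => i.elim0), inferInstance, fun a x => ?_⟩
    simp [rollout]
  | succ H ih =>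
    obtain ⟨κ, hκ, e⟩ := ih
    let κ' : Kernel ((A × Vec d) × Vec m) (Traj d m H) :=
      κ.comap (fun p => (p.1.1, f p.1.2 p.2)) (by fun_prop)
    have h1 : Measurable fun p : (A × Vec d) × Vec m => (p.1.2, p.2) := by fun_prop
    let κ₃ : Kernel ((A × Vec d) × Vec m) (Traj d m (H + 1)) :=
      (Kernel.deterministic _ h1 ×ₖ κ').map fun q => (Fin.cons q.1 q.2 : Traj d m (H + 1))
    have h3 : IsMarkovKernel κ₃ := Kernel.IsMarkovKernel.map _ measurable_cons
    have e3 : ∀ a x u, κ₃ ((a, x), u) = (rollout (fun y => π (a, y)) f H (f x u)).map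
        fun τ => (Fin.cons (x, u) τ : Traj d m (H + 1)) := by
      intro a x u
      have hc : Measurable fun τ : Traj d m H => ((x, u), τ) := measurable_prodMk_left
      simp only [κ₃, κ', Kernel.map_apply _ measurable_cons, Kernel.prod_apply,
        Kernel.deterministic_apply, Measure.dirac_prod]
      rw [Measure.map_map measurable_cons hc, Kernel.comap_apply, e]
      rfl
    refine ⟨κ₃ ∘ₖ (Kernel.id ×ₖ π), inferInstance, fun a x => ?_⟩
    simp only [rollout, Kernel.comp_apply, Kernel.prod_apply, Kernel.id_apply, Measure.dirac_prod]
    ext s hs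
    have hc : Measurable fun u : Vec m => ((a, x), u) := measurable_prodMk_left
    have hm : Measurable fun u => κ₃ ((a, x), u) := κ₃.measurable.comp hc
    simp only [← e3]
    rw [Measure.bind_apply hs κ₃.measurable.aemeasurable, Measure.bind_apply hs hm.aemeasurable,
      lintegral_map (κ₃.measurable_coe hs) hc]

theorem measurable_rollout_preimage_cons {d m : ℕ} (π : Kernel (Vec d) (Vec m))
    [IsMarkovKernel π] (f : Dynamics d m) (hf : Measurable fun p : Vec d × Vec m => f p.1 p.2)
    (H : ℕ) (x : Vec d) {E : Set (Traj d m (H + 1))} (hE : MeasurableSet E) :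
    Measurable fun u => rollout π f H (f x u)
      ((fun τ => (Fin.cons (x, u) τ : Traj d m (H + 1))) ⁻¹' E) := by
  obtain ⟨h1, h2⟩ := rollout_measurable π f hf H
  let κ : Kernel (Vec m) (Traj d m H) :=
    ⟨fun u => rollout π f H (f x u), h1.comp (hf.comp measurable_prodMk_left)⟩
  have hκ : IsMarkovKernel κ := ⟨fun u => h2 _⟩
  have h3 : Measurable fun q : Vec m × Traj d m H =>
      (Fin.cons (x, q.1) q.2 : Traj d m (H + 1)) :=
    measurable_cons.comp (f := fun q : Vec m × Traj d m H => ((x, q.1), q.2)) (by fun_prop)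
  exact Kernel.measurable_kernel_prodMk_left (κ := κ) (h3 hE)

theorem rollout_succ_apply {d m : ℕ} (π : Kernel (Vec d) (Vec m)) [IsMarkovKernel π]
    (f : Dynamics d m) (hf : Measurable fun p : Vec d × Vec m => f p.1 p.2) (H : ℕ) (x : Vec d)
    {E : Set (Traj d m (H + 1))} (hE : MeasurableSet E) :
    rollout π f (H + 1) x E = ∫⁻ u, rollout π f H (f x u)
      ((fun τ => (Fin.cons (x, u) τ : Traj d m (H + 1))) ⁻¹' E) ∂(π x) := by
  have hc : ∀ u, Measurable fun τ : Traj d m H => (Fin.cons (x, u) τ : Traj d m (H + 1)) :=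
    fun u => measurable_cons.comp measurable_prodMk_left
  have hm : Measurable fun u => (rollout π f H (f x u)).map
      fun τ => (Fin.cons (x, u) τ : Traj d m (H + 1)) := by
    refine Measure.measurable_of_measurable_coe _ fun s hs => ?_
    simp only [Measure.map_apply (hc _) hs]
    exact measurable_rollout_preimage_cons π f hf H x hs
  rw [rollout, Measure.bind_apply hE hm.aemeasurable]
  exact lintegral_congr fun u => Measure.map_apply (hc u) hE

/-- The trajectory of length `H` from `x` under the policy `μ` with additive noise `w` on the
actions. -/
def noisyTraj {d m : ℕ} (μ : DetPolicy d m) (f : Dynamics d m) :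
    (H : ℕ) → Vec d → (Fin H → Vec m) → Traj d m H
  | 0, _, _ => fun i => i.elim0
  | H + 1, x, w => Fin.cons (x, μ x + w 0)
      (noisyTraj μ f H (f x (μ x + w 0)) (Fin.tail w))

theorem measurable_noisyTraj {d m : ℕ} {μ : DetPolicy d m} {f : Dynamics d m}
    (hμ : Measurable μ) (hf : Measurable fun p : Vec d × Vec m => f p.1 p.2) (H : ℕ) :
    Measurable fun p : Vec d × (Fin H → Vec m) => noisyTraj μ f H p.1 p.2 := by
  induction H with
  | zero => exact measurable_const
  | succ H ih =>
    have h1 : Measurable fun p : Vec d × (Fin (H + 1) → Vec m) => μ p.1 + p.2 0 :=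
      (hμ.comp measurable_fst).add ((measurable_pi_apply 0).comp measurable_snd)
    have h2 : Measurable fun p : Vec d × (Fin (H + 1) → Vec m) => (Fin.tail p.2 : Fin H → Vec m) :=
      measurable_pi_lambda _ fun i => (measurable_pi_apply i.succ).comp measurable_snd
    have h3 := ih.comp ((hf.comp (measurable_fst.prodMk h1)).prodMk h2)
    exact measurable_cons.comp ((measurable_fst.prodMk h1).prodMk h3)

/-- If the deviation from the mean has the same law `ν` in every state, then all rollouts, from
whatever initial state, are driven by the same i.i.d. noise. -/
theorem rollout_eq_map_noisyTraj {d m : ℕ} (π : Kernel (Vec d) (Vec m)) [IsMarkovKernel π]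
    {μ : DetPolicy d m} (hμ : Measurable μ) {f : Dynamics d m}
    (hf : Measurable fun p : Vec d × Vec m => f p.1 p.2)
    (ν : Measure (Vec m)) [IsProbabilityMeasure ν] (hπ : ∀ x, π x = ν.map fun w => μ x + w)
    (H : ℕ) (x : Vec d) :
    rollout π f H x = (Measure.pi fun _ => ν).map (noisyTraj μ f H x) := by
  have hmt : ∀ H x, Measurable (noisyTraj μ f H x) := fun H x =>
    (measurable_noisyTraj hμ hf H).comp measurable_prodMk_left
  induction H generalizing x with
  | zero =>
    have e : noisyTraj μ f 0 x = fun _ => fun i => i.elim0 := rfl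
    rw [e, Measure.map_const, measure_univ, one_smul]
    rfl
  | succ H ih =>
    ext E hE
    have hcons : ∀ y : Vec d × Vec m, Measurable
        fun τ : Traj d m H => (Fin.cons y τ : Traj d m (H + 1)) :=
      fun y => measurable_cons.comp measurable_prodMk_left
    have hint : Measurable fun u => rollout π f H (f x u)
        ((fun τ => (Fin.cons (x, u) τ : Traj d m (H + 1))) ⁻¹' E) :=
      measurable_rollout_preimage_cons π f hf H x hE
    rw [rollout_succ_apply π f hf H x hE, hπ, lintegral_map hint (measurable_const_add _),
      Measure.map_apply (hmt _ _) hE]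
    have hmp := measurePreserving_piFinSuccAbove (fun _ : Fin (H + 1) => ν) 0
    rw [← hmp.symm.measure_preimage ((hmt (H + 1) x) hE).nullMeasurableSet,
      Measure.prod_apply (hmp.symm.measurable ((hmt (H + 1) x) hE))]
    refine lintegral_congr fun w => ?_
    rw [ih, Measure.map_apply (hmt _ _) (hcons _ hE)]
    congr 1

theorem trajLaw_apply {d m : ℕ} (π : Kernel (Vec d) (Vec m)) [IsMarkovKernel π]
    (f : Dynamics d m) (hf : Measurable fun p : Vec d × Vec m => f p.1 p.2) (D : Measure (Vec d))
    (H : ℕ) {E : Set (Traj d m H)} (hE : MeasurableSet E) :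
    trajLaw π f D H E = ∫⁻ x, rollout π f H x E ∂D :=
  Measure.bind_apply hE (rollout_measurable π f hf H).1.aemeasurable

theorem trajLaw_toPolicy {d m : ℕ} {μ : DetPolicy d m} (hμ : Measurable μ) {f : Dynamics d m}
    (hf : Measurable fun p : Vec d × Vec m => f p.1 p.2) (D : Measure (Vec d)) (H : ℕ) :
    trajLaw μ.toPolicy f D H = D.map fun x => noisyTraj μ f H x 0 := by
  have hm : Measurable fun x => noisyTraj μ f H x 0 :=
    (measurable_noisyTraj hμ hf H).comp measurable_prodMk_right
  have h : rollout μ.toPolicy f H = fun x => Measure.dirac (noisyTraj μ f H x 0) := by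
    funext x
    have h1 := rollout_eq_map_noisyTraj (Kernel.deterministic μ hμ) hμ hf (Measure.dirac 0)
      (fun x => by
        rw [Kernel.deterministic_apply, Measure.map_dirac' (measurable_const_add _), add_zero]) H x
    have h2 : (⇑(Kernel.deterministic μ hμ) : Policy d m) = μ.toPolicy := by
      funext x
      rw [Kernel.deterministic_apply, DetPolicy.toPolicy]
    rw [h2] at h1
    have hpi : (Measure.pi fun _ : Fin H => (Measure.dirac 0 : Measure (Vec m))) =
        Measure.dirac 0 := by
      refine Measure.pi_eq fun s hs => ?_
      rw [Measure.dirac_apply' _ (MeasurableSet.univ_pi hs)]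
      simp only [Measure.dirac_apply' _ (hs _)]
      by_cases h : ∀ i, (0 : Vec m) ∈ s i
      · simp [h]
      · push Not at h
        obtain ⟨i, hi⟩ := h
        rw [Finset.prod_eq_zero (Finset.mem_univ i) (by simp [hi]),
          Set.indicator_of_notMem fun h' => hi (Set.mem_univ_pi.1 h' i)]
    have hmx : Measurable (noisyTraj μ f H x) :=
      (measurable_noisyTraj hμ hf H).comp measurable_prodMk_left
    rw [h1, hpi, Measure.map_dirac' hmx]
  rw [trajLaw, h, Measure.bind_dirac_eq_map _ hm]

/-! ### Exponential growth under coupled noise -/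

/-- The stage cost: the second coordinate of the state, truncated at `1`. -/
def stageCost (k : ℕ) : Vec (k + 2) → Vec (k + 2) → ℝ := fun x _ => min 1 |x 1|

theorem isLipCost_stageCost (k : ℕ) : IsLipCost (stageCost k) := by
  refine ⟨fun z w => ?_, fun x u => ⟨le_min zero_le_one (abs_nonneg _), min_le_left _ _⟩⟩
  rw [one_mul, joint, joint, stageCost, stageCost, Real.norm_eq_abs]
  refine (abs_min_sub_min_le_max _ _ _ _).trans (max_le (by simp) ?_)
  refine (abs_abs_sub_abs_le _ _).trans ((abs_coord_sub_le _ _ 1).trans ?_)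
  exact WithLp.norm_fst_le _ (z - w)

theorem totalCost_cons {d m H : ℕ} (c : Vec d → Vec m → ℝ) (y : Vec d × Vec m) (τ : Traj d m H) :
    totalCost c (Fin.cons y τ : Traj d m (H + 1)) = c y.1 y.2 + totalCost c τ := by
  simp [totalCost, Fin.sum_univ_succ]

theorem totalCost_nonneg {d m H : ℕ} {c : Vec d → Vec m → ℝ} (hc : IsLipCost c)
    (τ : Traj d m H) : 0 ≤ totalCost c τ :=
  Finset.sum_nonneg fun _ _ => (hc.2 _ _).1

theorem totalCost_le {d m H : ℕ} {c : Vec d → Vec m → ℝ} (hc : IsLipCost c)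
    (τ : Traj d m H) : totalCost c τ ≤ H := by
  refine (Finset.sum_le_sum fun h _ => (hc.2 (τ h).1 (τ h).2).2).trans ?_
  simp

theorem measurable_totalCost (k H : ℕ) :
    Measurable (totalCost (stageCost k) : Traj (k + 2) (k + 2) H → ℝ) := by
  unfold totalCost stageCost
  refine Finset.measurable_sum _ fun h _ => ?_
  fun_prop

theorem IsSmooth.continuous {V : Type*} [NormedAddCommGroup V] [NormedSpace ℝ V] {M : ℝ} {m : ℕ}
    {μ : V → Vec m} (h : IsSmooth M μ) : Continuous μ := by
  have e : μ = fun z => WithLp.toLp 2 fun i => inner ℝ (EuclideanSpace.single i (1 : ℝ)) (μ z) := by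
    funext z
    ext i
    simp [EuclideanSpace.inner_single_left]
  rw [e]
  refine (PiLp.continuous_toLp 2 _).comp (continuous_pi fun i => ?_)
  exact (h (EuclideanSpace.single i 1) (by simp)).1.continuous

/-- The coordinates of a smooth map are linear on small balls, up to an error proportional to the
radius. -/
theorem IsSmooth.exists_linear_approx {d m : ℕ} {M : ℝ} {μ : Vec d → Vec m}
    (h : IsSmooth M μ) (i : Fin m) : ∃ ℓ : Vec d →L[ℝ] ℝ, ∀ r : ℝ, ∀ x y, ‖x‖ ≤ r → ‖y‖ ≤ r →
      |μ x i - μ y i - ℓ (x - y)| ≤ M * r * ‖x - y‖ := by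
  obtain ⟨h1, h2⟩ := h (EuclideanSpace.single i 1) (by simp)
  have e : (fun z => inner ℝ (EuclideanSpace.single i (1 : ℝ)) (μ z)) = fun z => μ z i := by
    funext z
    simp [EuclideanSpace.inner_single_left]
  rw [e] at h1 h2
  set φ : Vec d → ℝ := fun z => μ z i
  have h3 : ContDiff ℝ 1 (fderiv ℝ φ) := h1.fderiv_right (by norm_num)
  have hM : 0 ≤ M := (ContinuousLinearMap.opNorm_nonneg _).trans (h2 0)
  refine ⟨fderiv ℝ φ 0, fun r x y hx hy => ?_⟩
  refine Convex.norm_image_sub_le_of_norm_fderiv_le' (𝕜 := ℝ) (f := φ)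
    (s := Metric.closedBall 0 r) (fun z _ => h1.differentiable (by norm_num) z) (fun z hz => ?_)
    (convex_closedBall _ _) (by simpa using hy) (by simpa using hx)
  have h4 := Convex.norm_image_sub_le_of_norm_fderiv_le (𝕜 := ℝ) (f := fderiv ℝ φ) (x := 0)
    (y := z) (fun z _ => h3.differentiable (by norm_num) z) (fun z _ => h2 z) convex_univ
    (Set.mem_univ _) (Set.mem_univ _)
  refine h4.trans ?_
  rw [sub_zero]
  gcongr
  simpa using hz

theorem linear_plane {k : ℕ} (ℓ : Vec (k + 2) →L[ℝ] ℝ) (a b : ℝ) :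
    ℓ (plane k a b) = ℓ (plane k 1 0) * a + ℓ (plane k 0 1) * b := by
  have e : plane k a b = a • plane k 1 0 + b • plane k 0 1 := by apply vec_ext <;> simp
  rw [e, map_add, map_smul, map_smul, smul_eq_mul, smul_eq_mul]
  ring

theorem abs_lt_of_totalCost_lt {k H : ℕ} {x u : Vec (k + 2)} {T : Traj (k + 2) (k + 2) H} {τ : ℝ}
    (hτ : τ ≤ 1)
    (h : totalCost (stageCost k) (Fin.cons (x, u) T : Traj (k + 2) (k + 2) (H + 1)) < τ) :
    |x 1| < τ ∧ totalCost (stageCost k) T < τ := by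
  rw [totalCost_cons] at h
  have h1 := totalCost_nonneg (isLipCost_stageCost k) T
  have h2 := ((isLipCost_stageCost k).2 x u).1
  refine ⟨?_, by linarith⟩
  have h3 : min 1 |x 1| < τ := by
    change stageCost k x u < τ
    linarith
  exact (min_lt_iff.1 h3).resolve_left (not_lt.2 hτ)

theorem noisyTraj_succ_dyn {k : ℕ} (μ : DetPolicy (k + 2) (k + 2)) (σ : ℝ) (g : Vec (k + 2) → ℝ)
    (H : ℕ) (x : Vec (k + 2)) (w : Fin (H + 1) → Vec (k + 2)) :
    noisyTraj μ (dyn σ g) (H + 1) x w = Fin.cons (x, μ x + w 0)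
      (noisyTraj μ (dyn σ g) H
        (plane k (x 1) (-(9 / 16) * x 0 + σ * (3 / 2) * x 1 + (μ x 1 + w 0 1) - g x))
        (Fin.tail w)) := by
  rw [noisyTraj, dyn, PiLp.add_apply]

/-- Two trajectories in the plane of the first two coordinates, driven by the same noise: as long
as the cost of both is small, the difference of their second coordinates grows by a factor `1.05`
in each step. The noise cancels, the closed loop is nearly linear on the small ball in which both
trajectories stay, the coefficient of `p` is at least `3/2` in absolute value and that of `q` is
small. -/
theorem growth_of_coupled {k : ℕ} {μ : DetPolicy (k + 2) (k + 2)} {M τ σ : ℝ}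
    {ℓ : Vec (k + 2) →L[ℝ] ℝ} (hτ : τ ≤ 1) (hMτ : 100 * (M * τ) ≤ 1)
    (hℓ : ∀ r : ℝ, ∀ x y, ‖x‖ ≤ r → ‖y‖ ≤ r → |μ x 1 - μ y 1 - ℓ (x - y)| ≤ M * r * ‖x - y‖)
    (h0 : |-(9 / 16) + ℓ (plane k 1 0)| ≤ 3 / 10) (h1 : 3 / 2 ≤ |σ * (3 / 2) + ℓ (plane k 0 1)|)
    {g : Vec (k + 2) → ℝ} (hg : ∀ a b, g (plane k a b) = 0) (H : ℕ) (q p q' p' : ℝ)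
    (w : Fin (H + 1) → Vec (k + 2)) (hq : |q| ≤ τ) (hq' : |q'| ≤ τ) (hqp : |q - q'| ≤ |p - p'|)
    (hc : totalCost (stageCost k) (noisyTraj μ (dyn σ g) (H + 1) (plane k q p) w) < τ)
    (hc' : totalCost (stageCost k) (noisyTraj μ (dyn σ g) (H + 1) (plane k q' p') w) < τ) :
    1.05 ^ H * |p - p'| ≤ 2 * τ := by
  induction H generalizing q p q' p' with
  | zero =>
    rw [noisyTraj_succ_dyn] at hc hc'
    have hp := (abs_lt_of_totalCost_lt hτ hc).1
    have hp' := (abs_lt_of_totalCost_lt hτ hc').1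
    rw [plane_one] at hp hp'
    rw [pow_zero, one_mul]
    linarith [abs_sub p p']
  | succ H ih =>
    rw [noisyTraj_succ_dyn] at hc hc'
    obtain ⟨hp, hc⟩ := abs_lt_of_totalCost_lt hτ hc
    obtain ⟨hp', hc'⟩ := abs_lt_of_totalCost_lt hτ hc'
    simp only [plane_one, plane_zero, hg, sub_zero] at hp hp' hc hc'
    set P := -(9 / 16) * q + σ * (3 / 2) * p + (μ (plane k q p) 1 + w 0 1)
    set P' := -(9 / 16) * q' + σ * (3 / 2) * p' + (μ (plane k q' p') 1 + w 0 1)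
    set v := ℓ (plane k 1 0)
    set v' := ℓ (plane k 0 1)
    have hstep : 1.05 * |p - p'| ≤ |P - P'| := by
      have h2 := hℓ (2 * τ) (plane k q p) (plane k q' p')
        ((norm_plane_le _ _ _).trans (by linarith)) ((norm_plane_le _ _ _).trans (by linarith))
      have h3 : ‖plane k (q - q') (p - p')‖ ≤ 2 * |p - p'| :=
        (norm_plane_le _ _ _).trans (by linarith)
      rw [plane_sub, linear_plane] at h2
      set E := μ (plane k q p) 1 - μ (plane k q' p') 1 - (v * (q - q') + v' * (p - p'))
      have hE : |E| ≤ 1 / 25 * |p - p'| := by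
        refine h2.trans ?_
        have hMτ' : M * (2 * τ) ≤ 1 / 50 := by linarith
        calc M * (2 * τ) * ‖plane k (q - q') (p - p')‖
            ≤ 1 / 50 * ‖plane k (q - q') (p - p')‖ := by gcongr
          _ ≤ 1 / 50 * (2 * |p - p'|) := by gcongr
          _ = _ := by ring
      have e : (σ * (3 / 2) + v') * (p - p') =
          (P - P') - ((-(9 / 16) + v) * (q - q') + E) := by
        simp only [P, P', E]
        ring
      have h4 : |(σ * (3 / 2) + v') * (p - p')| ≤
          |P - P'| + (3 / 10 * |p - p'| + 1 / 25 * |p - p'|) := by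
        rw [e]
        refine (abs_sub _ _).trans ?_
        gcongr
        refine (abs_add_le _ _).trans (add_le_add ?_ hE)
        rw [abs_mul]
        gcongr
      have h5 : 3 / 2 * |p - p'| ≤ |(σ * (3 / 2) + v') * (p - p')| := by
        rw [abs_mul]
        gcongr
      norm_num
      linarith [abs_nonneg (p - p')]
    have h6 := ih p P p' P' (Fin.tail w) hp.le hp'.le
      (by norm_num at hstep; linarith [abs_nonneg (p - p')]) hc hc'
    calc (1.05 : ℝ) ^ (H + 1) * |p - p'| = 1.05 ^ H * (1.05 * |p - p'|) := by ring
      _ ≤ 1.05 ^ H * |P - P'| := by gcongr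
      _ ≤ 2 * τ := h6

/-- If the trajectories from `0` and from `(r, 0, 0)` with the same noise both have small cost, then
the mean action cancels the contribution of `q`, up to a small error. -/
theorem slope_of_coupled {k : ℕ} {μ : DetPolicy (k + 2) (k + 2)} {M τ σ r : ℝ}
    {ℓ : Vec (k + 2) →L[ℝ] ℝ} (hτ : τ ≤ 1) (hr : 0 < r) (hMr : 10 * (M * r) ≤ 1)
    (hτr : 10 * τ ≤ r)
    (hℓ : ∀ r : ℝ, ∀ x y, ‖x‖ ≤ r → ‖y‖ ≤ r → |μ x 1 - μ y 1 - ℓ (x - y)| ≤ M * r * ‖x - y‖)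
    {g : Vec (k + 2) → ℝ} (hg : ∀ a b, g (plane k a b) = 0) (H : ℕ)
    (w : Fin (H + 2) → Vec (k + 2))
    (hc : totalCost (stageCost k) (noisyTraj μ (dyn σ g) (H + 2) 0 w) < τ)
    (hc' : totalCost (stageCost k) (noisyTraj μ (dyn σ g) (H + 2) (plane k r 0) w) < τ) :
    |-(9 / 16) + ℓ (plane k 1 0)| ≤ 3 / 10 := by
  rw [← plane_zero_zero, noisyTraj_succ_dyn] at hc
  rw [noisyTraj_succ_dyn] at hc'
  have hp := (abs_lt_of_totalCost_lt hτ hc).2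
  have hp' := (abs_lt_of_totalCost_lt hτ hc').2
  rw [noisyTraj_succ_dyn] at hp hp'
  replace hp := (abs_lt_of_totalCost_lt hτ hp).1
  replace hp' := (abs_lt_of_totalCost_lt hτ hp').1
  simp only [plane_one, plane_zero, hg] at hp hp'
  have h0 : ‖plane k r 0‖ ≤ r := (norm_plane_le _ _ _).trans (by simp [abs_of_pos hr])
  have h2 := hℓ r (plane k r 0) (plane k 0 0) h0 (by simpa using hr.le)
  rw [plane_sub, sub_zero, sub_zero, linear_plane, mul_zero, add_zero] at h2
  have h3 : M * r * ‖plane k r 0‖ ≤ 1 / 10 * r := by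
    have : M * r ≤ 1 / 10 := by linarith
    calc M * r * ‖plane k r 0‖ ≤ 1 / 10 * ‖plane k r 0‖ := by gcongr
      _ ≤ _ := by gcongr
  set v := ℓ (plane k 1 0)
  have e : |(-(9 / 16) + v) * r| ≤ 3 / 10 * r := by
    rw [abs_lt] at hp hp'
    rw [abs_le] at h2 ⊢
    constructor <;> linarith [hp.1, hp.2, hp'.1, hp'.2, h2.1, h2.2]
  rw [abs_mul, abs_of_pos hr] at e
  exact le_of_mul_le_mul_right e hr

/-- A policy with smooth mean fails for one of four instances: whatever the noise, one of the
trajectories from `0`, from `(r, 0, 0)` and from `x = (0, 0, z)` has a large cost. The sign of the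
linear part is chosen so that the mean action does not damp `p`, and the perturbation so that
the mean action at `x` does not cancel it. -/
theorem exists_instance_large_cost {k : ℕ} {μ : DetPolicy (k + 2) (k + 2)} {M τ r a : ℝ}
    (hμ : IsSmooth M μ) (hτ0 : 0 < τ) (hτ : τ ≤ 1) (hMτ : 100 * (M * τ) ≤ 1)
    (hr : 0 < r) (hMr : 10 * (M * r) ≤ 1) (hτr : 10 * τ ≤ r)
    {g g' : Vec (k + 2) → ℝ} (hg : ∀ a b, g (plane k a b) = 0)
    (hg' : ∀ a b, g' (plane k a b) = 0) {x : Vec (k + 2)} (hx0 : x 0 = 0) (hx1 : x 1 = 0)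
    (hgx : g x = a) (hgx' : g' x = -a) (H : ℕ) (ha : 2 * τ < 1.05 ^ H * a) :
    ∃ σ ∈ ({1, -1} : Finset ℝ), ∃ γ, (γ = g ∨ γ = g') ∧ ∀ w : Fin (H + 2) → Vec (k + 2),
      τ ≤ totalCost (stageCost k) (noisyTraj μ (dyn σ γ) (H + 2) 0 w) ∨
      τ ≤ totalCost (stageCost k) (noisyTraj μ (dyn σ γ) (H + 2) (plane k r 0) w) ∨
      τ ≤ totalCost (stageCost k) (noisyTraj μ (dyn σ γ) (H + 2) x w) := by
  obtain ⟨ℓ, hℓ⟩ := hμ.exists_linear_approx 1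
  have hσ : ∃ σ ∈ ({1, -1} : Finset ℝ), 3 / 2 ≤ |σ * (3 / 2) + ℓ (plane k 0 1)| := by
    rcases le_total 0 (ℓ (plane k 0 1)) with h | h
    · exact ⟨1, by simp, by rw [abs_of_nonneg] <;> linarith⟩
    · exact ⟨-1, by simp, by rw [abs_of_nonpos] <;> linarith⟩
  have hγ : ∃ γ, (γ = g ∨ γ = g') ∧ a ≤ |μ x 1 - μ 0 1 - γ x| := by
    rcases le_total 0 (μ x 1 - μ 0 1) with h | h
    · refine ⟨g', Or.inr rfl, ?_⟩
      rw [hgx']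
      exact le_trans (by linarith) (le_abs_self _)
    · refine ⟨g, Or.inl rfl, ?_⟩
      rw [hgx]
      exact le_trans (by linarith) (neg_le_abs _)
  obtain ⟨σ, hσm, hσ⟩ := hσ
  obtain ⟨γ, hγm, hγ⟩ := hγ
  have hγ0 : ∀ a b, γ (plane k a b) = 0 := by
    rcases hγm with h | h <;> rw [h] <;> assumption
  refine ⟨σ, hσm, γ, hγm, fun w => ?_⟩
  by_contra! hc
  obtain ⟨h1, h2, h3⟩ := hc
  have hslope := slope_of_coupled hτ hr hMr hτr hℓ hγ0 H w h1 h2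
  rw [← plane_zero_zero, noisyTraj_succ_dyn] at h1
  rw [noisyTraj_succ_dyn] at h3
  replace h1 := (abs_lt_of_totalCost_lt hτ h1).2
  replace h3 := (abs_lt_of_totalCost_lt hτ h3).2
  simp only [hx0, hx1, plane_zero, plane_one, hγ0] at h1 h3
  have h4 := growth_of_coupled hτ hMτ hℓ hslope hσ hγ0 H _ _ _ _ _
    (by simpa using hτ0.le) (by simpa using hτ0.le) (by simp) h3 h1
  have e : -(9 / 16) * 0 + σ * (3 / 2) * 0 + (μ x 1 + w 0 1) - γ x -
      (-(9 / 16) * 0 + σ * (3 / 2) * 0 + (μ (plane k 0 0) 1 + w 0 1) - 0) =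
      μ x 1 - μ 0 1 - γ x := by
    rw [plane_zero_zero]
    ring
  rw [e] at h4
  have h5 : (1.05 : ℝ) ^ H * a ≤ 1.05 ^ H * |μ x 1 - μ 0 1 - γ x| := by gcongr
  linarith

/-- The probability that the cost of the rollout from `x` is at least `τ`. -/
def exceed {k : ℕ} (π : Policy (k + 2) (k + 2)) (f : Dynamics (k + 2) (k + 2)) (H : ℕ) (τ : ℝ)
    (x : Vec (k + 2)) : ENNReal :=
  rollout π f H x {T | τ ≤ totalCost (stageCost k) T}

theorem measurableSet_le_totalCost (k H : ℕ) (τ : ℝ) :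
    MeasurableSet {T : Traj (k + 2) (k + 2) H | τ ≤ totalCost (stageCost k) T} :=
  measurableSet_le measurable_const (measurable_totalCost k H)

/-- For a suitable sign and a suitable one of the two perturbations, one of the three rollouts fails
whatever the noise, so that their failure probabilities sum to at least `1`. Driving the rollouts by
the same noise needs the law of the deviation from the mean action to be the same in all states. -/
theorem one_le_sum_exceed {k : ℕ} (π : Kernel (Vec (k + 2)) (Vec (k + 2))) [IsMarkovKernel π]
    {L M τ r a : ℝ} (hπ : IsSimplePolicy L M π) (hτ0 : 0 < τ) (hτ : τ ≤ 1)
    (hMτ : 100 * (M * τ) ≤ 1) (hr : 0 < r) (hMr : 10 * (M * r) ≤ 1) (hτr : 10 * τ ≤ r)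
    {g g' : Vec (k + 2) → ℝ} (hgc : Continuous g) (hgc' : Continuous g')
    (hg : ∀ a b, g (plane k a b) = 0)
    (hg' : ∀ a b, g' (plane k a b) = 0) {x : Vec (k + 2)} (hx0 : x 0 = 0) (hx1 : x 1 = 0)
    (hgx : g x = a) (hgx' : g' x = -a) (H : ℕ) (ha : 2 * τ < 1.05 ^ H * a) :
    1 ≤ ∑ σ ∈ ({1, -1} : Finset ℝ),
      ((exceed π (dyn σ g) (H + 2) τ 0 + exceed π (dyn σ g) (H + 2) τ (plane k r 0) +
        exceed π (dyn σ g) (H + 2) τ x) +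
      (exceed π (dyn σ g') (H + 2) τ 0 + exceed π (dyn σ g') (H + 2) τ (plane k r 0) +
        exceed π (dyn σ g') (H + 2) τ x)) := by
  obtain ⟨hint, ⟨ν, hν⟩, -, hsm⟩ := hπ
  have hμ : Measurable (meanPolicy π) := hsm.continuous.measurable
  obtain ⟨σ, hσ, γ, hγ, hlarge⟩ :=
    exists_instance_large_cost hsm hτ0 hτ hMτ hr hMr hτr hg hg' hx0 hx1 hgx hgx' H ha
  have hsub : ∀ b : Vec (k + 2), Measurable fun u : Vec (k + 2) => u - b :=
    fun b => measurable_sub_const b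
  have hνp : IsProbabilityMeasure ν := by
    rw [← hν 0]
    exact Measure.isProbabilityMeasure_map (hsub _).aemeasurable
  have hπν : ∀ x, π x = ν.map fun w => meanPolicy π x + w := fun y => by
    rw [← hν y, Measure.map_map (measurable_const_add _) (hsub _)]
    have e : ((fun w => meanPolicy π y + w) ∘ fun u => u - meanPolicy π y) = id := by
      funext u
      simp
    rw [e, Measure.map_id]
  have hγc : Continuous γ := by rcases hγ with h | h <;> rw [h] <;> assumption
  have hf := (continuous_dyn σ hγc).measurable
  have hE := measurableSet_le_totalCost k (H + 2) τ
  have key : 1 ≤ exceed π (dyn σ γ) (H + 2) τ 0 + exceed π (dyn σ γ) (H + 2) τ (plane k r 0) +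
      exceed π (dyn σ γ) (H + 2) τ x := by
    have hex : ∀ y, exceed π (dyn σ γ) (H + 2) τ y = (Measure.pi fun _ : Fin (H + 2) => ν)
        {w | τ ≤ totalCost (stageCost k) (noisyTraj (meanPolicy π) (dyn σ γ) (H + 2) y w)} := by
      intro y
      have hm : Measurable (noisyTraj (meanPolicy π) (dyn σ γ) (H + 2) y) :=
        (measurable_noisyTraj hμ hf (H + 2)).comp measurable_prodMk_left
      rw [exceed, rollout_eq_map_noisyTraj π hμ hf ν hπν, Measure.map_apply hm hE]
      rfl
    rw [hex, hex, hex]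
    calc (1 : ENNReal) = (Measure.pi fun _ : Fin (H + 2) => ν) Set.univ := measure_univ.symm
      _ ≤ _ := measure_mono (fun w _ => by
          rcases hlarge w with h | h | h
          · exact Or.inl (Or.inl h)
          · exact Or.inl (Or.inr h)
          · exact Or.inr h)
      _ ≤ _ := (measure_union_le _ _).trans (add_le_add_left (measure_union_le _ _) _)
  refine le_trans ?_ (Finset.single_le_sum (fun _ _ => zero_le) hσ)
  rcases hγ with h | h
  · exact key.trans (h ▸ le_self_add)
  · exact key.trans (h ▸ le_add_self)

/-! ### The initial distribution -/

/-- The state `(0, 0, ζ / k)`, whose grid coordinates are `ζ`. -/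
def gridPoint (k : ℕ) (ζ : Fin k → ℝ) : Vec (k + 2) :=
  WithLp.toLp 2 (Fin.cons 0 (Fin.cons 0 fun j => ζ j / k : Fin (k + 1) → ℝ) : Fin (k + 2) → ℝ)

@[simp] theorem gridPoint_zero (k : ℕ) (ζ : Fin k → ℝ) : gridPoint k ζ 0 = 0 := rfl

@[simp] theorem gridPoint_one (k : ℕ) (ζ : Fin k → ℝ) : gridPoint k ζ 1 = 0 := rfl

@[simp] theorem gridPoint_succ_succ (k : ℕ) (ζ : Fin k → ℝ) (j : Fin k) :
    gridPoint k ζ j.succ.succ = ζ j / k := rfl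

theorem gridCoord_gridPoint {k : ℕ} (hk : 1 ≤ k) (ζ : Fin k → ℝ) (j : Fin k) :
    gridCoord k (gridPoint k ζ) j = ζ j := by
  have : (k : ℝ) ≠ 0 := by positivity
  simp only [gridCoord_apply, gridPoint_succ_succ]
  field_simp

theorem measurable_gridPoint (k : ℕ) : Measurable (gridPoint k) := by
  refine (PiLp.continuous_toLp 2 _).measurable.comp (measurable_pi_lambda _ fun i => ?_)
  refine Fin.cases measurable_const (fun i => ?_) i
  refine Fin.cases measurable_const (fun i => ?_) i
  exact (measurable_pi_apply i).div_const _

theorem norm_gridPoint_le {k : ℕ} (hk : 1 ≤ k) {ζ : Fin k → ℝ} (hζ : ζ ∈ Set.Icc 0 1) :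
    ‖gridPoint k ζ‖ ≤ 1 := by
  have hk' : (1 : ℝ) ≤ k := by exact_mod_cast hk
  rw [EuclideanSpace.norm_eq, Fin.sum_univ_succ, Fin.sum_univ_succ]
  have h : ∀ j : Fin k, ‖gridPoint k ζ j.succ.succ‖ ^ 2 ≤ 1 / k := fun j => by
    rw [gridPoint_succ_succ, Real.norm_eq_abs, sq_abs, div_pow]
    have h0 : 0 ≤ ζ j := hζ.1 j
    have h1 : ζ j ≤ 1 := hζ.2 j
    rw [div_le_div_iff₀ (by positivity) (by positivity)]
    have h2 : ζ j ^ 2 ≤ 1 := pow_le_one₀ h0 h1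
    nlinarith
  refine Real.sqrt_le_one.2 ?_
  have e0 : ‖gridPoint k ζ 0‖ ^ 2 = 0 := by simp
  have e1 : ‖gridPoint k ζ (Fin.succ 0)‖ ^ 2 = 0 := by
    change ‖gridPoint k ζ 1‖ ^ 2 = 0
    simp
  rw [e0, e1, zero_add, zero_add]
  refine (Finset.sum_le_sum fun j _ => h j).trans ?_
  rw [Finset.sum_const, Finset.card_univ, Fintype.card_fin, nsmul_eq_mul]
  field_simp
  exact le_rfl

/-- The law of `(0, 0, ζ / k)` with `ζ` uniform on the unit cube. -/
def gridLaw (k : ℕ) : Measure (Vec (k + 2)) :=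
  ((volume : Measure (Fin k → ℝ)).restrict (Set.Icc 0 1)).map (gridPoint k)

instance (k : ℕ) : IsProbabilityMeasure (gridLaw k) := by
  have h : IsProbabilityMeasure ((volume : Measure (Fin k → ℝ)).restrict (Set.Icc 0 1)) :=
    ⟨by rw [Measure.restrict_apply_univ, Real.volume_Icc_pi]; simp⟩
  exact Measure.isProbabilityMeasure_map (measurable_gridPoint k).aemeasurable

theorem ae_gridLaw {k : ℕ} (hk : 1 ≤ k) : ∀ᵐ x ∂(gridLaw k), x 0 = 0 ∧ x 1 = 0 ∧ ‖x‖ ≤ 1 := by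
  have hm : MeasurableSet {x : Vec (k + 2) | x 0 = 0 ∧ x 1 = 0 ∧ ‖x‖ ≤ 1} := by
    refine (measurableSet_eq_fun ?_ measurable_const).inter
      ((measurableSet_eq_fun ?_ measurable_const).inter
        (measurableSet_le measurable_norm measurable_const)) <;> fun_prop
  refine (ae_map_iff (measurable_gridPoint k).aemeasurable hm).2 ?_
  filter_upwards [ae_restrict_mem measurableSet_Icc] with ζ hζ
  exact ⟨gridPoint_zero k ζ, gridPoint_one k ζ, norm_gridPoint_le hk hζ⟩

theorem measurable_cellBump (k N : ℕ) (j : Fin k → ℕ) : Measurable (cellBump k N j) :=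
  (contDiff_cellBump k N j).continuous.measurable

theorem measurableSet_plateau (k N : ℕ) (j : Fin k → ℕ) :
    MeasurableSet {x | cellBump k N j x = 1} :=
  measurable_cellBump k N j (measurableSet_singleton 1)

theorem measurableSet_cellBump_ne_zero (k N : ℕ) (j : Fin k → ℕ) :
    MeasurableSet {x | cellBump k N j x ≠ 0} :=
  measurable_cellBump k N j (measurableSet_singleton 0).compl

/-- The bump over a cell equals `1` on a fixed proportion of the cell. -/
theorem gridLaw_plateau_ge {k N : ℕ} (hk : 1 ≤ k) (hN : 1 ≤ N) {j : Fin k → ℕ}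
    (hj : j ∈ cells k N) :
    ENNReal.ofReal ((1 / (2 * k)) ^ k / N ^ k) ≤ gridLaw k {x | cellBump k N j x = 1} := by
  have hk' : (1 : ℝ) ≤ k := by exact_mod_cast hk
  have hN' : (1 : ℝ) ≤ N := by exact_mod_cast hN
  have hjN : ∀ i, (j i : ℝ) + 1 ≤ N := fun i => by
    have := Finset.mem_range.1 (Fintype.mem_piFinset.1 hj i)
    exact_mod_cast this
  set a : Fin k → ℝ := fun i => (j i + 1 / 2 - 1 / (4 * k)) / N
  set b : Fin k → ℝ := fun i => (j i + 1 / 2 + 1 / (4 * k)) / N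
  have hk4 : 1 / (4 * (k : ℝ)) ≤ 1 / 4 := by
    rw [div_le_div_iff₀ (by positivity) (by norm_num)]
    linarith
  have hvol : volume (Set.Icc a b) = ENNReal.ofReal ((1 / (2 * k)) ^ k / N ^ k) := by
    have e : ∀ i, b i - a i = 1 / (2 * k) / N := fun i => by
      simp only [a, b]
      field_simp
      ring
    rw [Real.volume_Icc_pi]
    simp only [e]
    rw [Finset.prod_const, Finset.card_univ, Fintype.card_fin, ← ENNReal.ofReal_pow (by positivity),
      div_pow]
  have hsub : Set.Icc a b ⊆ gridPoint k ⁻¹' {x | cellBump k N j x = 1} ∩ Set.Icc 0 1 := by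
    intro ζ hζ
    have hz : ∀ i, |N * ζ i - j i - 1 / 2| ≤ 1 / (4 * k) := fun i => by
      have h1 : (j i + 1 / 2 - 1 / (4 * k)) / N ≤ ζ i := hζ.1 i
      have h2 : ζ i ≤ (j i + 1 / 2 + 1 / (4 * k)) / N := hζ.2 i
      rw [div_le_iff₀ (by positivity)] at h1
      rw [le_div_iff₀ (by positivity)] at h2
      rw [abs_le]
      constructor <;> linarith
    refine ⟨?_, fun i => ?_, fun i => ?_⟩
    · refine (cubeBump k).one_of_mem_closedBall ?_
      rw [Metric.mem_closedBall, dist_eq_norm, EuclideanSpace.norm_eq]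
      change _ ≤ (1 / 4 : ℝ)
      refine Real.sqrt_le_iff.2 ⟨by norm_num, ?_⟩
      calc ∑ i, ‖(cellChart k N j (gridPoint k ζ) - WithLp.toLp 2 fun _ => 1 / 2 : Vec k) i‖ ^ 2
          ≤ ∑ _i : Fin k, (1 / (4 * (k : ℝ))) ^ 2 := by
            refine Finset.sum_le_sum fun i _ => ?_
            have e : (cellChart k N j (gridPoint k ζ) - WithLp.toLp 2 fun _ => 1 / 2 : Vec k) i =
                N * ζ i - j i - 1 / 2 := by
              simp only [cellChart, PiLp.sub_apply, PiLp.smul_apply, gridCoord_gridPoint hk,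
                smul_eq_mul]
            rw [e]
            exact pow_le_pow_left₀ (norm_nonneg _) (hz i) 2
        _ = 1 / (4 * k) * (1 / 4) := by
            rw [Finset.sum_const, Finset.card_univ, Fintype.card_fin, nsmul_eq_mul]
            field_simp
        _ ≤ 1 / 4 * (1 / 4) := by gcongr
        _ = (1 / 4) ^ 2 := by norm_num
    · have h1 : (j i + 1 / 2 - 1 / (4 * k)) / N ≤ ζ i := hζ.1 i
      refine le_trans ?_ h1
      have : (0 : ℝ) ≤ j i := Nat.cast_nonneg _
      exact div_nonneg (by linarith) (by positivity)
    · have h2 : ζ i ≤ (j i + 1 / 2 + 1 / (4 * k)) / N := hζ.2 i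
      refine h2.trans ?_
      exact div_le_one_of_le₀ (by linarith [hjN i]) (by positivity)
  rw [← hvol, gridLaw, Measure.map_apply (measurable_gridPoint k) (measurableSet_plateau k N j),
    Measure.restrict_apply (measurable_gridPoint k (measurableSet_plateau k N j))]
  exact measure_mono hsub

theorem gridLaw_support_le {k N : ℕ} (hk : 1 ≤ k) (hN : 1 ≤ N) (j : Fin k → ℕ) :
    gridLaw k {x | cellBump k N j x ≠ 0} ≤ ENNReal.ofReal (1 / N ^ k) := by
  have hN' : (1 : ℝ) ≤ N := by exact_mod_cast hN
  set a : Fin k → ℝ := fun i => j i / N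
  set b : Fin k → ℝ := fun i => (j i + 1) / N
  have hvol : volume (Set.Icc a b) = ENNReal.ofReal (1 / N ^ k) := by
    have e : ∀ i, b i - a i = 1 / N := fun i => by
      simp only [a, b]
      ring
    rw [Real.volume_Icc_pi]
    simp only [e]
    rw [Finset.prod_const, Finset.card_univ, Fintype.card_fin, ← ENNReal.ofReal_pow (by positivity),
      one_div_pow]
  have hsub : gridPoint k ⁻¹' {x | cellBump k N j x ≠ 0} ⊆ Set.Icc a b := by
    intro ζ hζ
    have h1 := mem_cell_of_chart_mem (chart_mem_of_cellBump_ne_zero hζ)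
    simp only [gridCoord_gridPoint hk] at h1
    refine ⟨fun i => ?_, fun i => ?_⟩
    · change (j i : ℝ) / N ≤ ζ i
      rw [div_le_iff₀ (by positivity)]
      linarith [(h1 i).1]
    · change ζ i ≤ (j i + 1) / N
      rw [le_div_iff₀ (by positivity)]
      linarith [(h1 i).2]
  rw [← hvol, gridLaw,
    Measure.map_apply (measurable_gridPoint k) (measurableSet_cellBump_ne_zero k N j)]
  exact (Measure.restrict_apply_le _ _).trans (measure_mono hsub)

/-- The initial distribution: the mixture in equal parts of the point masses at `0` and at
`(r, 0, 0)` and of the uniform law on the grid cube. -/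
def initLaw (k : ℕ) (r : ℝ) : Measure (Vec (k + 2)) :=
  (3 : ENNReal)⁻¹ • (Measure.dirac 0 + Measure.dirac (plane k r 0) + gridLaw k)

instance (k : ℕ) (r : ℝ) : IsProbabilityMeasure (initLaw k r) := by
  refine ⟨?_⟩
  simp only [initLaw, Measure.smul_apply, Measure.add_apply, measure_univ, smul_eq_mul]
  rw [one_add_one_eq_two, two_add_one_eq_three]
  exact ENNReal.inv_mul_cancel (by norm_num) (by norm_num)

theorem lintegral_initLaw (k : ℕ) (r : ℝ) (F : Vec (k + 2) → ENNReal) :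
    ∫⁻ x, F x ∂(initLaw k r) = 3⁻¹ * (F 0 + F (plane k r 0) + ∫⁻ x, F x ∂(gridLaw k)) := by
  rw [initLaw, lintegral_smul_measure, lintegral_add_measure, lintegral_add_measure,
    lintegral_dirac, lintegral_dirac, smul_eq_mul]

theorem ae_initLaw {k : ℕ} (hk : 1 ≤ k) {r : ℝ} (hr0 : 0 ≤ r) (hr : r ≤ 1) :
    ∀ᵐ x ∂(initLaw k r), x 1 = 0 ∧ ‖x‖ ≤ 1 := by
  have h : ∀ᵐ x ∂(Measure.dirac 0 + Measure.dirac (plane k r 0) + gridLaw k),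
      x 1 = 0 ∧ ‖x‖ ≤ 1 := by
    rw [ae_add_measure_iff, ae_add_measure_iff]
    refine ⟨⟨?_, ?_⟩, ?_⟩
    · rw [ae_dirac_eq]
      simp
    · rw [ae_dirac_eq]
      refine ⟨plane_one _ _ _, (norm_plane_le _ _ _).trans ?_⟩
      simpa [abs_of_nonneg hr0] using hr
    · filter_upwards [ae_gridLaw hk] with x hx
      exact ⟨hx.2.1, hx.2.2⟩
  exact Measure.ae_smul_measure h _

/-- The two atoms of the initial distribution lie outside all bumps. -/
theorem initLaw_cellBump {k N : ℕ} (hk : 1 ≤ k) (r : ℝ) (j : Fin k → ℕ) {s : Set ℝ}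
    (hs : MeasurableSet s) (h0 : (0 : ℝ) ∉ s) :
    initLaw k r {x | cellBump k N j x ∈ s} = 3⁻¹ * gridLaw k {x | cellBump k N j x ∈ s} := by
  have hm : MeasurableSet {x | cellBump k N j x ∈ s} := measurable_cellBump k N j hs
  have e : ∀ a b, cellBump k N j (plane k a b) = 0 := fun a b =>
    cellBump_zero_of_tail_eq_zero hk j fun i => plane_succ_succ k a b i
  have e0 : cellBump k N j 0 = 0 := by rw [← plane_zero_zero]; exact e 0 0
  rw [initLaw, Measure.smul_apply, Measure.add_apply, Measure.add_apply, smul_eq_mul,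
    Measure.dirac_apply' _ hm, Measure.dirac_apply' _ hm, Set.indicator_of_notMem,
    Set.indicator_of_notMem, zero_add, zero_add]
  · rw [Set.mem_ofPred_eq, e]
    exact h0
  · rw [Set.mem_ofPred_eq, e0]
    exact h0

/-! ### Expert trajectories -/

/-- The trajectory of the expert with perturbation `g` and idle action `c` from a state `x` with
`x 1 = 0`: the state vanishes from the second step on. The sign of the linear part plays no
role. -/
def expertTraj {k : ℕ} (c : ℝ) (g : Vec (k + 2) → ℝ) (H : ℕ) (x : Vec (k + 2)) :
    Traj (k + 2) (k + 2) H :=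
  fun t => if (t : ℕ) = 0 then (x, plane k c (9 / 16 * x 0 + g x)) else (0, plane k c 0)

theorem measurable_expertTraj {k : ℕ} (c : ℝ) {g : Vec (k + 2) → ℝ} (hg : Continuous g) (H : ℕ) :
    Measurable (expertTraj c g H) := by
  refine measurable_pi_lambda _ fun t => ?_
  unfold expertTraj
  split_ifs
  · refine measurable_id.prodMk ?_
    exact ((continuous_plane k).comp (f := fun x : Vec (k + 2) => (c, 9 / 16 * x 0 + g x))
      (by fun_prop)).measurable
  · exact measurable_const

theorem noisyTraj_expert_zero {k : ℕ} (σ c : ℝ) {g : Vec (k + 2) → ℝ} (hg : g 0 = 0) (H : ℕ)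
    (t : Fin H) : noisyTraj (expert σ c g) (dyn σ g) H 0 0 t = (0, plane k c 0) := by
  induction H with
  | zero => exact t.elim0
  | succ H ih =>
    have e : expert σ c g 0 = plane k c 0 := by simp [expert, hg]
    have e2 : dyn σ g 0 (plane k c 0) = 0 := by simp [dyn, hg]
    have e3 : (Fin.tail (0 : Fin (H + 1) → Vec (k + 2)) : Fin H → Vec (k + 2)) = 0 := rfl
    rw [noisyTraj, e, Pi.zero_apply, add_zero, e2, e3]
    refine Fin.cases ?_ (fun t => ?_) t
    · rw [Fin.cons_zero]
    · rw [Fin.cons_succ]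
      exact ih t

theorem noisyTraj_expert {k : ℕ} (σ c : ℝ) {g : Vec (k + 2) → ℝ} (hg : g 0 = 0) (H : ℕ)
    {x : Vec (k + 2)} (hx : x 1 = 0) :
    noisyTraj (expert σ c g) (dyn σ g) H x 0 = expertTraj c g H x := by
  cases H with
  | zero => exact funext fun t => t.elim0
  | succ H =>
    funext t
    have e : expert σ c g x = plane k c (9 / 16 * x 0 + g x) := by simp [expert, hx]
    have e2 : dyn σ g x (plane k c (9 / 16 * x 0 + g x)) = 0 := by
      rw [dyn, plane_one, hx, ← plane_zero_zero k]
      congr 1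
      ring
    have e3 : (Fin.tail (0 : Fin (H + 1) → Vec (k + 2)) : Fin H → Vec (k + 2)) = 0 := rfl
    rw [noisyTraj, Pi.zero_apply, add_zero, e, e2, e3]
    refine Fin.cases ?_ (fun t => ?_) t
    · rw [Fin.cons_zero]
      simp [expertTraj]
    · rw [Fin.cons_succ, noisyTraj_expert_zero σ c hg]
      simp [expertTraj]

/-- Under the expert, the law of the trajectory does not depend on `σ`. -/
theorem trajLaw_expert {k : ℕ} (σ c : ℝ) {g : Vec (k + 2) → ℝ} (hgc : Continuous g) (hg : g 0 = 0)
    {D : Measure (Vec (k + 2))} (hD : ∀ᵐ x ∂D, x 1 = 0) (H : ℕ) :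
    trajLaw (expert σ c g).toPolicy (dyn σ g) D H = D.map (expertTraj c g H) := by
  rw [trajLaw_toPolicy (continuous_expert σ c hgc).measurable (continuous_dyn σ hgc).measurable]
  refine Measure.map_congr ?_
  filter_upwards [hD] with x hx
  exact noisyTraj_expert σ c hg H hx

theorem sampleLaw_expert {k : ℕ} (σ c : ℝ) {g : Vec (k + 2) → ℝ} (hgc : Continuous g) (hg : g 0 = 0)
    {D : Measure (Vec (k + 2))} [IsProbabilityMeasure D] (hD : ∀ᵐ x ∂D, x 1 = 0) (H n : ℕ) :
    sampleLaw (expert σ c g, dyn σ g) D H n =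
      (Measure.pi fun _ : Fin n => D).map fun X i => expertTraj c g H (X i) := by
  have hm := (measurable_expertTraj c hgc H).aemeasurable (μ := D)
  have : IsProbabilityMeasure (D.map (expertTraj c g H)) :=
    Measure.isProbabilityMeasure_map hm
  rw [sampleLaw, Measure.pi_map_pi fun _ => hm]
  simp only [trajLaw_expert σ c hgc hg hD]

theorem totalCost_expertTraj {k : ℕ} (c : ℝ) (g : Vec (k + 2) → ℝ) (H : ℕ) {x : Vec (k + 2)}
    (hx : x 1 = 0) : totalCost (stageCost k) (expertTraj c g H x) = 0 := by
  refine Finset.sum_eq_zero fun t _ => ?_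
  unfold expertTraj stageCost
  split_ifs <;> simp [hx]

theorem trajLaw_expert_cost_zero {k : ℕ} (σ c : ℝ) {g : Vec (k + 2) → ℝ} (hgc : Continuous g)
    (hg : g 0 = 0) {D : Measure (Vec (k + 2))} [IsProbabilityMeasure D] (hD : ∀ᵐ x ∂D, x 1 = 0)
    (H : ℕ) : ∀ᵐ T ∂(trajLaw (expert σ c g).toPolicy (dyn σ g) D H),
      totalCost (stageCost k) T = 0 := by
  rw [trajLaw_expert σ c hgc hg hD]
  refine (ae_map_iff (measurable_expertTraj c hgc H).aemeasurable
    (measurable_totalCost k H (measurableSet_singleton 0))).2 ?_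
  filter_upwards [hD] with x hx
  exact totalCost_expertTraj c g H hx

/-! ### The instance class and failure at a single cell -/

/-- The instance with linear sign `σ`, grid size `N` and set `T` of positive cells. The expert
announces the grid size by its idle action, so that only the signs of the cells remain to be
learned. -/
def inst (k s : ℕ) (κ σ : ℝ) (N : ℕ) (T : Finset (Fin k → ℕ)) :
    DetPolicy (k + 2) (k + 2) × Dynamics (k + 2) (k + 2) :=
  (expert σ (1 / (N + 1)) (profile k s κ N T), dyn σ (profile k s κ N T))

/-- All instances, over all signs, grids and cell patterns. -/
def instClass (k s : ℕ) (κ : ℝ) : InstanceClass (k + 2) (k + 2) :=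
  {p | ∃ σ ∈ ({1, -1} : Finset ℝ), ∃ N T, p = inst k s κ σ N T}

theorem abs_eq_one_of_mem {σ : ℝ} (h : σ ∈ ({1, -1} : Finset ℝ)) : |σ| = 1 := by
  rw [Finset.mem_insert, Finset.mem_singleton] at h
  rcases h with h | h <;> simp [h]

theorem measurable_exceed_output {k H n : ℕ} (alg : Algorithm (k + 2) (k + 2) H n)
    {f : Dynamics (k + 2) (k + 2)}
    (hf : Measurable fun p : Vec (k + 2) × Vec (k + 2) => f p.1 p.2) (τ : ℝ) :
    Measurable fun p : (Sample (k + 2) (k + 2) H n × alg.Seed) × Vec (k + 2) =>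
      exceed (alg.output p.1.1 p.1.2) f H τ p.2 := by
  obtain ⟨κ, _, e⟩ := exists_kernel_rollout alg.policy f hf H
  have h := κ.measurable_coe (measurableSet_le_totalCost k H τ)
  convert h using 2 with p
  rw [exceed, show p = ((p.1.1, p.1.2), p.2) from rfl, e]
  rfl

/-- The returned policy, as a kernel. -/
def outputKernel {d m H n : ℕ} (alg : Algorithm d m H n) (S : Sample d m H n) (ω : alg.Seed) :
    Kernel (Vec d) (Vec m) :=
  alg.policy.comap (fun x => ((S, ω), x)) measurable_prodMk_left

instance {d m H n : ℕ} (alg : Algorithm d m H n) (S : Sample d m H n) (ω : alg.Seed) :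
    IsMarkovKernel (outputKernel alg S ω) := by
  unfold outputKernel
  infer_instance

theorem trajLaw_output_apply {k H n : ℕ} (alg : Algorithm (k + 2) (k + 2) H n)
    (S : Sample (k + 2) (k + 2) H n) (ω : alg.Seed) {f : Dynamics (k + 2) (k + 2)}
    (hf : Measurable fun p : Vec (k + 2) × Vec (k + 2) => f p.1 p.2) (r τ : ℝ) :
    trajLaw (alg.output S ω) f (initLaw k r) H {T | τ ≤ totalCost (stageCost k) T} =
      3⁻¹ * (exceed (alg.output S ω) f H τ 0 + exceed (alg.output S ω) f H τ (plane k r 0) +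
        ∫⁻ x, exceed (alg.output S ω) f H τ x ∂(gridLaw k)) := by
  have h := trajLaw_apply (outputKernel alg S ω) f hf (initLaw k r) H
    (measurableSet_le_totalCost k H τ)
  exact h.trans (lintegral_initLaw k r _)

/-- The part of the failure probability that the cell `j` accounts for: its share of the
starts at `0` and `(r, 0, 0)`, and the starts on the plateau of its bump. -/
def cellFailure {k : ℕ} (π : Policy (k + 2) (k + 2)) (f : Dynamics (k + 2) (k + 2)) (H : ℕ)
    (τ r : ℝ) (N : ℕ) (j : Fin k → ℕ) : ENNReal :=
  3⁻¹ * ∫⁻ x in {x | cellBump k N j x = 1},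
    (exceed π f H τ 0 + exceed π f H τ (plane k r 0) + exceed π f H τ x) ∂(gridLaw k)

theorem measurable_cellFailure {k H n : ℕ} (alg : Algorithm (k + 2) (k + 2) H n)
    {f : Dynamics (k + 2) (k + 2)}
    (hf : Measurable fun p : Vec (k + 2) × Vec (k + 2) => f p.1 p.2) (τ r : ℝ) (N : ℕ)
    (j : Fin k → ℕ) :
    Measurable fun p : Sample (k + 2) (k + 2) H n × alg.Seed =>
      cellFailure (alg.output p.1 p.2) f H τ r N j := by
  have h := measurable_exceed_output alg hf τ
  unfold cellFailure
  refine Measurable.const_mul ?_ _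
  refine Measurable.lintegral_prod_right' (f := fun q : (Sample (k + 2) (k + 2) H n × alg.Seed) ×
    Vec (k + 2) => exceed (alg.output q.1.1 q.1.2) f H τ 0 +
      exceed (alg.output q.1.1 q.1.2) f H τ (plane k r 0) +
      exceed (alg.output q.1.1 q.1.2) f H τ q.2) ?_
  have hc : ∀ y, Measurable fun q : (Sample (k + 2) (k + 2) H n × alg.Seed) × Vec (k + 2) =>
      exceed (alg.output q.1.1 q.1.2) f H τ y := fun y =>
    h.comp (f := fun q : (Sample (k + 2) (k + 2) H n × alg.Seed) × Vec (k + 2) => (q.1, y))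
      (measurable_fst.prodMk measurable_const)
  exact ((hc _).add (hc _)).add h

theorem sum_cellFailure_le {k H n : ℕ} (alg : Algorithm (k + 2) (k + 2) H n)
    (S : Sample (k + 2) (k + 2) H n) (ω : alg.Seed) {f : Dynamics (k + 2) (k + 2)}
    (hf : Measurable fun p : Vec (k + 2) × Vec (k + 2) => f p.1 p.2) (r τ : ℝ) (N : ℕ) :
    ∑ j ∈ cells k N, cellFailure (alg.output S ω) f H τ r N j ≤
      trajLaw (alg.output S ω) f (initLaw k r) H {T | τ ≤ totalCost (stageCost k) T} := by
  rw [trajLaw_output_apply alg S ω hf]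
  unfold cellFailure
  rw [← Finset.mul_sum]
  gcongr
  rw [← lintegral_biUnion_finset (fun i _ j _ hij => ?_) (fun j _ => measurableSet_plateau k N j)]
  · refine (setLIntegral_le_lintegral _ _).trans ?_
    rw [lintegral_add_left measurable_const, lintegral_const, measure_univ, mul_one]
  · refine Set.disjoint_left.2 fun x hx hx' => hij (cellBump_unique (N := N) (x := x) ?_ ?_)
    · rw [show cellBump k N i x = 1 from hx]
      exact one_ne_zero
    · rw [show cellBump k N j x = 1 from hx']
      exact one_ne_zero

theorem cellSign_symmDiff {k : ℕ} (T : Finset (Fin k → ℕ)) (i j : Fin k → ℕ) :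
    cellSign (symmDiff T {j}) i = if i = j then -cellSign T i else cellSign T i := by
  unfold cellSign
  simp only [Finset.mem_symmDiff, Finset.mem_singleton]
  split_ifs <;> simp_all

theorem profile_symmDiff_of_eq_zero {k : ℕ} (s : ℕ) (κ : ℝ) (N : ℕ) (T : Finset (Fin k → ℕ))
    {j : Fin k → ℕ} {x : Vec (k + 2)} (hx : cellBump k N j x = 0) :
    profile k s κ N (symmDiff T {j}) x = profile k s κ N T x := by
  refine Finset.sum_congr rfl fun i _ => ?_
  rw [cellSign_symmDiff]
  split_ifs with h
  · rw [h, hx, mul_zero, mul_zero]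
  · rfl

theorem sum_symmDiff {k N : ℕ} {j : Fin k → ℕ} (hj : j ∈ cells k N)
    (F : Finset (Fin k → ℕ) → ENNReal) :
    ∑ T ∈ (cells k N).powerset, F (symmDiff T {j}) = ∑ T ∈ (cells k N).powerset, F T := by
  have hmem : ∀ T ∈ (cells k N).powerset, symmDiff T {j} ∈ (cells k N).powerset := fun T hT => by
    rw [Finset.mem_powerset] at hT ⊢
    intro i hi
    rw [Finset.mem_symmDiff, Finset.mem_singleton] at hi
    rcases hi with h | h
    · exact hT h.1
    · exact h.1 ▸ hj
  exact Finset.sum_nbij' (fun T => symmDiff T {j}) (fun T => symmDiff T {j}) hmem hmem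
    (fun T _ => symmDiff_symmDiff_cancel_right _ _) (fun T _ => symmDiff_symmDiff_cancel_right _ _)
    fun T _ => rfl

/-- Two-point bound at a single cell. On a common sample, no simple policy does well on all four
instances that differ in the sign of the linear part and in the sign of the cell `j`. -/
theorem cellFailure_pair {k H N : ℕ} {s : ℕ} {κ : ℝ} (hk : 1 ≤ k) (hN : 1 ≤ N)
    (hprof : ∀ N T, IsProfile (profile k s κ N T))
    {j : Fin k → ℕ} (hj : j ∈ cells k N) (T : Finset (Fin k → ℕ))
    (π : Kernel (Vec (k + 2)) (Vec (k + 2))) [IsMarkovKernel π]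
    {L M τ r : ℝ} (hπ : IsSimplePolicy L M π) (hτ0 : 0 < τ) (hτ : τ ≤ 1)
    (hMτ : 100 * (M * τ) ≤ 1) (hr : 0 < r) (hMr : 10 * (M * r) ≤ 1) (hτr : 10 * τ ≤ r)
    (ha : 2 * τ < 1.05 ^ H * (κ / N ^ s)) :
    3⁻¹ * ENNReal.ofReal ((1 / (2 * k)) ^ k / N ^ k) ≤
      ∑ σ ∈ ({1, -1} : Finset ℝ),
        (cellFailure π (dyn σ (profile k s κ N T)) (H + 2) τ r N j +
          cellFailure π (dyn σ (profile k s κ N (symmDiff T {j}))) (H + 2) τ r N j) := by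
  have hmx : ∀ (g : Vec (k + 2) → ℝ), Continuous g → ∀ σ, Measurable fun x =>
      exceed π (dyn σ g) (H + 2) τ x := fun g hg σ => by
    have h1 := (rollout_measurable π (dyn σ g) (continuous_dyn σ hg).measurable (H + 2)).1
    exact (Measure.measurable_coe (measurableSet_le_totalCost k (H + 2) τ)).comp h1
  have hcont : ∀ T, Continuous (profile k s κ N T) := fun T => (hprof N T).contDiff.continuous
  have hzero : ∀ T a b, profile k s κ N T (plane k a b) = 0 := fun T a b =>
    (hprof N T).eq_zero _ fun i => plane_succ_succ k a b i
  let G : Finset (Fin k → ℕ) → ℝ → Vec (k + 2) → ENNReal := fun T σ x =>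
    exceed π (dyn σ (profile k s κ N T)) (H + 2) τ 0 +
      exceed π (dyn σ (profile k s κ N T)) (H + 2) τ (plane k r 0) +
      exceed π (dyn σ (profile k s κ N T)) (H + 2) τ x
  have hmG : ∀ T σ, Measurable (G T σ) := fun T σ => measurable_const.add (hmx _ (hcont T) σ)
  have hmG2 : ∀ T' σ, Measurable fun x => G T σ x + G T' σ x := fun T' σ =>
    (hmG T σ).add (hmG T' σ)
  unfold cellFailure
  simp_rw [← mul_add, ← Finset.mul_sum]
  gcongr
  change _ ≤ ∑ σ ∈ ({1, -1} : Finset ℝ),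
    ((∫⁻ x in {x | cellBump k N j x = 1}, G T σ x ∂(gridLaw k)) +
      ∫⁻ x in {x | cellBump k N j x = 1}, G (symmDiff T {j}) σ x ∂(gridLaw k))
  simp_rw [← lintegral_add_left (hmG T _)]
  rw [← lintegral_finsetSum _ fun σ _ => hmG2 _ σ]
  calc ENNReal.ofReal ((1 / (2 * k)) ^ k / N ^ k)
      ≤ gridLaw k {x | cellBump k N j x = 1} := gridLaw_plateau_ge hk hN hj
    _ = ∫⁻ _ in {x | cellBump k N j x = 1}, 1 ∂(gridLaw k) := by rw [setLIntegral_one]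
    _ ≤ _ := by
      refine lintegral_mono_ae ?_
      filter_upwards [ae_restrict_mem (measurableSet_plateau k N j),
        ae_restrict_of_ae (ae_gridLaw hk)] with x hx hx0
      have hx1 : cellBump k N j x = 1 := hx
      have hval : ∀ T, profile k s κ N T x = κ / N ^ s * cellSign T j := fun T => by
        rw [profile_eq_of_cellBump_ne_zero s κ T hj (by rw [hx1]; exact one_ne_zero), hx1, mul_one]
      have hflip : cellSign (symmDiff T {j}) j = -cellSign T j := by
        rw [cellSign_symmDiff, if_pos rfl]
      by_cases hT : j ∈ T
      · have e : cellSign T j = 1 := if_pos hT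
        exact one_le_sum_exceed π hπ hτ0 hτ hMτ hr hMr hτr (hcont T) (hcont _) (hzero T)
          (hzero _) hx0.1 hx0.2.1 (a := κ / N ^ s) (by rw [hval, e, mul_one])
          (by rw [hval, hflip, e]; ring) H ha
      · have e : cellSign T j = -1 := if_neg hT
        have h := one_le_sum_exceed π hπ hτ0 hτ hMτ hr hMr hτr (hcont (symmDiff T {j})) (hcont T)
          (hzero _) (hzero T) hx0.1 hx0.2.1 (a := κ / N ^ s) (by rw [hval, hflip, e]; ring)
          (by rw [hval, e]; ring) H ha
        refine h.trans_eq (Finset.sum_congr rfl fun σ _ => add_comm _ _)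

/-! ### Averaging over samples and sign patterns -/

/-- With probability at least `2 / 3`, a given cell is not visited by the sample, provided the grid
has at least as many cells as there are sample points. -/
theorem measure_miss_ge {k n N : ℕ} (hk : 1 ≤ k) (hN : 1 ≤ N) (hn : n ≤ N ^ k) (r : ℝ)
    (j : Fin k → ℕ) :
    1 - 3⁻¹ ≤ (Measure.pi fun _ : Fin n => initLaw k r) {X | ∀ l, cellBump k N j (X l) = 0} := by
  set P := Measure.pi fun _ : Fin n => initLaw k r
  have hcover : (Set.univ : Set (Fin n → Vec (k + 2))) ⊆
      {X | ∀ l, cellBump k N j (X l) = 0} ∪ ⋃ l, {X | cellBump k N j (X l) ≠ 0} := by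
    intro X _
    by_cases h : ∀ l, cellBump k N j (X l) = 0
    · exact Or.inl h
    · push Not at h
      exact Or.inr (Set.mem_iUnion.2 h)
  have hone : ∀ l, P {X | cellBump k N j (X l) ≠ 0} ≤ 3⁻¹ * ENNReal.ofReal (1 / N ^ k) := by
    intro l
    have hmp := measurePreserving_eval (fun _ : Fin n => initLaw k r) l
    have h1 := hmp.measure_preimage (measurableSet_cellBump_ne_zero k N j).nullMeasurableSet
    have h2 : P {X | cellBump k N j (X l) ≠ 0} = initLaw k r {x | cellBump k N j x ≠ 0} := h1
    have h3 := initLaw_cellBump hk r j (N := N) (s := {0}ᶜ) (measurableSet_singleton 0).compl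
      (by simp)
    rw [h2]
    refine (le_of_eq h3).trans ?_
    gcongr
    exact gridLaw_support_le hk hN j
  have hvisit : P (⋃ l, {X | cellBump k N j (X l) ≠ 0}) ≤ 3⁻¹ := by
    refine (measure_iUnion_fintype_le _ _).trans ((Finset.sum_le_sum fun l _ => hone l).trans ?_)
    rw [Finset.sum_const, Finset.card_univ, Fintype.card_fin, nsmul_eq_mul, mul_left_comm]
    have hN0 : (0 : ℝ) < (N : ℝ) ^ k := by positivity
    have h4 : (n : ENNReal) * ENNReal.ofReal (1 / N ^ k) ≤ 1 := by
      rw [← ENNReal.ofReal_natCast, ← ENNReal.ofReal_mul (by positivity), ← ENNReal.ofReal_one]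
      refine ENNReal.ofReal_le_ofReal ?_
      rw [mul_one_div, div_le_one hN0]
      exact_mod_cast hn
    calc 3⁻¹ * ((n : ENNReal) * ENNReal.ofReal (1 / N ^ k)) ≤ 3⁻¹ * 1 := by gcongr
      _ = 3⁻¹ := mul_one _
  rw [tsub_le_iff_right]
  calc (1 : ENNReal) = P Set.univ := measure_univ.symm
    _ ≤ P {X | ∀ l, cellBump k N j (X l) = 0} + P (⋃ l, {X | cellBump k N j (X l) ≠ 0}) :=
      (measure_mono hcover).trans (measure_union_le _ _)
    _ ≤ _ := by gcongr

/-- The sample generated by the expert of an instance from the initial states `X`. -/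
def expertSample {k : ℕ} (s : ℕ) (κ : ℝ) (N : ℕ) (T : Finset (Fin k → ℕ)) (H n : ℕ)
    (X : Fin n → Vec (k + 2)) : Sample (k + 2) (k + 2) H n :=
  fun l => expertTraj (1 / (N + 1)) (profile k s κ N T) H (X l)

theorem measurable_expertSample {k s : ℕ} {κ : ℝ} {N : ℕ} {T : Finset (Fin k → ℕ)}
    (hT : IsProfile (profile k s κ N T)) (H n : ℕ) :
    Measurable (expertSample s κ N T H n) :=
  measurable_pi_lambda _ fun l =>
    (measurable_expertTraj _ hT.contDiff.continuous H).comp (measurable_pi_apply l)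

/-- A sample that misses the cell `j` does not reveal its sign. -/
theorem expertSample_symmDiff {k s : ℕ} {κ : ℝ} {N : ℕ} {T : Finset (Fin k → ℕ)}
    {j : Fin k → ℕ} {H n : ℕ} {X : Fin n → Vec (k + 2)}
    (hX : ∀ l, cellBump k N j (X l) = 0) :
    expertSample s κ N (symmDiff T {j}) H n X = expertSample s κ N T H n X := by
  funext l t
  simp only [expertSample, expertTraj, profile_symmDiff_of_eq_zero s κ N T (hX l)]

theorem ae_initLaw_one {k : ℕ} (hk : 1 ≤ k) {r : ℝ} (hr0 : 0 ≤ r) (hr : r ≤ 1) :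
    ∀ᵐ x ∂(initLaw k r), x 1 = 0 :=
  (ae_initLaw hk hr0 hr).mono fun _ h => h.1

theorem sampleLaw_inst {k s : ℕ} {κ : ℝ} (hk : 1 ≤ k) {N : ℕ} {T : Finset (Fin k → ℕ)}
    (hT : IsProfile (profile k s κ N T)) (σ : ℝ) {r : ℝ} (hr0 : 0 ≤ r) (hr : r ≤ 1) (H n : ℕ) :
    sampleLaw (inst k s κ σ N T) (initLaw k r) H n =
      (Measure.pi fun _ : Fin n => initLaw k r).map (expertSample s κ N T H n) :=
  sampleLaw_expert σ _ hT.contDiff.continuous (hT.eq_zero 0 fun _ => rfl)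
    (ae_initLaw_one hk hr0 hr) H n

/-- The expectation of `cellFailure` over the seed, given the sample `S`. -/
def cellLoss {k H n : ℕ} (alg : Algorithm (k + 2) (k + 2) H n) (f : Dynamics (k + 2) (k + 2))
    (τ r : ℝ) (N : ℕ) (j : Fin k → ℕ) (S : Sample (k + 2) (k + 2) H n) : ENNReal :=
  ∫⁻ ω, cellFailure (alg.output S ω) f H τ r N j ∂(alg.seedLaw S)

theorem measurable_cellLoss {k H n : ℕ} (alg : Algorithm (k + 2) (k + 2) H n)
    {f : Dynamics (k + 2) (k + 2)}
    (hf : Measurable fun p : Vec (k + 2) × Vec (k + 2) => f p.1 p.2) (τ r : ℝ) (N : ℕ)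
    (j : Fin k → ℕ) : Measurable (cellLoss alg f τ r N j) :=
  Measurable.lintegral_kernel_prod_right' (κ := alg.seedLaw)
    (measurable_cellFailure alg hf τ r N j)

theorem measurable_cellFailure_seed {k H n : ℕ} (alg : Algorithm (k + 2) (k + 2) H n)
    {f : Dynamics (k + 2) (k + 2)}
    (hf : Measurable fun p : Vec (k + 2) × Vec (k + 2) => f p.1 p.2) (τ r : ℝ) (N : ℕ)
    (j : Fin k → ℕ) (S : Sample (k + 2) (k + 2) H n) :
    Measurable fun ω => cellFailure (alg.output S ω) f H τ r N j :=
  (measurable_cellFailure alg hf τ r N j).comp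
    (g := fun p : Sample (k + 2) (k + 2) H n × alg.Seed =>
      cellFailure (alg.output p.1 p.2) f H τ r N j)
    (f := fun ω : alg.Seed => (S, ω)) measurable_prodMk_left

theorem sum_cellLoss_le {k H n : ℕ} (alg : Algorithm (k + 2) (k + 2) H n)
    {f : Dynamics (k + 2) (k + 2)}
    (hf : Measurable fun p : Vec (k + 2) × Vec (k + 2) => f p.1 p.2) (τ r : ℝ) (N : ℕ)
    (S : Sample (k + 2) (k + 2) H n) :
    ∑ j ∈ cells k N, cellLoss alg f τ r N j S ≤
      ∫⁻ ω, trajLaw (alg.output S ω) f (initLaw k r) H {T | τ ≤ totalCost (stageCost k) T}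
        ∂(alg.seedLaw S) := by
  unfold cellLoss
  rw [← lintegral_finsetSum _ fun j _ => measurable_cellFailure_seed alg hf τ r N j S]
  exact lintegral_mono fun ω => sum_cellFailure_le alg S ω hf r τ N

theorem measurable_dyn_profile {k s : ℕ} {κ : ℝ} (hprof : ∀ N T, IsProfile (profile k s κ N T))
    (σ : ℝ) (N : ℕ) (T : Finset (Fin k → ℕ)) : Measurable fun p : Vec (k + 2) × Vec (k + 2) =>
      dyn σ (profile k s κ N T) p.1 p.2 :=
  (continuous_dyn σ (hprof N T).contDiff.continuous).measurable

theorem cellLoss_pair {k s H n N : ℕ} {κ L M τ r : ℝ} (hk : 1 ≤ k) (hN : 1 ≤ N)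
    (hprof : ∀ N T, IsProfile (profile k s κ N T))
    (alg : Algorithm (k + 2) (k + 2) (H + 2) n) (halg : alg.IsSimple L M) (hτ0 : 0 < τ)
    (hτ : τ ≤ 1) (hMτ : 100 * (M * τ) ≤ 1) (hr : 0 < r) (hMr : 10 * (M * r) ≤ 1)
    (hτr : 10 * τ ≤ r) (ha : 2 * τ < 1.05 ^ H * (κ / N ^ s)) {j : Fin k → ℕ} (hj : j ∈ cells k N)
    (T : Finset (Fin k → ℕ)) (S : Sample (k + 2) (k + 2) (H + 2) n) :
    3⁻¹ * ENNReal.ofReal ((1 / (2 * k)) ^ k / N ^ k) ≤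
      ∑ σ ∈ ({1, -1} : Finset ℝ), (cellLoss alg (dyn σ (profile k s κ N T)) τ r N j S +
        cellLoss alg (dyn σ (profile k s κ N (symmDiff T {j}))) τ r N j S) := by
  have hm : ∀ σ T, Measurable fun ω => cellFailure (alg.output S ω)
      (dyn σ (profile k s κ N T)) (H + 2) τ r N j := fun σ T =>
    measurable_cellFailure_seed alg (measurable_dyn_profile hprof σ N T) τ r N j S
  have hm2 : ∀ σ, Measurable fun ω => cellFailure (alg.output S ω)
      (dyn σ (profile k s κ N T)) (H + 2) τ r N j + cellFailure (alg.output S ω)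
      (dyn σ (profile k s κ N (symmDiff T {j}))) (H + 2) τ r N j := fun σ =>
    (hm σ T).add (hm σ _)
  unfold cellLoss
  simp_rw [← lintegral_add_left (hm _ T)]
  rw [← lintegral_finsetSum _ fun σ _ => hm2 σ]
  calc 3⁻¹ * ENNReal.ofReal ((1 / (2 * k)) ^ k / N ^ k)
      = ∫⁻ _, 3⁻¹ * ENNReal.ofReal ((1 / (2 * k)) ^ k / N ^ k) ∂(alg.seedLaw S) := by
        rw [lintegral_const, measure_univ, mul_one]
    _ ≤ _ := lintegral_mono_ae (by
        filter_upwards [halg S] with ω hω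
        exact cellFailure_pair hk hN hprof hj T (outputKernel alg S ω) hω hτ0 hτ hMτ hr
          hMr hτr ha)

/-- The two-point bound, integrated over the samples that miss the cell. -/
theorem lintegral_cellLoss_pair {k s H n N : ℕ} {κ L M τ r : ℝ} (hk : 1 ≤ k) (hN : 1 ≤ N)
    (hn : n ≤ N ^ k) (hprof : ∀ N T, IsProfile (profile k s κ N T))
    (alg : Algorithm (k + 2) (k + 2) (H + 2) n) (halg : alg.IsSimple L M) (hτ0 : 0 < τ)
    (hτ : τ ≤ 1) (hMτ : 100 * (M * τ) ≤ 1) (hr : 0 < r) (hMr : 10 * (M * r) ≤ 1)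
    (hτr : 10 * τ ≤ r) (ha : 2 * τ < 1.05 ^ H * (κ / N ^ s)) {j : Fin k → ℕ} (hj : j ∈ cells k N)
    (T : Finset (Fin k → ℕ)) :
    (1 - 3⁻¹) * (3⁻¹ * ENNReal.ofReal ((1 / (2 * k)) ^ k / N ^ k)) ≤
      (∑ σ ∈ ({1, -1} : Finset ℝ), ∫⁻ X, cellLoss alg (dyn σ (profile k s κ N T)) τ r N j
        (expertSample s κ N T (H + 2) n X) ∂(Measure.pi fun _ => initLaw k r)) +
      ∑ σ ∈ ({1, -1} : Finset ℝ), ∫⁻ X,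
        cellLoss alg (dyn σ (profile k s κ N (symmDiff T {j}))) τ r N j
          (expertSample s κ N (symmDiff T {j}) (H + 2) n X)
          ∂(Measure.pi fun _ => initLaw k r) := by
  have hm : ∀ σ T, Measurable fun X => cellLoss alg (dyn σ (profile k s κ N T)) τ r N j
      (expertSample s κ N T (H + 2) n X) := fun σ T =>
    (measurable_cellLoss alg (measurable_dyn_profile hprof σ N T) τ r N j).comp
      (measurable_expertSample (hprof N T) (H + 2) n)
  have hm2 : ∀ σ, Measurable fun X => cellLoss alg (dyn σ (profile k s κ N T)) τ r N j
      (expertSample s κ N T (H + 2) n X) +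
      cellLoss alg (dyn σ (profile k s κ N (symmDiff T {j}))) τ r N j
        (expertSample s κ N (symmDiff T {j}) (H + 2) n X) := fun σ =>
    (hm σ T).add (hm σ _)
  have hmiss : MeasurableSet {X : Fin n → Vec (k + 2) | ∀ l, cellBump k N j (X l) = 0} := by
    rw [Set.ofPred_forall]
    exact MeasurableSet.iInter fun l =>
      ((measurable_cellBump k N j).comp (measurable_pi_apply l)) (measurableSet_singleton 0)
  rw [← Finset.sum_add_distrib]
  simp_rw [← lintegral_add_left (hm _ T)]
  rw [← lintegral_finsetSum _ fun σ _ => hm2 σ]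
  refine le_trans ?_ (setLIntegral_le_lintegral
    {X : Fin n → Vec (k + 2) | ∀ l, cellBump k N j (X l) = 0} _)
  refine le_trans ?_ (setLIntegral_mono' hmiss
    (f := fun _ => 3⁻¹ * ENNReal.ofReal ((1 / (2 * k)) ^ k / N ^ k)) fun X hX => ?_)
  · rw [setLIntegral_const, mul_comm (1 - 3⁻¹ : ENNReal)]
    gcongr
    exact measure_miss_ge hk hN hn r j
  · rw [expertSample_symmDiff hX]
    exact cellLoss_pair hk hN hprof alg halg hτ0 hτ hMτ hr hMr hτr ha hj T _

/-- Averaging over the signs of all cells and of the linear part: some instance makes a simple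
algorithm incur a cost of at least `τ` with probability bounded below. -/
theorem exists_inst_failure {k s H n N : ℕ} {κ L M τ r : ℝ} (hk : 1 ≤ k) (hN : 1 ≤ N)
    (hn : n ≤ N ^ k) (hprof : ∀ N T, IsProfile (profile k s κ N T))
    (alg : Algorithm (k + 2) (k + 2) (H + 2) n) (halg : alg.IsSimple L M) (hτ0 : 0 < τ)
    (hτ : τ ≤ 1) (hMτ : 100 * (M * τ) ≤ 1) (hr : 0 < r) (hr1 : r ≤ 1) (hMr : 10 * (M * r) ≤ 1)
    (hτr : 10 * τ ≤ r) (ha : 2 * τ < 1.05 ^ H * (κ / N ^ s)) :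
    ∃ σ ∈ ({1, -1} : Finset ℝ), ∃ T,
      ENNReal.ofReal ((1 / (2 * k)) ^ k / 18) ≤
        ∫⁻ S, ∫⁻ ω, trajLaw (alg.output S ω) (inst k s κ σ N T).2 (initLaw k r) (H + 2)
          {T | τ ≤ totalCost (stageCost k) T} ∂(alg.seedLaw S)
          ∂(sampleLaw (inst k s κ σ N T) (initLaw k r) (H + 2) n) := by
  set v : ℝ := (1 / (2 * k)) ^ k with hv_def
  have hv : 0 < v := by positivity
  set A : ℝ → Finset (Fin k → ℕ) → ENNReal := fun σ T =>
    ∫⁻ S, ∫⁻ ω, trajLaw (alg.output S ω) (inst k s κ σ N T).2 (initLaw k r) (H + 2)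
      {T | τ ≤ totalCost (stageCost k) T} ∂(alg.seedLaw S)
      ∂(sampleLaw (inst k s κ σ N T) (initLaw k r) (H + 2) n)
  -- the failure probability charged to the cell `j`
  set B : ℝ → Finset (Fin k → ℕ) → (Fin k → ℕ) → ENNReal := fun σ T j =>
    ∫⁻ X, cellLoss alg (dyn σ (profile k s κ N T)) τ r N j (expertSample s κ N T (H + 2) n X)
      ∂(Measure.pi fun _ => initLaw k r)
  have hA : ∀ σ T, ∑ j ∈ cells k N, B σ T j ≤ A σ T := by
    intro σ T
    have hm := fun j => measurable_cellLoss alg (measurable_dyn_profile hprof σ N T) τ r N j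
    have hs := measurable_expertSample (hprof N T) (H + 2) n
    have hms : ∀ j, Measurable fun X => cellLoss alg (dyn σ (profile k s κ N T)) τ r N j
        (expertSample s κ N T (H + 2) n X) := fun j => (hm j).comp hs
    calc ∑ j ∈ cells k N, B σ T j
        = ∫⁻ S, ∑ j ∈ cells k N, cellLoss alg (dyn σ (profile k s κ N T)) τ r N j S
            ∂(sampleLaw (inst k s κ σ N T) (initLaw k r) (H + 2) n) := by
          rw [sampleLaw_inst hk (hprof N T) σ hr.le hr1,
            lintegral_map (Finset.measurable_fun_sum _ fun j _ => hm j) hs,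
            lintegral_finsetSum _ fun j _ => hms j]
      _ ≤ A σ T := lintegral_mono fun S =>
          sum_cellLoss_le alg (measurable_dyn_profile hprof σ N T) τ r N S
  have hpair : ∀ j ∈ cells k N, ∀ T, (1 - 3⁻¹) * (3⁻¹ * ENNReal.ofReal (v / N ^ k)) ≤
      (∑ σ ∈ ({1, -1} : Finset ℝ), B σ T j) +
        ∑ σ ∈ ({1, -1} : Finset ℝ), B σ (symmDiff T {j}) j := fun j hj T =>
    lintegral_cellLoss_pair hk hN hn hprof alg halg hτ0 hτ hMτ hr hMr hτr ha hj T
  set Q := (cells k N).powerset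
  have hQ : (0 : ℝ) < Q.card := by
    have : Q.Nonempty := ⟨∅, Finset.empty_mem_powerset _⟩
    exact_mod_cast this.card_pos
  have hNk : (0 : ℝ) < (N : ℝ) ^ k := by positivity
  have hlower : ENNReal.ofReal (Q.card * (2 / 9 * v)) ≤
      2 * ∑ σ ∈ ({1, -1} : Finset ℝ), ∑ T ∈ Q, A σ T := by
    calc ENNReal.ofReal (Q.card * (2 / 9 * v))
        = ∑ j ∈ cells k N, ∑ T ∈ Q, (1 - 3⁻¹) * (3⁻¹ * ENNReal.ofReal (v / N ^ k)) := by
          have e3 : (3⁻¹ : ENNReal) = ENNReal.ofReal (1 / 3) := by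
            rw [one_div, ENNReal.ofReal_inv_of_pos (by norm_num)]
            norm_num
          have e23 : 1 - (3⁻¹ : ENNReal) = ENNReal.ofReal (2 / 3) := by
            rw [e3, ← ENNReal.ofReal_one, ← ENNReal.ofReal_sub _ (by norm_num)]
            norm_num
          rw [Finset.sum_const, Finset.sum_const, nsmul_eq_mul, nsmul_eq_mul, card_cells, e23, e3,
            ← ENNReal.ofReal_mul (by norm_num), ← ENNReal.ofReal_mul (by norm_num),
            ← ENNReal.ofReal_natCast, ← ENNReal.ofReal_natCast,
            ← ENNReal.ofReal_mul (by positivity), ← ENNReal.ofReal_mul (by positivity)]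
          congr 1
          push_cast
          field_simp
          norm_num
      _ ≤ ∑ j ∈ cells k N, ∑ T ∈ Q,
          ((∑ σ ∈ ({1, -1} : Finset ℝ), B σ T j) +
          ∑ σ ∈ ({1, -1} : Finset ℝ), B σ (symmDiff T {j}) j) :=
          Finset.sum_le_sum fun j hj => Finset.sum_le_sum fun T _ => hpair j hj T
      _ = ∑ j ∈ cells k N, 2 * ∑ T ∈ Q, ∑ σ ∈ ({1, -1} : Finset ℝ),
            B σ T j := by
          refine Finset.sum_congr rfl fun j hj => ?_
          rw [Finset.sum_add_distrib, sum_symmDiff hj fun T => ∑ σ ∈ ({1, -1} : Finset ℝ),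
            B σ T j, two_mul]
      _ = 2 * ∑ σ ∈ ({1, -1} : Finset ℝ), ∑ T ∈ Q, ∑ j ∈ cells k N,
            B σ T j := by
          rw [← Finset.mul_sum, Finset.sum_comm]
          simp_rw [Finset.sum_comm (s := cells k N)]
          rw [Finset.sum_comm]
      _ ≤ _ := by
          gcongr with σ _ T _
          exact hA σ T
  by_contra! hcon
  have hlt : ∑ σ ∈ ({1, -1} : Finset ℝ), ∑ T ∈ Q, A σ T <
      ∑ σ ∈ ({1, -1} : Finset ℝ), ∑ T ∈ Q, ENNReal.ofReal (v / 18) :=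
    ENNReal.sum_lt_sum_of_nonempty (by simp) fun σ hσ =>
      ENNReal.sum_lt_sum_of_nonempty ⟨∅, Finset.empty_mem_powerset _⟩ fun T _ => hcon σ hσ T
  have hcard : (({1, -1} : Finset ℝ)).card = 2 := Finset.card_pair (by norm_num)
  rw [Finset.sum_const, Finset.sum_const, hcard, nsmul_eq_mul, nsmul_eq_mul] at hlt
  have hlt2 := ENNReal.mul_lt_mul_right (a := 2) (by norm_num) (by norm_num) hlt
  refine absurd (hlower.trans_lt hlt2) (not_lt.2 (le_of_eq ?_))
  rw [← ENNReal.ofReal_natCast, ← ENNReal.ofReal_natCast, ← ENNReal.ofReal_mul (by positivity),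
    ← ENNReal.ofReal_mul (by positivity), show (2 : ENNReal) = ENNReal.ofReal 2 by norm_num,
    ← ENNReal.ofReal_mul (by positivity)]
  congr 1
  push_cast
  ring

/-! ### A proper learner -/

open Classical in
/-- The estimated set of positive cells: those for which the sample has an initial state on the
plateau of the bump, with a positive value of the perturbation. -/
def estSigns {k H n : ℕ} (N : ℕ) (S : Sample (k + 2) (k + 2) (H + 1) n) : Finset (Fin k → ℕ) :=
  (cells k N).filter fun j =>
    ∃ l, cellBump k N j (S l 0).1 = 1 ∧ 0 < (S l 0).2 1 - 9 / 16 * (S l 0).1 0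

/-- The grid size announced by the idle action. -/
def estGrid {k H n : ℕ} (S : Sample (k + 2) (k + 2) (H + 1) (n + 1)) : ℕ :=
  ⌊((S 0 0).2 0)⁻¹ - 1⌋₊

/-- The policy learned from `S`, for a given grid size. -/
def learnedOnGrid {k H n : ℕ} (s : ℕ) (κ : ℝ) (N : ℕ) (S : Sample (k + 2) (k + 2) (H + 1) n) :
    DetPolicy (k + 2) (k + 2) :=
  (inst k s κ 1 N (estSigns N S)).1

theorem measurable_learnedOnGrid {k H n : ℕ} (s : ℕ) (κ : ℝ) (N : ℕ) :
    Measurable fun p : Sample (k + 2) (k + 2) (H + 1) n × Vec (k + 2) =>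
      learnedOnGrid s κ N p.1 p.2 := by
  have hsign : ∀ j, Measurable fun S : Sample (k + 2) (k + 2) (H + 1) n =>
      cellSign (estSigns N S) j := by
    intro j
    have e : {S : Sample (k + 2) (k + 2) (H + 1) n | j ∈ estSigns N S} =
        {_S | j ∈ cells k N} ∩ ⋃ l, {S | cellBump k N j (S l 0).1 = 1} ∩
          {S | 0 < (S l 0).2 1 - 9 / 16 * (S l 0).1 0} := by
      ext S
      simp [estSigns]
    have hset : MeasurableSet {S : Sample (k + 2) (k + 2) (H + 1) n | j ∈ estSigns N S} := by
      rw [e]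
      refine (MeasurableSet.const _).inter (MeasurableSet.iUnion fun l => ?_)
      have h1 : Measurable fun S : Sample (k + 2) (k + 2) (H + 1) n => (S l 0).1 := by fun_prop
      have h2 : Measurable fun S : Sample (k + 2) (k + 2) (H + 1) n =>
          (S l 0).2 1 - 9 / 16 * (S l 0).1 0 := by fun_prop
      exact (h1 (measurableSet_plateau k N j)).inter (measurableSet_lt measurable_const h2)
    exact Measurable.ite hset measurable_const measurable_const
  have hg : Measurable fun p : Sample (k + 2) (k + 2) (H + 1) n × Vec (k + 2) =>
      profile k s κ N (estSigns N p.1) p.2 := by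
    unfold profile
    refine Finset.measurable_fun_sum _ fun j _ => ?_
    exact (((hsign j).comp measurable_fst).const_mul _).mul
      ((measurable_cellBump k N j).comp measurable_snd)
  have hc : Measurable fun x : Vec (k + 2) => 9 / 16 * x 0 - 1 * (3 / 2) * x 1 := by fun_prop
  have h := ((hc.comp measurable_snd).add hg)
  exact (continuous_plane k).measurable.comp
    ((measurable_const (a := (1 / (N + 1) : ℝ))).prodMk h)

/-- The learned policy: the instance policy that announces the observed grid size and has the
estimated signs. -/
def learned {k H n : ℕ} (s : ℕ) (κ : ℝ) (S : Sample (k + 2) (k + 2) (H + 1) (n + 1)) :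
    DetPolicy (k + 2) (k + 2) :=
  learnedOnGrid s κ (estGrid S) S

theorem measurable_learned {k H n : ℕ} (s : ℕ) (κ : ℝ) :
    Measurable fun p : Sample (k + 2) (k + 2) (H + 1) (n + 1) × Vec (k + 2) =>
      learned s κ p.1 p.2 := by
  have hN : Measurable fun p : Sample (k + 2) (k + 2) (H + 1) (n + 1) × Vec (k + 2) =>
      estGrid p.1 := by
    unfold estGrid
    refine Nat.measurable_floor.comp ?_
    fun_prop
  have h : Measurable fun q : (Sample (k + 2) (k + 2) (H + 1) (n + 1) × Vec (k + 2)) × ℕ =>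
      learnedOnGrid s κ q.2 q.1.1 q.1.2 :=
    measurable_from_prod_countable_left fun N => measurable_learnedOnGrid s κ N
  exact Measurable.comp
    (g := fun q : (Sample (k + 2) (k + 2) (H + 1) (n + 1) × Vec (k + 2)) × ℕ =>
      learnedOnGrid s κ q.2 q.1.1 q.1.2)
    (f := fun p => (p, estGrid p.1)) h (measurable_id.prodMk hN)

theorem measurable_learned_seed {k H n : ℕ} (s : ℕ) (κ : ℝ) : Measurable
    fun p : (Sample (k + 2) (k + 2) (H + 1) (n + 1) × Unit) × Vec (k + 2) =>
      learned s κ p.1.1 p.2 :=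
  Measurable.comp
    (g := fun p : Sample (k + 2) (k + 2) (H + 1) (n + 1) × Vec (k + 2) => learned s κ p.1 p.2)
    (f := fun p : (Sample (k + 2) (k + 2) (H + 1) (n + 1) × Unit) × Vec (k + 2) =>
        (p.1.1, p.2)) (measurable_learned s κ) (by fun_prop)

/-- The deterministic algorithm that returns the learned policy. -/
def learner (k s : ℕ) (κ : ℝ) (H n : ℕ) : Algorithm (k + 2) (k + 2) (H + 1) (n + 1) where
  Seed := Unit
  seedLaw := Kernel.const _ (Measure.dirac ())
  policy := Kernel.deterministic _ (measurable_learned_seed s κ)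

theorem learner_output (k s : ℕ) (κ : ℝ) (H n : ℕ) (S : Sample (k + 2) (k + 2) (H + 1) (n + 1))
    (ω : (learner k s κ H n).Seed) :
    (learner k s κ H n).output S ω = (learned s κ S).toPolicy := by
  funext x
  exact Kernel.deterministic_apply (measurable_learned_seed s κ) ((S, ω), x)

theorem learner_isProper (k s : ℕ) (κ : ℝ) (H n : ℕ) :
    (learner k s κ H n).IsProper (instClass k s κ) := fun S =>
  Filter.Eventually.of_forall fun ω =>
    ⟨_, ⟨1, by simp, _, _, rfl⟩, learner_output k s κ H n S ω⟩

theorem estGrid_expertSample {k s : ℕ} (κ : ℝ) (N : ℕ) (T : Finset (Fin k → ℕ)) (H n : ℕ)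
    (X : Fin (n + 1) → Vec (k + 2)) :
    estGrid (expertSample s κ N T (H + 1) (n + 1) X) = N := by
  simp [estGrid, expertSample, expertTraj]

theorem mem_estSigns_expertSample {k s : ℕ} {κ : ℝ} {N : ℕ} {T : Finset (Fin k → ℕ)} {H n : ℕ}
    {X : Fin n → Vec (k + 2)} {j : Fin k → ℕ} :
    j ∈ estSigns N (expertSample s κ N T (H + 1) n X) ↔
      j ∈ cells k N ∧ ∃ l, cellBump k N j (X l) = 1 ∧ 0 < profile k s κ N T (X l) := by
  simp [estSigns, expertSample, expertTraj]

/-- The sign of a cell is estimated correctly once its plateau is visited. -/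
theorem cellSign_estSigns {k s : ℕ} {κ : ℝ} (hκ : 0 < κ) {N : ℕ} (hN : 1 ≤ N)
    {T : Finset (Fin k → ℕ)} {H n : ℕ}
    {X : Fin n → Vec (k + 2)} {j : Fin k → ℕ} (hj : j ∈ cells k N)
    (hX : ∃ l, cellBump k N j (X l) = 1) :
    cellSign (estSigns N (expertSample s κ N T (H + 1) n X)) j = cellSign T j := by
  have hval : ∀ l, cellBump k N j (X l) = 1 →
      profile k s κ N T (X l) = κ / N ^ s * cellSign T j := fun l hl => by
    rw [profile_eq_of_cellBump_ne_zero s κ T hj (by rw [hl]; exact one_ne_zero), hl, mul_one]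
  have hpos : 0 < κ / (N : ℝ) ^ s := by positivity
  by_cases hT : j ∈ T
  · obtain ⟨l, hl⟩ := hX
    have hs : cellSign T j = 1 := if_pos hT
    rw [hs]
    refine if_pos (mem_estSigns_expertSample.2 ⟨hj, l, hl, ?_⟩)
    rw [hval l hl, hs, mul_one]
    exact hpos
  · have hs : cellSign T j = -1 := if_neg hT
    rw [hs]
    refine if_neg fun h => ?_
    obtain ⟨-, l, hl, hp⟩ := mem_estSigns_expertSample.1 h
    rw [hval l hl, hs] at hp
    linarith

theorem one_le_of_mem_cells {k N : ℕ} (hk : 1 ≤ k) {j : Fin k → ℕ} (hj : j ∈ cells k N) :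
    1 ≤ N :=
  Nat.one_le_of_lt (Finset.mem_range.1 (Fintype.mem_piFinset.1 hj ⟨0, hk⟩))

/-- The squared error of the estimated perturbation: it is supported on the cells whose plateau
the sample misses. -/
theorem sq_profile_sub_le {k s : ℕ} {κ : ℝ} (hk : 1 ≤ k) (hκ : 0 < κ) (N : ℕ)
    (T : Finset (Fin k → ℕ)) {H n : ℕ} (X : Fin n → Vec (k + 2)) (x : Vec (k + 2)) :
    ENNReal.ofReal ((profile k s κ N (estSigns N (expertSample s κ N T (H + 1) n X)) x -
        profile k s κ N T x) ^ 2) ≤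
      ∑ j ∈ cells k N, {X : Fin n → Vec (k + 2) | ∀ l, cellBump k N j (X l) ≠ 1}.indicator
        (fun _ => ENNReal.ofReal ((2 * κ / N ^ s) ^ 2)) X *
          {x | cellBump k N j x ≠ 0}.indicator (fun _ => 1) x := by
  set T' := estSigns N (expertSample s κ N T (H + 1) n X)
  by_cases h : ∃ j ∈ cells k N, cellBump k N j x ≠ 0
  · obtain ⟨j, hj, hx⟩ := h
    have hN := one_le_of_mem_cells hk hj
    refine le_trans ?_ (Finset.single_le_sum (fun _ _ => zero_le) hj)
    rw [Set.indicator_of_mem (s := {x | cellBump k N j x ≠ 0}) hx, mul_one]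
    rw [profile_eq_of_cellBump_ne_zero s κ T' hj hx, profile_eq_of_cellBump_ne_zero s κ T hj hx]
    by_cases hX : ∃ l, cellBump k N j (X l) = 1
    · rw [cellSign_estSigns hκ hN hj hX]
      simp
    · push Not at hX
      rw [Set.indicator_of_mem (by exact hX)]
      refine ENNReal.ofReal_le_ofReal ?_
      have e : κ / (N : ℝ) ^ s * cellSign T' j * cellBump k N j x -
          κ / N ^ s * cellSign T j * cellBump k N j x =
          κ / N ^ s * ((cellSign T' j - cellSign T j) * cellBump k N j x) := by ring
      rw [e, ← sq_abs, abs_mul, abs_mul, abs_of_pos (by positivity : 0 < κ / (N : ℝ) ^ s),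
        abs_of_nonneg (cellBump_nonneg k N j x)]
      have h2 : |cellSign T' j - cellSign T j| ≤ 2 := by
        refine (abs_sub _ _).trans ?_
        rw [abs_cellSign, abs_cellSign]
        norm_num
      have h1 := cellBump_le_one k N j x
      have h0 := cellBump_nonneg k N j x
      calc (κ / (N : ℝ) ^ s * (|cellSign T' j - cellSign T j| * cellBump k N j x)) ^ 2
          ≤ (κ / (N : ℝ) ^ s * (2 * 1)) ^ 2 := by gcongr
        _ = (2 * κ / N ^ s) ^ 2 := by ring
  · push Not at h
    have e : ∀ T, profile k s κ N T x = 0 := fun T =>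
      Finset.sum_eq_zero fun j hj => by rw [h j hj, mul_zero]
    rw [e, e]
    simp

theorem measurableSet_forall_plateau (k N n : ℕ) (j : Fin k → ℕ) :
    MeasurableSet {X : Fin n → Vec (k + 2) | ∀ l, cellBump k N j (X l) ≠ 1} := by
  rw [Set.ofPred_forall]
  exact MeasurableSet.iInter fun l =>
    ((measurable_cellBump k N j).comp (measurable_pi_apply l)) (measurableSet_singleton 1).compl

/-- A sample of size `n` misses the plateau of a given cell with exponentially small probability in
the number of sample points per cell. -/
theorem measure_miss_plateau_le {k N : ℕ} (hk : 1 ≤ k) (hN : 1 ≤ N) {j : Fin k → ℕ}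
    (hj : j ∈ cells k N) (r : ℝ) (n : ℕ) :
    (Measure.pi fun _ : Fin n => initLaw k r) {X | ∀ l, cellBump k N j (X l) ≠ 1} ≤
      ENNReal.ofReal (Real.exp (-((1 / (2 * k)) ^ k / 3 * (n / N ^ k)))) := by
  set p : ℝ := (1 / (2 * k)) ^ k / 3 / N ^ k with hp
  have hp0 : 0 ≤ p := by positivity
  have h1 : ENNReal.ofReal p ≤ initLaw k r {x | cellBump k N j x = 1} := by
    have h2 := initLaw_cellBump hk r j (N := N) (s := {1}) (measurableSet_singleton 1) (by simp)
    refine le_trans ?_ (le_of_eq h2.symm)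
    have h3 : ENNReal.ofReal p = 3⁻¹ * ENNReal.ofReal ((1 / (2 * k)) ^ k / N ^ k) := by
      have e3 : (3⁻¹ : ENNReal) = ENNReal.ofReal (1 / 3) := by
        rw [one_div, ENNReal.ofReal_inv_of_pos (by norm_num)]
        norm_num
      rw [e3, ← ENNReal.ofReal_mul (by norm_num)]
      congr 1
      rw [hp]
      ring
    rw [h3]
    gcongr
    exact gridLaw_plateau_ge hk hN hj
  have h4 : initLaw k r {x | cellBump k N j x ≠ 1} ≤ ENNReal.ofReal (Real.exp (-p)) := by
    have e : {x | cellBump k N j x ≠ 1} = {x | cellBump k N j x = 1}ᶜ := rfl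
    rw [e, prob_compl_eq_one_sub (measurableSet_plateau k N j)]
    refine (tsub_le_tsub_left h1 _).trans ?_
    rw [← ENNReal.ofReal_one, ← ENNReal.ofReal_sub _ hp0]
    exact ENNReal.ofReal_le_ofReal (Real.one_sub_le_exp_neg p)
  have e : {X : Fin n → Vec (k + 2) | ∀ l, cellBump k N j (X l) ≠ 1} =
      Set.univ.pi fun _ => {x | cellBump k N j x ≠ 1} := by
    ext X
    simp
  rw [e, Measure.pi_pi, Finset.prod_const, Finset.card_univ, Fintype.card_fin]
  refine (pow_le_pow_left₀ zero_le h4 n).trans ?_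
  rw [← ENNReal.ofReal_pow (Real.exp_nonneg _), ← Real.exp_nat_mul]
  refine ENNReal.ofReal_le_ofReal (Real.exp_le_exp.2 (le_of_eq ?_))
  rw [hp]
  ring

/-- The height `N^{-s}` of the bumps, weighted with the probability `e^{-c n / N^k}` of missing a
plateau, is of order `n^{-s/k}` uniformly in `N`: fine grids have low bumps, and the cells of
coarse grids are all visited. -/
theorem exists_height_bound (k s : ℕ) (hk : 1 ≤ k) : ∃ K : ℝ, 1 ≤ K ∧ ∀ N n : ℕ, 1 ≤ N → 1 ≤ n →
    (1 / (N : ℝ) ^ s) ^ 2 * Real.exp (-((1 / (2 * k)) ^ k / 3 * (n / N ^ k))) ≤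
      K * rate k s n ^ 2 := by
  set c : ℝ := (1 / (2 * k)) ^ k / 3
  have hc : 0 < c := by positivity
  refine ⟨2 + 2 * ((2 * s).factorial / c ^ (2 * s)), ?_, fun N n hN hn => ?_⟩
  · have : 0 ≤ ((2 * s).factorial : ℝ) / c ^ (2 * s) := by positivity
    linarith
  set y : ℝ := n / (N : ℝ) ^ k
  have hN0 : (0 : ℝ) < N := by exact_mod_cast hN
  have hn0 : (0 : ℝ) < n := by exact_mod_cast hn
  have hy : 0 < y := by positivity
  have hk0 : (0 : ℝ) < k := by exact_mod_cast hk
  have hheight : 1 / (N : ℝ) ^ s = y ^ ((s : ℝ) / k) * rate k s n := by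
    have e1 : ((N : ℝ) ^ k) ^ ((s : ℝ) / k) = (N : ℝ) ^ s := by
      rw [← Real.rpow_natCast, ← Real.rpow_mul hN0.le, mul_div_cancel₀ _ hk0.ne',
        Real.rpow_natCast]
    rw [rate, Real.div_rpow hn0.le (by positivity), e1, neg_div, Real.rpow_neg hn0.le]
    field_simp
  have hys : y ^ ((s : ℝ) / k) ≤ 1 + y ^ s := by
    rcases le_total y 1 with h | h
    · have h1 : y ^ ((s : ℝ) / k) ≤ 1 := Real.rpow_le_one hy.le h (by positivity)
      have h2 : 0 < y ^ s := by positivity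
      linarith
    · have h1 : y ^ ((s : ℝ) / k) ≤ y ^ (s : ℝ) := by
        refine Real.rpow_le_rpow_of_exponent_le h (div_le_self (by positivity) ?_)
        exact_mod_cast hk
      rw [Real.rpow_natCast] at h1
      linarith
  have hexp : y ^ (2 * s) * Real.exp (-(c * y)) ≤ (2 * s).factorial / c ^ (2 * s) := by
    have h1 := Real.pow_div_factorial_le_exp _ (mul_pos hc hy).le (2 * s)
    rw [mul_pow, div_le_iff₀ (by positivity)] at h1
    rw [Real.exp_neg, le_div_iff₀ (by positivity), ← div_eq_mul_inv, div_mul_eq_mul_div,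
      div_le_iff₀ (Real.exp_pos _)]
    linarith
  have hexp1 : Real.exp (-(c * y)) ≤ 1 := Real.exp_le_one_iff.2 (by nlinarith)
  have hsq : (y ^ ((s : ℝ) / k)) ^ 2 ≤ 2 + 2 * y ^ (2 * s) := by
    have h0 : 0 ≤ y ^ ((s : ℝ) / k) := by positivity
    calc (y ^ ((s : ℝ) / k)) ^ 2 ≤ (1 + y ^ s) ^ 2 := by gcongr
      _ ≤ 2 + 2 * (y ^ s) ^ 2 := by nlinarith [sq_nonneg (1 - y ^ s)]
      _ = 2 + 2 * y ^ (2 * s) := by rw [← pow_mul, mul_comm s 2]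
  rw [hheight, mul_pow]
  have h5 : (y ^ ((s : ℝ) / k)) ^ 2 * Real.exp (-(c * y)) ≤
      2 + 2 * ((2 * s).factorial / c ^ (2 * s)) := by
    calc (y ^ ((s : ℝ) / k)) ^ 2 * Real.exp (-(c * y))
        ≤ (2 + 2 * y ^ (2 * s)) * Real.exp (-(c * y)) := by gcongr
      _ = 2 * Real.exp (-(c * y)) + 2 * (y ^ (2 * s) * Real.exp (-(c * y))) := by ring
      _ ≤ _ := by linarith
  calc (y ^ ((s : ℝ) / k)) ^ 2 * rate k s n ^ 2 * Real.exp (-(c * y))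
      = ((y ^ ((s : ℝ) / k)) ^ 2 * Real.exp (-(c * y))) * rate k s n ^ 2 := by ring
    _ ≤ _ := by gcongr

theorem lintegral_sqrt_le {Ω : Type*} [MeasurableSpace Ω] (P : Measure Ω) [IsProbabilityMeasure P]
    {Y : Ω → ENNReal} (hY : Measurable Y) :
    ∫⁻ ω, Y ω ^ (1 / 2 : ℝ) ∂P ≤ (∫⁻ ω, Y ω ∂P) ^ (1 / 2 : ℝ) := by
  have h := ENNReal.lintegral_mul_le_Lp_mul_Lq P Real.HolderConjugate.two_two
    (hY.pow_const (1 / 2 : ℝ)).aemeasurable (measurable_const (a := (1 : ENNReal))).aemeasurable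
  have e : ∀ ω, (Y ω ^ (1 / 2 : ℝ)) ^ (2 : ℝ) = Y ω := fun ω => by
    rw [← ENNReal.rpow_mul]
    norm_num
  simpa only [Pi.mul_apply, mul_one, e, ENNReal.one_rpow, lintegral_const, measure_univ] using h

/-- The error of the learned policy under the expert distribution comes from the first step. -/
theorem expertRisk_learned_le {k s : ℕ} {κ : ℝ} (hk : 1 ≤ k) (hκ : 0 < κ)
    (hprof : ∀ N T, IsProfile (profile k s κ N T)) (σ : ℝ) (N : ℕ)
    (T : Finset (Fin k → ℕ)) {r : ℝ} (hr0 : 0 ≤ r) (hr : r ≤ 1) (H n : ℕ)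
    (X : Fin (n + 1) → Vec (k + 2)) :
    expertRisk 2 (learned s κ (expertSample s κ N T (H + 1) (n + 1) X)).toPolicy
      (inst k s κ σ N T) (initLaw k r) (H + 1) ≤
      (∑ j ∈ cells k N,
        {X : Fin (n + 1) → Vec (k + 2) | ∀ l, cellBump k N j (X l) ≠ 1}.indicator
        (fun _ => ENNReal.ofReal ((2 * κ / N ^ s) ^ 2)) X * ENNReal.ofReal (1 / N ^ k)) ^
          (1 / 2 : ℝ) := by
  set S := expertSample s κ N T (H + 1) (n + 1) X
  set T' := estSigns N S
  have hlearn : ∀ x, x 1 = 0 → learned s κ S x - (inst k s κ σ N T).1 x =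
      plane k 0 (profile k s κ N T' x - profile k s κ N T x) := by
    intro x hx
    have e : estGrid S = N := estGrid_expertSample κ N T H n X
    rw [learned, learnedOnGrid, e]
    simp only [inst, expert, plane_sub, hx]
    congr 1 <;> ring
  have hzero : ∀ T, profile k s κ N T 0 = 0 := fun T => (hprof N T).eq_zero 0 fun _ => rfl
  have htraj : ∀ t : Fin (H + 1),
      ∫⁻ τ, ∫⁻ u, ‖u - (inst k s κ σ N T).1 (τ t).1‖ₑ ^ (2 : ℝ)
        ∂((learned s κ S).toPolicy (τ t).1)
        ∂(trajLaw (inst k s κ σ N T).1.toPolicy (inst k s κ σ N T).2 (initLaw k r) (H + 1)) ≤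
      ∫⁻ x, ‖learned s κ S (expertTraj (1 / (N + 1)) (profile k s κ N T) (H + 1) x t).1 -
        (inst k s κ σ N T).1 (expertTraj (1 / (N + 1)) (profile k s κ N T) (H + 1) x t).1‖ₑ ^
          (2 : ℝ) ∂(initLaw k r) := by
    intro t
    have e := trajLaw_expert σ (1 / (N + 1)) (hprof N T).contDiff.continuous (hzero T)
      (ae_initLaw_one hk hr0 hr) (H + 1)
    simp only [DetPolicy.toPolicy, lintegral_dirac]
    change ∫⁻ τ, _ ∂(trajLaw (expert σ (1 / (N + 1)) (profile k s κ N T)).toPolicy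
      (dyn σ (profile k s κ N T)) (initLaw k r) (H + 1)) ≤ _
    rw [e]
    exact lintegral_map_le _ _
  have hlate : ∀ t : Fin H,
      (∫⁻ τ, ∫⁻ u, ‖u - (inst k s κ σ N T).1 (τ t.succ).1‖ₑ ^ (2 : ℝ)
        ∂((learned s κ S).toPolicy (τ t.succ).1)
        ∂(trajLaw (inst k s κ σ N T).1.toPolicy (inst k s κ σ N T).2 (initLaw k r) (H + 1))) ^
          (1 / 2 : ℝ) = 0 := by
    intro t
    have h := htraj t.succ
    have e : ∀ x, (expertTraj (1 / (N + 1)) (profile k s κ N T) (H + 1) x t.succ).1 = 0 :=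
      fun x => by simp [expertTraj]
    simp only [e, hlearn 0 rfl, hzero, sub_self, plane_zero_zero, enorm_zero] at h
    rw [ENNReal.zero_rpow_of_pos (by norm_num), lintegral_zero, nonpos_iff_eq_zero] at h
    rw [h, ENNReal.zero_rpow_of_pos (by norm_num)]
  rw [expertRisk, Fin.sum_univ_succ, Finset.sum_eq_zero fun t _ => hlate t, add_zero]
  gcongr
  refine (htraj 0).trans ?_
  calc ∫⁻ x, ‖learned s κ S (expertTraj (1 / (N + 1)) (profile k s κ N T) (H + 1) x 0).1 -
        (inst k s κ σ N T).1 (expertTraj (1 / (N + 1)) (profile k s κ N T) (H + 1) x 0).1‖ₑ ^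
          (2 : ℝ) ∂(initLaw k r)
      ≤ ∫⁻ x, ∑ j ∈ cells k N,
          {X : Fin (n + 1) → Vec (k + 2) | ∀ l, cellBump k N j (X l) ≠ 1}.indicator
          (fun _ => ENNReal.ofReal ((2 * κ / N ^ s) ^ 2)) X *
            {x | cellBump k N j x ≠ 0}.indicator (fun _ => 1) x ∂(initLaw k r) := by
        refine lintegral_mono_ae ?_
        filter_upwards [ae_initLaw_one hk hr0 hr] with x hx
        refine le_trans ?_ (sq_profile_sub_le hk hκ N T (H := H) X x)
        have e : (expertTraj (1 / (N + 1)) (profile k s κ N T) (H + 1) x 0).1 = x := by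
          simp [expertTraj]
        rw [e, hlearn x hx]
        set b := profile k s κ N T' x - profile k s κ N T x
        have hb : ‖plane k 0 b‖ ≤ |b| := (norm_plane_le k 0 b).trans (by simp)
        rw [← ofReal_norm, ENNReal.ofReal_rpow_of_nonneg (norm_nonneg _) (by norm_num)]
        refine ENNReal.ofReal_le_ofReal ?_
        rw [Real.rpow_two, ← sq_abs b]
        gcongr
    _ = ∑ j ∈ cells k N,
          {X : Fin (n + 1) → Vec (k + 2) | ∀ l, cellBump k N j (X l) ≠ 1}.indicator
          (fun _ => ENNReal.ofReal ((2 * κ / N ^ s) ^ 2)) X *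
            initLaw k r {x | cellBump k N j x ≠ 0} := by
        rw [lintegral_finsetSum _ fun j _ => (measurable_const.indicator
          (measurableSet_cellBump_ne_zero k N j)).const_mul _]
        refine Finset.sum_congr rfl fun j _ => ?_
        rw [lintegral_const_mul _ (measurable_const.indicator
          (measurableSet_cellBump_ne_zero k N j)),
          lintegral_indicator_const (measurableSet_cellBump_ne_zero k N j), one_mul]
    _ ≤ _ := by
        gcongr with j hj
        have h3 := initLaw_cellBump hk r j (N := N) (s := {0}ᶜ) (measurableSet_singleton 0).compl
          (by simp)
        refine (le_of_eq h3).trans ?_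
        calc 3⁻¹ * gridLaw k {x | cellBump k N j x ∈ ({0}ᶜ : Set ℝ)}
            ≤ 1 * ENNReal.ofReal (1 / N ^ k) := by
              gcongr
              · exact ENNReal.inv_le_one.2 (by norm_num)
              · exact gridLaw_support_le hk (one_le_of_mem_cells hk hj) j
          _ = _ := one_mul _

/-- The learner reaches the rate `n^{-s/k}`: by Jensen's inequality it suffices to bound the expected
squared error, to which each cell contributes its squared height times the probability that its
plateau is missed. -/
theorem learner_risk_le {k s : ℕ} {κ K : ℝ} (hk : 1 ≤ k) (hκ : 0 < κ) (hκ1 : κ ≤ 1)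
    (hprof : ∀ N T, IsProfile (profile k s κ N T)) (hK1 : 1 ≤ K)
    (hK : ∀ N n : ℕ, 1 ≤ N → 1 ≤ n →
      (1 / (N : ℝ) ^ s) ^ 2 * Real.exp (-((1 / (2 * k)) ^ k / 3 * (n / N ^ k))) ≤
        K * rate k s n ^ 2)
    {r : ℝ} (hr0 : 0 ≤ r) (hr : r ≤ 1) (H n : ℕ) {p} (hp : p ∈ instClass k s κ) :
    ∫⁻ S, ∫⁻ ω, expertRisk 2 ((learner k s κ H n).output S ω) p (initLaw k r) (H + 1)
      ∂((learner k s κ H n).seedLaw S) ∂(sampleLaw p (initLaw k r) (H + 1) (n + 1)) ≤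
      ENNReal.ofReal (2 * K * rate k s (n + 1)) := by
  obtain ⟨σ, -, N, T, rfl⟩ := hp
  have hrate : 0 ≤ rate k s (n + 1) := by unfold rate; positivity
  set P := Measure.pi fun _ : Fin (n + 1) => initLaw k r
  set Y : (Fin (n + 1) → Vec (k + 2)) → ENNReal := fun X => ∑ j ∈ cells k N,
    {X : Fin (n + 1) → Vec (k + 2) | ∀ l, cellBump k N j (X l) ≠ 1}.indicator
      (fun _ => ENNReal.ofReal ((2 * κ / N ^ s) ^ 2)) X * ENNReal.ofReal (1 / N ^ k)
  have hind : ∀ j, Measurable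
      ({X : Fin (n + 1) → Vec (k + 2) | ∀ l, cellBump k N j (X l) ≠ 1}.indicator
        fun _ => ENNReal.ofReal ((2 * κ / N ^ s) ^ 2)) := fun j =>
    measurable_const.indicator (measurableSet_forall_plateau k N (n + 1) j)
  have hYm : Measurable Y := Finset.measurable_fun_sum _ fun j _ => (hind j).mul_const _
  have hYint : ∫⁻ X, Y X ∂P ≤ ENNReal.ofReal ((2 * K * rate k s (n + 1)) ^ 2) := by
    simp only [Y]
    rw [lintegral_finsetSum _ fun j _ => (hind j).mul_const _]
    have hterm : ∀ j ∈ cells k N, ∫⁻ X,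
        {X : Fin (n + 1) → Vec (k + 2) | ∀ l, cellBump k N j (X l) ≠ 1}.indicator
          (fun _ => ENNReal.ofReal ((2 * κ / N ^ s) ^ 2)) X * ENNReal.ofReal (1 / N ^ k) ∂P ≤
        ENNReal.ofReal ((2 * K * rate k s (n + 1)) ^ 2 / N ^ k) := by
      intro j hj
      have hN := one_le_of_mem_cells hk hj
      have hN0 : (0 : ℝ) < N := by exact_mod_cast hN
      rw [lintegral_mul_const _ (hind j),
        lintegral_indicator_const (measurableSet_forall_plateau k N (n + 1) j)]
      calc ENNReal.ofReal ((2 * κ / N ^ s) ^ 2) *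
            P {X | ∀ l, cellBump k N j (X l) ≠ 1} * ENNReal.ofReal (1 / N ^ k)
          ≤ ENNReal.ofReal ((2 * κ / N ^ s) ^ 2) * ENNReal.ofReal
              (Real.exp (-((1 / (2 * k)) ^ k / 3 * ((n + 1 : ℕ) / N ^ k)))) *
              ENNReal.ofReal (1 / N ^ k) := by
            gcongr
            exact measure_miss_plateau_le hk hN hj r (n + 1)
        _ = ENNReal.ofReal ((2 * κ / N ^ s) ^ 2 *
              Real.exp (-((1 / (2 * k)) ^ k / 3 * ((n + 1 : ℕ) / N ^ k))) * (1 / N ^ k)) := by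
            rw [ENNReal.ofReal_mul (by positivity), ENNReal.ofReal_mul (by positivity)]
        _ ≤ _ := by
            refine ENNReal.ofReal_le_ofReal ?_
            rw [mul_one_div]
            gcongr
            have h1 := hK N (n + 1) hN (by omega)
            set e := Real.exp (-((1 / (2 * k)) ^ k / 3 * ((n + 1 : ℕ) / N ^ k)))
            calc (2 * κ / (N : ℝ) ^ s) ^ 2 * e
                = 4 * κ ^ 2 * ((1 / (N : ℝ) ^ s) ^ 2 * e) := by ring
              _ ≤ 4 * 1 ^ 2 * (K * rate k s (n + 1) ^ 2) := by gcongr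
              _ ≤ 4 * 1 ^ 2 * (K ^ 2 * rate k s (n + 1) ^ 2) := by
                  gcongr
                  nlinarith
              _ = (2 * K * rate k s (n + 1)) ^ 2 := by ring
    refine (Finset.sum_le_sum hterm).trans ?_
    rw [Finset.sum_const, card_cells, nsmul_eq_mul, ← ENNReal.ofReal_natCast,
      ← ENNReal.ofReal_mul (by positivity)]
    refine ENNReal.ofReal_le_ofReal ?_
    rcases Nat.eq_zero_or_pos N with h | h
    · subst h
      have : k ≠ 0 := by omega
      simp only [ne_eq, this, not_false_eq_true, zero_pow, Nat.cast_zero, zero_mul]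
      positivity
    · have hN0 : (0 : ℝ) < N := by exact_mod_cast h
      push_cast
      rw [mul_div_cancel₀ _ (by positivity)]
  rw [sampleLaw_inst hk (hprof N T) σ hr0 hr]
  refine (lintegral_map_le _ _).trans ?_
  calc ∫⁻ X, ∫⁻ ω, expertRisk 2
          ((learner k s κ H n).output (expertSample s κ N T (H + 1) (n + 1) X) ω)
          (inst k s κ σ N T) (initLaw k r) (H + 1)
          ∂((learner k s κ H n).seedLaw (expertSample s κ N T (H + 1) (n + 1) X)) ∂P
      ≤ ∫⁻ X, Y X ^ (1 / 2 : ℝ) ∂P := by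
        refine lintegral_mono fun X => ?_
        simp only [learner_output]
        rw [lintegral_const, measure_univ, mul_one]
        exact expertRisk_learned_le hk hκ hprof σ N T hr0 hr H n X
    _ ≤ (∫⁻ X, Y X ∂P) ^ (1 / 2 : ℝ) := lintegral_sqrt_le P hYm
    _ ≤ ENNReal.ofReal ((2 * K * rate k s (n + 1)) ^ 2) ^ (1 / 2 : ℝ) := by gcongr
    _ = ENNReal.ofReal (2 * K * rate k s (n + 1)) := by
        have h0 : 0 ≤ 2 * K * rate k s (n + 1) := by positivity
        rw [ENNReal.ofReal_rpow_of_nonneg (by positivity) (by norm_num), ← Real.sqrt_eq_rpow,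
          Real.sqrt_sq h0]

/-! ### From probabilities to expected costs -/

theorem isProbabilityMeasure_trajLaw {d m : ℕ} (π : Kernel (Vec d) (Vec m)) [IsMarkovKernel π]
    (f : Dynamics d m) (hf : Measurable fun p : Vec d × Vec m => f p.1 p.2) (D : Measure (Vec d))
    [IsProbabilityMeasure D] (H : ℕ) : IsProbabilityMeasure (trajLaw π f D H) := by
  refine ⟨?_⟩
  have h := (rollout_measurable π f hf H).2
  rw [trajLaw_apply π f hf D H MeasurableSet.univ]
  simp [measure_univ]

/-- The expected cost of the returned policy. -/
def meanCost {k H n : ℕ} (alg : Algorithm (k + 2) (k + 2) H n) (f : Dynamics (k + 2) (k + 2))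
    (D : Measure (Vec (k + 2))) (p : Sample (k + 2) (k + 2) H n × alg.Seed) : ENNReal :=
  ∫⁻ T, ENNReal.ofReal (totalCost (stageCost k) T) ∂(trajLaw (alg.output p.1 p.2) f D H)

theorem measurable_meanCost {k H n : ℕ} (alg : Algorithm (k + 2) (k + 2) H n)
    {f : Dynamics (k + 2) (k + 2)}
    (hf : Measurable fun p : Vec (k + 2) × Vec (k + 2) => f p.1 p.2)
    (D : Measure (Vec (k + 2))) [IsProbabilityMeasure D] : Measurable (meanCost alg f D) := by
  obtain ⟨κ, _, e⟩ := exists_kernel_rollout alg.policy f hf H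
  have hF : Measurable fun T : Traj (k + 2) (k + 2) H =>
      ENNReal.ofReal (totalCost (stageCost k) T) := (measurable_totalCost k H).ennreal_ofReal
  have h : Measurable fun p : Sample (k + 2) (k + 2) H n × alg.Seed =>
      ∫⁻ x, ∫⁻ T, ENNReal.ofReal (totalCost (stageCost k) T) ∂(κ (p, x)) ∂D :=
    (Measurable.lintegral_kernel hF).lintegral_prod_right'
  convert h using 2 with p
  have hm := (rollout_measurable (outputKernel alg p.1 p.2) f hf H).1
  have h1 : meanCost alg f D p = ∫⁻ x, ∫⁻ T, ENNReal.ofReal (totalCost (stageCost k) T)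
      ∂(rollout (outputKernel alg p.1 p.2) f H x) ∂D :=
    Measure.lintegral_bind hm.aemeasurable hF.aemeasurable
  rw [h1]
  refine lintegral_congr fun x => ?_
  rw [e]
  rfl

theorem meanCost_le {k H n : ℕ} (alg : Algorithm (k + 2) (k + 2) H n)
    {f : Dynamics (k + 2) (k + 2)}
    (hf : Measurable fun p : Vec (k + 2) × Vec (k + 2) => f p.1 p.2)
    (D : Measure (Vec (k + 2))) [IsProbabilityMeasure D]
    (p : Sample (k + 2) (k + 2) H n × alg.Seed) : meanCost alg f D p ≤ H := by
  have hp := isProbabilityMeasure_trajLaw (outputKernel alg p.1 p.2) f hf D H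
  calc meanCost alg f D p ≤ ∫⁻ _, (H : ENNReal) ∂(trajLaw (outputKernel alg p.1 p.2) f D H) := by
        refine lintegral_mono fun T => ?_
        rw [← ENNReal.ofReal_natCast]
        exact ENNReal.ofReal_le_ofReal (totalCost_le (isLipCost_stageCost k) T)
    _ = H := by rw [lintegral_const, measure_univ, mul_one]

/-- If the expert pays nothing, a failure probability `c` at the threshold `τ` forces an expected
excess cost of at least `τ * c`, by Markov's inequality. The cost is bounded by `H`, so the Bochner
integrals are genuine. -/
theorem integral_costRisk_ge {k H n : ℕ} (alg : Algorithm (k + 2) (k + 2) H n)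
    {p : DetPolicy (k + 2) (k + 2) × Dynamics (k + 2) (k + 2)}
    (hf : Measurable fun q : Vec (k + 2) × Vec (k + 2) => p.2 q.1 q.2)
    (D : Measure (Vec (k + 2))) [IsProbabilityMeasure D]
    (μ : Measure (Sample (k + 2) (k + 2) H n)) [IsProbabilityMeasure μ]
    (hexp : ∀ᵐ T ∂(trajLaw p.1.toPolicy p.2 D H), totalCost (stageCost k) T = 0)
    {τ c : ℝ} (hτ : 0 ≤ τ)
    (h : ENNReal.ofReal c ≤ ∫⁻ S, ∫⁻ ω, trajLaw (alg.output S ω) p.2 D H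
      {T | τ ≤ totalCost (stageCost k) T} ∂(alg.seedLaw S) ∂μ) :
    τ * c ≤ ∫ S, ∫ ω, costRisk (stageCost k) (alg.output S ω) p D H ∂(alg.seedLaw S) ∂μ := by
  have hm := measurable_meanCost alg hf D
  have hle := meanCost_le alg hf D
  have hrisk : ∀ S ω, costRisk (stageCost k) (alg.output S ω) p D H =
      (meanCost alg p.2 D (S, ω)).toReal := fun S ω => by
    rw [costRisk, integral_eq_zero_of_ae hexp, sub_zero, integral_eq_lintegral_of_nonneg_ae
      (Filter.Eventually.of_forall fun T => totalCost_nonneg (isLipCost_stageCost k) T)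
      (measurable_totalCost k H).aestronglyMeasurable]
    rfl
  have hfin : ∀ q, meanCost alg p.2 D q < ⊤ := fun q =>
    (hle q).trans_lt (ENNReal.natCast_lt_top H)
  have hin : ∀ S, ∫⁻ ω, meanCost alg p.2 D (S, ω) ∂(alg.seedLaw S) ≤ H := fun S => by
    refine (lintegral_mono fun ω => hle (S, ω)).trans ?_
    rw [lintegral_const, measure_univ, mul_one]
  have houter : ∫⁻ S, ∫⁻ ω, meanCost alg p.2 D (S, ω) ∂(alg.seedLaw S) ∂μ ≤ H := by
    refine (lintegral_mono hin).trans ?_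
    rw [lintegral_const, measure_univ, mul_one]
  have hmS : Measurable fun S => ∫⁻ ω, meanCost alg p.2 D (S, ω) ∂(alg.seedLaw S) :=
    Measurable.lintegral_kernel_prod_right' (κ := alg.seedLaw) hm
  have hint : ∫ S, ∫ ω, costRisk (stageCost k) (alg.output S ω) p D H ∂(alg.seedLaw S) ∂μ =
      (∫⁻ S, ∫⁻ ω, meanCost alg p.2 D (S, ω) ∂(alg.seedLaw S) ∂μ).toReal := by
    simp only [hrisk]
    rw [← integral_toReal hmS.aemeasurable
      (Filter.Eventually.of_forall fun S => (hin S).trans_lt (ENNReal.natCast_lt_top H))]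
    refine integral_congr_ae (Filter.Eventually.of_forall fun S => ?_)
    exact integral_toReal (hm.comp measurable_prodMk_left).aemeasurable
      (Filter.Eventually.of_forall fun ω => hfin (S, ω))
  rw [hint, ← ENNReal.ofReal_le_iff_le_toReal (houter.trans_lt (ENNReal.natCast_lt_top H)).ne,
    ENNReal.ofReal_mul hτ]
  calc ENNReal.ofReal τ * ENNReal.ofReal c
      ≤ ENNReal.ofReal τ * ∫⁻ S, ∫⁻ ω, trajLaw (alg.output S ω) p.2 D H
          {T | τ ≤ totalCost (stageCost k) T} ∂(alg.seedLaw S) ∂μ := by gcongr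
    _ = ∫⁻ S, ∫⁻ ω, ENNReal.ofReal τ * trajLaw (alg.output S ω) p.2 D H
          {T | τ ≤ totalCost (stageCost k) T} ∂(alg.seedLaw S) ∂μ := by
        simp_rw [lintegral_const_mul' _ _ ENNReal.ofReal_ne_top]
    _ ≤ _ := by
        refine lintegral_mono fun S => lintegral_mono fun ω => ?_
        refine le_trans ?_ (mul_meas_ge_le_lintegral (measurable_totalCost k H).ennreal_ofReal
          (ENNReal.ofReal τ))
        exact mul_le_mul_right (measure_mono fun T hT => ENNReal.ofReal_le_ofReal hT) _

/-! ### Regularity of the class and simplicity of its policies -/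

theorem isSimplePolicy_toPolicy {d m : ℕ} {L M : ℝ} {μ : DetPolicy d m} (hL : IsLip L μ)
    (hM : IsSmooth M μ) : IsSimplePolicy L M μ.toPolicy := by
  have hmean : meanPolicy μ.toPolicy = μ := by
    funext x
    exact integral_dirac _ _
  refine ⟨fun x => integrable_dirac (by simp), ⟨Measure.dirac 0, fun x => ?_⟩, ?_, ?_⟩
  · rw [hmean, DetPolicy.toPolicy, Measure.map_dirac' (measurable_sub_const _), sub_self]
  · rw [hmean]
    exact hL
  · rw [hmean]
    exact hM

theorem isProper_isSimple {k s H n : ℕ} {κ : ℝ} (hprof : ∀ N T, IsProfile (profile k s κ N T))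
    (alg : Algorithm (k + 2) (k + 2) H n) (halg : alg.IsProper (instClass k s κ)) :
    alg.IsSimple 6 1 := by
  intro S
  filter_upwards [halg S] with ω hω
  obtain ⟨p, ⟨σ, hσ, N, T, rfl⟩, he⟩ := hω
  rw [he]
  exact isSimplePolicy_toPolicy (isLip_expert (abs_eq_one_of_mem hσ) _ (hprof N T))
    (isSmooth_expert σ _ (hprof N T))

theorem measurableSet_traj_bounded (d m H : ℕ) (R : ℝ) :
    MeasurableSet {T : Traj d m H | ∀ t, ‖(T t).1‖ ≤ R ∧ ‖(T t).2‖ ≤ R} := by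
  have h (t : Fin H) : Measurable fun T : Traj d m H => T t := measurable_pi_apply t
  have h1 (t : Fin H) : Measurable fun T : Traj d m H => ‖(T t).1‖ := (h t).fst.norm
  have h2 (t : Fin H) : Measurable fun T : Traj d m H => ‖(T t).2‖ := (h t).snd.norm
  rw [Set.ofPred_forall]
  exact MeasurableSet.iInter fun t => (measurableSet_le (h1 t) measurable_const).inter
    (measurableSet_le (h2 t) measurable_const)

theorem norm_expertTraj_le {k H : ℕ} {c : ℝ} (hc : |c| ≤ 1) {g : Vec (k + 2) → ℝ}
    (hg : IsProfile g) {x : Vec (k + 2)} (hx : ‖x‖ ≤ 1) (t : Fin H) :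
    ‖(expertTraj c g H x t).1‖ ≤ 3 ∧ ‖(expertTraj c g H x t).2‖ ≤ 3 := by
  unfold expertTraj
  split_ifs
  · refine ⟨hx.trans (by norm_num), (norm_plane_le _ _ _).trans ?_⟩
    have h0 := abs_coord_le x 0
    have h1 := abs_add_le (9 / 16 * x 0) (g x)
    rw [abs_mul, abs_of_pos (by norm_num : (0 : ℝ) < 9 / 16)] at h1
    linarith [hg.abs_le_one x]
  · refine ⟨by simp, (norm_plane_le _ _ _).trans ?_⟩
    rw [abs_zero]
    linarith

theorem ae_norm_le_trajLaw_expert {k : ℕ} (hk : 1 ≤ k) (σ : ℝ) {c : ℝ} (hc : |c| ≤ 1)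
    {g : Vec (k + 2) → ℝ} (hg : IsProfile g) {r : ℝ} (hr0 : 0 ≤ r) (hr : r ≤ 1) (H : ℕ) :
    ∀ᵐ T ∂(trajLaw (expert σ c g).toPolicy (dyn σ g) (initLaw k r) H),
      ∀ t, ‖(T t).1‖ ≤ 3 ∧ ‖(T t).2‖ ≤ 3 := by
  rw [trajLaw_expert σ c hg.contDiff.continuous (hg.eq_zero 0 fun _ => rfl)
    (ae_initLaw_one hk hr0 hr) H]
  refine (ae_map_iff (measurable_expertTraj c hg.contDiff.continuous H).aemeasurable
    (measurableSet_traj_bounded _ _ H 3)).2 ?_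
  filter_upwards [ae_initLaw hk hr0 hr] with x hx t
  exact norm_expertTraj_le hc hg hx.2 t

theorem isRegular_instClass {k s : ℕ} {κ : ℝ} (hk : 1 ≤ k)
    (hprof : ∀ N T, IsProfile (profile k s κ N T)) {r : ℝ} (hr0 : 0 ≤ r) (hr : r ≤ 1) :
    IsRegular 3 6 1 (instClass k s κ) (initLaw k r) := by
  rintro p ⟨σ, hσ, N, T, rfl⟩
  have hg := hprof N T
  have hσ1 := abs_eq_one_of_mem hσ
  have hc : |(1 / (N + 1) : ℝ)| ≤ 1 := by
    rw [abs_of_pos (by positivity)]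
    exact div_le_one_of_le₀ (by linarith [Nat.cast_nonneg (α := ℝ) N]) (by positivity)
  exact ⟨isLip_expert hσ1 _ hg, isSmooth_expert σ _ hg, isLip_dyn hσ1 hg, isSmooth_dyn σ hg,
    fun H => ae_norm_le_trajLaw_expert hk σ hc hg hr0 hr H⟩

/-! ### The lower bound at the scale of the theorem -/

/-- The grid used against samples of size `n`: about `n` cells, so that its bumps have height
`n^{-s/k}` up to a constant. -/
theorem exists_grid (k s n : ℕ) (hk : 1 ≤ k) (hn : 1 ≤ n) : ∃ N : ℕ, 1 ≤ N ∧ n ≤ N ^ k ∧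
    rate k s n / 2 ^ s ≤ 1 / (N : ℝ) ^ s := by
  have hn0 : (1 : ℝ) ≤ n := by exact_mod_cast hn
  have hk0 : (0 : ℝ) < k := by exact_mod_cast hk
  set y : ℝ := (n : ℝ) ^ (1 / (k : ℝ)) with hy
  have hy1 : 1 ≤ y := Real.one_le_rpow hn0 (by positivity)
  have hyk : y ^ k = n := by
    rw [hy, ← Real.rpow_natCast, ← Real.rpow_mul (by positivity), one_div,
      inv_mul_cancel₀ hk0.ne', Real.rpow_one]
  have hys : rate k s n = 1 / y ^ s := by
    rw [rate, hy, ← Real.rpow_natCast, ← Real.rpow_mul (by positivity), neg_div,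
      Real.rpow_neg (by positivity), one_div]
    congr 2
    ring
  have hceil : y ≤ ⌈y⌉₊ := Nat.le_ceil y
  have hceil' : (⌈y⌉₊ : ℝ) ≤ 2 * y := by
    have := Nat.ceil_lt_add_one (by linarith : 0 ≤ y)
    linarith
  have h1 : (1 : ℝ) ≤ ⌈y⌉₊ := hy1.trans hceil
  refine ⟨⌈y⌉₊, by exact_mod_cast h1, ?_, ?_⟩
  · have : (n : ℝ) ≤ (⌈y⌉₊ : ℝ) ^ k := by
      rw [← hyk]
      gcongr
    exact_mod_cast this
  · rw [hys, div_div, ← mul_pow]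
    refine one_div_le_one_div_of_le (by positivity) ?_
    rw [mul_comm]
    gcongr

theorem compoundedError_pos {k s n H : ℕ} (hn : 1 ≤ n) {L M : ℝ} (hL : 1 ≤ L) (hM : 1 ≤ M) :
    0 < compoundedError k s n H L M := by
  have hn0 : (0 : ℝ) < n := by exact_mod_cast hn
  unfold compoundedError rate
  refine lt_min ?_ ?_ <;> positivity

/-- The lower bound in the form of the theorem, for the threshold
`κ / (100 * 2 ^ s) * compoundedError`. -/
theorem exists_inst_compounding {k s H n : ℕ} {κ L M : ℝ} (hk : 1 ≤ k) (hκ : 0 < κ) (hκ1 : κ ≤ 1)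
    (hprof : ∀ N T, IsProfile (profile k s κ N T)) (hL : 1 ≤ L) (hM : 1 ≤ M) (hn : 1 ≤ n)
    (alg : Algorithm (k + 2) (k + 2) (H + 2) n) (halg : alg.IsSimple L M) :
    ∃ σ ∈ ({1, -1} : Finset ℝ), ∃ N T,
      ENNReal.ofReal ((1 / (2 * k)) ^ k / 18) ≤
        ∫⁻ S, ∫⁻ ω, trajLaw (alg.output S ω) (inst k s κ σ N T).2 (initLaw k (1 / (10 * M))) (H + 2)
          {T | κ / (100 * 2 ^ s) * compoundedError k s n (H + 2) L M ≤
            totalCost (stageCost k) T} ∂(alg.seedLaw S)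
          ∂(sampleLaw (inst k s κ σ N T) (initLaw k (1 / (10 * M))) (H + 2) n) := by
  obtain ⟨N, hN, hnN, hNs⟩ := exists_grid k s n hk hn
  have hM0 : 0 < M := by linarith
  set τ := κ / (100 * 2 ^ s) * compoundedError k s n (H + 2) L M with hτ_def
  have hcomp := compoundedError_pos (k := k) (s := s) (H := H + 2) hn hL hM
  have hτ0 : 0 < τ := by positivity
  have h2s : (1 : ℝ) ≤ 2 ^ s := one_le_pow₀ (by norm_num)
  have hC3 : κ / (100 * 2 ^ s) ≤ 1 / 100 := by
    rw [div_le_div_iff₀ (by positivity) (by norm_num)]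
    nlinarith
  have hcM : compoundedError k s n (H + 2) L M ≤ 1 / M := by
    refine (min_le_right _ _).trans (one_div_le_one_div_of_le hM0 ?_)
    have : 1 ≤ L ^ 2 := one_le_pow₀ hL
    nlinarith
  have hτM : τ ≤ 1 / 100 * (1 / M) := by
    rw [hτ_def]
    gcongr
  have hM1 : 1 / M ≤ 1 := div_le_one_of_le₀ hM hM0.le
  have hMM : M * (1 / M) = 1 := mul_one_div_cancel hM0.ne'
  have hr : 1 / (10 * M) = 1 / 10 * (1 / M) := by ring
  have hrate : 0 < rate k s n := by
    have hn0 : (0 : ℝ) < n := by exact_mod_cast hn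
    unfold rate
    positivity
  obtain ⟨σ, hσ, T, h⟩ := exists_inst_failure (H := H) (r := 1 / (10 * M)) (τ := τ) hk hN hnN hprof
    alg halg hτ0 (by linarith) (by nlinarith) (by positivity) (by rw [hr]; linarith)
    (by rw [hr]; nlinarith) (by rw [hr]; linarith) (by
      have h1 : compoundedError k s n (H + 2) L M ≤ 1.05 ^ (H + 2) * rate k s n := min_le_left _ _
      calc 2 * τ ≤ 2 * (κ / (100 * 2 ^ s) * (1.05 ^ (H + 2) * rate k s n)) := by
            rw [hτ_def]
            gcongr
        _ = (2 * 1.05 ^ 2 / 100) * (1.05 ^ H * (κ * (rate k s n / 2 ^ s))) := by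
            field_simp
            ring
        _ < 1 * (1.05 ^ H * (κ * (rate k s n / 2 ^ s))) := by
            refine mul_lt_mul_of_pos_right (by norm_num) (by positivity)
        _ ≤ 1 * (1.05 ^ H * (κ * (1 / (N : ℝ) ^ s))) := by gcongr
        _ = 1.05 ^ H * (κ / N ^ s) := by ring)
  exact ⟨σ, hσ, N, T, h⟩

end ImitationLearning

end

theorem mainTheorem2 :
    ∃ C ρ R L₀ M₀ : ℝ, 1 ≤ C ∧ 0 < ρ ∧ ρ < 1 ∧
    ∀ k s : ℕ, 1 ≤ k → 2 ≤ s →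
    ∃ C₁ C₂ C₃ C₄ : ℝ, 0 < C₁ ∧ 0 < C₂ ∧ 0 < C₃ ∧ 0 < C₄ ∧
    ∃ (I : ImitationLearning.InstanceClass (k + 2) (k + 2))
      (c : ImitationLearning.Vec (k + 2) → ImitationLearning.Vec (k + 2) → ℝ),
      ImitationLearning.IsLipCost c ∧
      (∀ p ∈ I, ImitationLearning.IsEIISS C ρ p.2 ∧
        ImitationLearning.IsEIISS C ρ (ImitationLearning.closedLoop p.1 p.2)) ∧
      ∀ L M : ℝ, 1 ≤ L → 1 ≤ M →
      ∃ D : MeasureTheory.Measure (ImitationLearning.Vec (k + 2)),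
        MeasureTheory.IsProbabilityMeasure D ∧
        ImitationLearning.IsRegular R L₀ M₀ I D ∧
        ∀ H n : ℕ, 2 ≤ H → 1 ≤ n →
          -- proper algorithms are simple, and one of them has small expert-distribution error
          (∀ alg : ImitationLearning.Algorithm (k + 2) (k + 2) H n,
            alg.IsProper I → alg.IsSimple L₀ M₀) ∧
          (∃ alg : ImitationLearning.Algorithm (k + 2) (k + 2) H n, alg.IsProper I ∧
            ∀ p ∈ I,
              ∫⁻ S, ∫⁻ ω, ImitationLearning.expertRisk 2 (alg.output S ω) p D H
                ∂(alg.seedLaw S) ∂(ImitationLearning.sampleLaw p D H n)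
              ≤ ENNReal.ofReal (C₁ * ImitationLearning.rate k s n)) ∧
          -- the expected execution error of simple algorithms compounds exponentially
          (∀ alg : ImitationLearning.Algorithm (k + 2) (k + 2) H n, alg.IsSimple L M →
            ∃ p ∈ I,
              C₂ * ImitationLearning.compoundedError k s n H L M ≤
                ∫ S, ∫ ω, ImitationLearning.costRisk c (alg.output S ω) p D H
                  ∂(alg.seedLaw S) ∂(ImitationLearning.sampleLaw p D H n)) ∧
          -- the cost vanishes almost surely on expert trajectories
          (∀ p ∈ I,
            ImitationLearning.trajLaw p.1.toPolicy p.2 D H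
              {τ | ImitationLearning.totalCost c τ = 0} = 1) ∧
          -- and simple algorithms incur large cost with constant probability
          (∀ alg : ImitationLearning.Algorithm (k + 2) (k + 2) H n, alg.IsSimple L M →
            ∃ p ∈ I,
              ENNReal.ofReal C₄ ≤
                ∫⁻ S, ∫⁻ ω,
                  ImitationLearning.trajLaw (alg.output S ω) p.2 D H
                    {τ | C₃ * ImitationLearning.compoundedError k s n H L M ≤
                      ImitationLearning.totalCost c τ}
                  ∂(alg.seedLaw S) ∂(ImitationLearning.sampleLaw p D H n)) := by
  open ImitationLearning in
  refine ⟨52, 7 / 8, 3, 6, 1, by norm_num, by norm_num, by norm_num, fun k s hk hs => ?_⟩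
  obtain ⟨κ, hκ, hκ1, hprof'⟩ := exists_isProfile hk
  have hprof := hprof' s hs
  obtain ⟨K, hK1, hK⟩ := exists_height_bound k s hk
  have hk0 : (0 : ℝ) < k := by exact_mod_cast hk
  set v : ℝ := (1 / (2 * k)) ^ k / 18
  have hv : 0 < v := by positivity
  set C₃ : ℝ := κ / (100 * 2 ^ s)
  have hC₃ : 0 < C₃ := by positivity
  refine ⟨2 * K, C₃ * v, C₃, v, by positivity, by positivity, hC₃, hv, instClass k s κ,
    stageCost k, isLipCost_stageCost k, ?_, fun L M hL hM => ?_⟩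
  · rintro p ⟨σ, hσ, N, T, rfl⟩
    exact ⟨isEIISS_dyn (abs_eq_one_of_mem hσ) (hprof N T), isEIISS_closedLoop _ _ _⟩
  have hM0 : 0 < M := by linarith
  set r : ℝ := 1 / (10 * M)
  have hr0 : 0 ≤ r := by positivity
  have hr1 : r ≤ 1 := div_le_one_of_le₀ (by linarith) (by positivity)
  refine ⟨initLaw k r, inferInstance, isRegular_instClass hk hprof hr0 hr1, fun H n hH hn => ?_⟩
  obtain ⟨H, rfl⟩ := Nat.exists_eq_add_of_le' hH
  obtain ⟨n, rfl⟩ := Nat.exists_eq_add_of_le' hn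
  have hD := ae_initLaw_one hk hr0 hr1
  have hzero : ∀ p ∈ instClass k s κ, ∀ᵐ T ∂(trajLaw p.1.toPolicy p.2 (initLaw k r) (H + 2)),
      totalCost (stageCost k) T = 0 := by
    rintro p ⟨σ, hσ, N, T, rfl⟩
    exact trajLaw_expert_cost_zero σ _ (hprof N T).contDiff.continuous
      ((hprof N T).eq_zero 0 fun _ => rfl) hD (H + 2)
  have hprob : ∀ p ∈ instClass k s κ,
      MeasureTheory.IsProbabilityMeasure (sampleLaw p (initLaw k r) (H + 2) (n + 1)) ∧
      MeasureTheory.IsProbabilityMeasure (trajLaw p.1.toPolicy p.2 (initLaw k r) (H + 2)) := by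
    rintro p ⟨σ, hσ, N, T, rfl⟩
    have hg := hprof N T
    refine ⟨?_, ?_⟩
    · rw [sampleLaw_inst hk hg σ hr0 hr1]
      exact MeasureTheory.Measure.isProbabilityMeasure_map
        (measurable_expertSample hg _ _).aemeasurable
    · have e := trajLaw_expert σ (1 / (N + 1)) hg.contDiff.continuous
        (hg.eq_zero 0 fun _ => rfl) hD (H + 2)
      change MeasureTheory.IsProbabilityMeasure (trajLaw
        (expert σ (1 / (N + 1)) (profile k s κ N T)).toPolicy
        (dyn σ (profile k s κ N T)) (initLaw k r) (H + 2))
      rw [e]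
      exact MeasureTheory.Measure.isProbabilityMeasure_map
        (measurable_expertTraj _ hg.contDiff.continuous _).aemeasurable
  refine ⟨fun alg halg => isProper_isSimple hprof alg halg,
    ⟨learner k s κ (H + 1) n, learner_isProper k s κ (H + 1) n, fun p hp =>
      learner_risk_le hk hκ hκ1 hprof hK1 hK hr0 hr1 (H + 1) n hp⟩, fun alg halg => ?_,
    fun p hp => ?_, fun alg halg => ?_⟩
  · obtain ⟨σ, hσ, N, T, h⟩ := exists_inst_compounding hk hκ hκ1 hprof hL hM hn alg halg
    have hp : inst k s κ σ N T ∈ instClass k s κ := ⟨σ, hσ, N, T, rfl⟩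
    refine ⟨_, hp, ?_⟩
    have := (hprob _ hp).1
    have hτ := (compoundedError_pos (k := k) (s := s) (H := H + 2) hn hL hM).le
    have h2 := integral_costRisk_ge alg (measurable_dyn_profile hprof σ N T) (initLaw k r)
      (sampleLaw (inst k s κ σ N T) (initLaw k r) (H + 2) (n + 1)) (hzero _ hp)
      (mul_nonneg hC₃.le hτ) h
    refine le_trans (le_of_eq ?_) h2
    ring
  · have := (hprob p hp).2
    exact (MeasureTheory.mem_ae_iff_prob_eq_one
      (measurable_totalCost k (H + 2) (measurableSet_singleton 0))).1 (hzero p hp)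
  · obtain ⟨σ, hσ, N, T, h⟩ := exists_inst_compounding hk hκ hκ1 hprof hL hM hn alg halg
    exact ⟨_, ⟨σ, hσ, N, T, rfl⟩, h⟩
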